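/- **Definitions.** A *complex mixed Hodge structure* is a finite-dimensional complex vector space $V$ with a finite (exhaustive and separated) increasing filtration $W_\bullet$ and two finite decreasing filtrations $F'^\bullet, F''^\bullet$ (all indexed by $\mathbb Z$) such that $$\operatorname{gr}^p_{F'}\operatorname{gr}^q_{F''}\operatorname{gr}^W_n(V)=0\quad\text{for } n\neq p+q .$$ Morphisms are the linear maps that respect the three filtrations; the tensor product is $V\otimes_{\mathbb C} V'$ with the tensor product filtrations. Let $\operatorname{MHS}_{\mathbb C}$ be the resulting $\mathbb C$-linear symmetric monoidal category. Let $\operatorname{Bun}_\nabla(\mathbb A^2;\mathbb G_m^2)$ be the $\mathbb C$-linear symmetric monoidal category of complex algebraic vector bundles on $\mathbb A^2=\operatorname{Spec}\mathbb C[t_1,t_2]$ that are equivariant with respect to the standard action of $\mathbb G_m^2$ (by $t_i\mapsto\lambda_i t_i$) and are equipped with a $\mathbb G_m^2$-equivariant algebraic connection, not assumed flat; morphisms are the equivariant bundle homomorphisms compatible with the connections, and the tensor product is that of equivariant bundles with connection. Let $\Gamma=\operatorname{Gal}(\mathbb C/\mathbb R)=\{1,\sigma\}$. For a complex vector space $V$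 let $\sigma(V)=\{\sigma(v):v\in V\}$ be the complex conjugate space. The group $\Gamma$ acts on $\operatorname{MHS}_{\mathbb C}$ by $$\sigma(V,W_\bullet,F'^\bullet,F''^\bullet)=(\sigma(V),\sigma(W_\bullet),\sigma(F''^\bullet),\sigma(F'^\bullet)),$$ and on $\operatorname{Bun}_\nabla(\mathbb A^2;\mathbb G_m^2)$ through the antilinear involutions $\sigma(t_1,t_2)=(\overline{t_2},\overline{t_1})$ of $\mathbb A^2$ and $\sigma(\lambda_1,\lambda_2)=(\overline{\lambda_2},\overline{\lambda_1})$ of $\mathbb G_m^2$. In both cases $\sigma$ is an antilinear symmetric monoidal functor, with the evident coherent monoidal isomorphism $\sigma\sigma\cong 1$. **Theorem.** The categories $\operatorname{MHS}_{\mathbb C}$ and $\operatorname{Bun}_\nabla(\mathbb A^2;\mathbb G_m^2)$ are equivalent as tensor categories with $\Gamma$-action: there is a $\mathbb C$-linear symmetric monoidal equivalence $$\Phi:\operatorname{MHS}_{\mathbb C}\longrightarrow\operatorname{Bun}_\nabla(\mathbb A^2;\mathbb G_m^2)$$ together with a monoidal natural isomorphism $\gamma:\Phi\circ\sigma\cong\sigma\circ\Phi$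 compatible with the isomorphisms $\sigma\sigma\cong1$ of the two categories, i.e. $\Phi(\sigma\sigma X\cong X)$ is the composite $\Phi(\sigma\sigma X)\xrightarrow{\gamma_{\sigma X}}\sigma\Phi(\sigma X)\xrightarrow{\sigma(\gamma_X)}\sigma\sigma\Phi(X)\cong\Phi(X)$ for every $X$. -/

import Mathlib

open CategoryTheory MonoidalCategory TensorProduct

noncomputable section

namespace HodgeConn

section Filtrations

variable {V : Type} [AddCommGroup V] [Module ℂ V]

/-- The subquotient `A / (A ∩ B)` of a vector space. -/
abbrev SubQuot (A B : Submodule ℂ V) : Type := ↥A ⧸ B.submoduleOf A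

/-- The subspace of the subquotient `A / (A ∩ B)` induced by a subspace `C`: the image of `A ∩ C`. -/
def inducedSub (A B C : Submodule ℂ V) : Submodule ℂ (SubQuot A B) :=
  (C.submoduleOf A).map (B.submoduleOf A).mkQ

/-- `gr_n^W V = W_n / W_{n-1}` for an increasing filtration `W`. -/
abbrev grInc (W : ℤ → Submodule ℂ V) (n : ℤ) : Type := SubQuot (W n) (W (n - 1))

/-- The filtration induced by `F` on `gr_n^W V`. -/
def onGrInc (W : ℤ → Submodule ℂ V) (n : ℤ) (F : ℤ → Submodule ℂ V) (p : ℤ) :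
    Submodule ℂ (grInc W n) := inducedSub (W n) (W (n - 1)) (F p)

/-- `gr^p_F V = F^p / F^{p+1}` for a decreasing filtration `F`. -/
abbrev grDec (F : ℤ → Submodule ℂ V) (p : ℤ) : Type := SubQuot (F p) (F (p + 1))

/-- The filtration induced by `G` on `gr^p_F V`. -/
def onGrDec (F : ℤ → Submodule ℂ V) (p : ℤ) (G : ℤ → Submodule ℂ V) (q : ℤ) :
    Submodule ℂ (grDec F p) := inducedSub (F p) (F (p + 1)) (G q)

/-- `gr^p_{F'} gr^q_{F''} gr_n^W V`, each filtration being replaced by the one it induces on the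
successive subquotients. -/
abbrev grTriple (W F' F'' : ℤ → Submodule ℂ V) (p q n : ℤ) : Type :=
  grDec (onGrDec (onGrInc W n F'') q (onGrInc W n F')) p

/-- The three filtrations are opposite: `gr^p_{F'} gr^q_{F''} gr_n^W V = 0` for `n ≠ p + q`. -/
def Opposed (W F' F'' : ℤ → Submodule ℂ V) : Prop :=
  ∀ n p q : ℤ, n ≠ p + q → Subsingleton (grTriple W F' F'' p q n)

/-- A finite (exhaustive and separated) increasing filtration. -/
structure IsIncFiltration (W : ℤ → Submodule ℂ V) : Prop where
  mono : Monotone W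
  exists_top : ∃ n, W n = ⊤
  exists_bot : ∃ n, W n = ⊥

/-- A finite (exhaustive and separated) decreasing filtration. -/
structure IsDecFiltration (F : ℤ → Submodule ℂ V) : Prop where
  anti : Antitone F
  exists_top : ∃ n, F n = ⊤
  exists_bot : ∃ n, F n = ⊥

/-! ### Adapted bases: a working criterion for oppositeness -/

/-- A pair of bases with common bidegrees, the first splitting `W` and `F'`, the second splitting
`W` and `F''`, which agree modulo lower weight. -/
def Adapted (W F' F'' : ℤ → Submodule ℂ V) : Prop :=
  ∃ (ι : Type) (v w : Module.Basis ι ℂ V) (p q : ι → ℤ),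
    (∀ n, W n = Submodule.span ℂ (v '' {k | p k + q k ≤ n})) ∧
    (∀ n, W n = Submodule.span ℂ (w '' {k | p k + q k ≤ n})) ∧
    (∀ n, F' n = Submodule.span ℂ (v '' {k | n ≤ p k})) ∧
    (∀ n, F'' n = Submodule.span ℂ (w '' {k | n ≤ q k})) ∧
    (∀ k, v k - w k ∈ W (p k + q k - 1))

theorem subsingleton_subQuot_iff (A B : Submodule ℂ V) :
    Subsingleton (SubQuot A B) ↔ A ≤ B := by
  rw [Submodule.Quotient.subsingleton_iff, Submodule.submoduleOf_eq_top]

theorem mem_inducedSub {A B C : Submodule ℂ V} {x : SubQuot A B} :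
    x ∈ inducedSub A B C ↔ ∃ a : A, (a : V) ∈ C ∧ (B.submoduleOf A).mkQ a = x :=
  Iff.rfl

theorem inducedSub_le_iff (A B C C' : Submodule ℂ V) :
    inducedSub A B C ≤ inducedSub A B C' ↔ A ⊓ C ≤ (A ⊓ C') ⊔ B := by
  constructor
  · rintro h x ⟨hxA, hxC⟩
    have := h (mem_inducedSub.2 ⟨⟨x, hxA⟩, hxC, rfl⟩)
    obtain ⟨a, haC, ha⟩ := mem_inducedSub.1 this
    have h2 : (⟨x, hxA⟩ - a : A) ∈ B.submoduleOf A := by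
      rw [← Submodule.Quotient.eq]; exact ha.symm
    have h3 : x - (a : V) ∈ B := h2
    have : x = (a : V) + (x - a) := by abel
    rw [this]
    exact Submodule.add_mem_sup ⟨a.2, haC⟩ h3
  · intro h x hx
    obtain ⟨a, haC, rfl⟩ := mem_inducedSub.1 hx
    obtain ⟨y, hy, z, hz, hyz⟩ := Submodule.mem_sup.1 (h ⟨a.2, haC⟩)
    refine mem_inducedSub.2 ⟨⟨y, hy.1⟩, hy.2, ?_⟩
    refine (Submodule.Quotient.eq _).2 ?_
    change y - (a : V) ∈ B
    rw [← hyz]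
    simpa using hz

theorem inducedSub_mono {A B C C' : Submodule ℂ V} (h : C ≤ C') :
    inducedSub A B C ≤ inducedSub A B C' :=
  Submodule.map_mono (Submodule.comap_mono h)

theorem onGrInc_anti {W F : ℤ → Submodule ℂ V} (hF : Antitone F) (n : ℤ) :
    Antitone (onGrInc W n F) := fun _ _ h => inducedSub_mono (hF h)

theorem onGrInc_bot {W F : ℤ → Submodule ℂ V} (n a : ℤ) (h : F a = ⊥) :
    onGrInc W n F a = ⊥ := by
  rw [eq_bot_iff]
  intro x hx
  obtain ⟨y, hy, rfl⟩ := mem_inducedSub.1 hx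
  rw [h, Submodule.mem_bot] at hy
  have : y = 0 := Subtype.ext hy
  simp [this]

theorem onGrInc_top {W F : ℤ → Submodule ℂ V} (n a : ℤ) (h : F a = ⊤) :
    onGrInc W n F a = ⊤ := by
  rw [eq_top_iff]
  intro x _
  obtain ⟨y, rfl⟩ := Submodule.mkQ_surjective _ x
  exact mem_inducedSub.2 ⟨y, by simp [h], rfl⟩

theorem opposed_iff {W F' F'' : ℤ → Submodule ℂ V} :
    Opposed W F' F'' ↔ ∀ n p q : ℤ, n ≠ p + q →
      onGrInc W n F'' q ⊓ onGrInc W n F' p ≤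
        (onGrInc W n F'' q ⊓ onGrInc W n F' (p + 1)) ⊔ onGrInc W n F'' (q + 1) := by
  refine forall₄_congr fun n p q _ => ?_
  rw [subsingleton_subQuot_iff]
  exact inducedSub_le_iff _ _ _ _

theorem two_filtrations {F G : ℤ → Submodule ℂ V} (hF : IsDecFiltration F) (hG : IsDecFiltration G)
    (n : ℤ) (h : ∀ p q : ℤ, n ≠ p + q → G q ⊓ F p ≤ (G q ⊓ F (p + 1)) ⊔ G (q + 1)) :
    ∃ (κ : Type) (e : κ → V) (p : κ → ℤ), LinearIndependent ℂ e ∧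
      (∀ k, e k ∈ F (p k)) ∧ (∀ k, e k ∈ G (n - p k)) ∧
      (∀ a, F a ≤ Submodule.span ℂ (e '' {k | a ≤ p k})) ∧
      (∀ b, G b ≤ Submodule.span ℂ (e '' {k | b ≤ n - p k})) := by
  obtain ⟨P, hP⟩ := hF.exists_bot
  obtain ⟨Q, hQ⟩ := hG.exists_bot
  have step : ∀ p q : ℤ, n ≠ p + q → F p ⊓ G q ≤ (F (p + 1) ⊓ G q) ⊔ (F p ⊓ G (q + 1)) := by
    rintro p q hn x ⟨hx1, hx2⟩
    obtain ⟨y, hy, z, hz, rfl⟩ := Submodule.mem_sup.1 (h p q hn ⟨hx2, hx1⟩)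
    refine Submodule.add_mem_sup ⟨hy.2, hy.1⟩ ⟨?_, hz⟩
    have := (F p).sub_mem hx1 (hF.anti (by omega : p ≤ p + 1) hy.2)
    simpa using this
  let X : ℤ → Submodule ℂ V := fun a => F a ⊓ G (n - a)
  have botF : ∀ p, P ≤ p → F p = ⊥ := fun p hp => by
    rw [eq_bot_iff, ← hP]; exact hF.anti hp
  have botG : ∀ q, Q ≤ q → G q = ⊥ := fun q hq => by
    rw [eq_bot_iff, ← hQ]; exact hG.anti hq
  have key : ∀ (m : ℕ) (p q : ℤ), P + Q - p - q ≤ m →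
      (n < p + q → F p ⊓ G q = ⊥) ∧ F p ⊓ G q ≤ ⨆ a, ⨆ (_ : p ≤ a ∧ q ≤ n - a), X a := by
    intro m
    induction m with
    | zero =>
      intro p q hm
      have : F p ⊓ G q = ⊥ := by
        rcases le_or_gt P p with h1 | h1
        · rw [botF p h1, bot_inf_eq]
        · rw [botG q (by push_cast at hm; omega), inf_bot_eq]
      rw [this]; simp
    | succ m ih =>
      intro p q hm
      push_cast at hm
      by_cases hn : n = p + q
      · refine ⟨fun hh => by omega, ?_⟩
        refine le_iSup₂_of_le p ⟨le_rfl, by omega⟩ ?_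
        simp only [X]
        rw [show n - p = q by omega]
      · have h1 := ih (p + 1) q (by omega)
        have h2 := ih p (q + 1) (by omega)
        refine ⟨fun hh => ?_, ?_⟩
        · rw [eq_bot_iff]
          refine (step p q hn).trans ?_
          rw [h1.1 (by omega), h2.1 (by omega)]; simp
        · refine (step p q hn).trans (sup_le (h1.2.trans ?_) (h2.2.trans ?_))
          · exact iSup₂_le fun a ha => le_iSup₂_of_le a ⟨by omega, ha.2⟩ le_rfl
          · exact iSup₂_le fun a ha => le_iSup₂_of_le a ⟨ha.1, by omega⟩ le_rfl
  have hA : ∀ p q : ℤ, n < p + q → F p ⊓ G q = ⊥ := fun p q hh =>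
    (key (P + Q - p - q).toNat p q (Int.self_le_toNat _)).1 hh
  have hB : ∀ p q : ℤ, F p ⊓ G q ≤ ⨆ a, ⨆ (_ : p ≤ a ∧ q ≤ n - a), X a := fun p q =>
    (key (P + Q - p - q).toNat p q (Int.self_le_toNat _)).2
  obtain ⟨P0, hP0⟩ := hF.exists_top
  obtain ⟨Q0, hQ0⟩ := hG.exists_top
  have hFX : ∀ p, F p ≤ ⨆ a, ⨆ (_ : p ≤ a), X a := fun p => by
    have := hB p Q0
    rw [hQ0, inf_top_eq] at this
    exact this.trans (iSup₂_le fun a ha => le_iSup₂_of_le a ha.1 le_rfl)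
  have hGX : ∀ q, G q ≤ ⨆ a, ⨆ (_ : q ≤ n - a), X a := fun q => by
    have := hB P0 q
    rw [hP0, top_inf_eq] at this
    exact this.trans (iSup₂_le fun a ha => le_iSup₂_of_le a ha.2 le_rfl)
  have hind : iSupIndep X := by
    intro a
    rw [Submodule.disjoint_def]
    intro y hy hy'
    have : (⨆ j, ⨆ (_ : j ≠ a), X j) ≤ F (a + 1) ⊔ G (n - a + 1) := by
      refine iSup₂_le fun j hj => ?_
      rcases lt_or_gt_of_ne hj with h1 | h1
      · exact le_sup_of_le_right (inf_le_right.trans (hG.anti (by omega)))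
      · exact le_sup_of_le_left (inf_le_left.trans (hF.anti (by omega)))
    obtain ⟨u, hu, z, hz, huz⟩ := Submodule.mem_sup.1 (this hy')
    have hu0 : u = 0 := by
      have : u ∈ F (a + 1) ⊓ G (n - a) := ⟨hu, by
        have h3 := (G (n - a)).sub_mem hy.2 (hG.anti (by omega : n - a ≤ n - a + 1) hz)
        rw [← huz] at h3; simpa using h3⟩
      rw [hA _ _ (by omega)] at this
      simpa using this
    have : y ∈ F a ⊓ G (n - a + 1) := ⟨hy.1, by rw [← huz, hu0, zero_add]; exact hz⟩
    rw [hA _ _ (by omega)] at this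
    simpa using this
  have htop : ⨆ a, X a = ⊤ := by
    rw [eq_top_iff, ← hP0]
    exact (hFX P0).trans (iSup₂_le fun a _ => le_iSup X a)
  have hint := DirectSum.isInternal_submodule_of_iSupIndep_of_iSup_eq_top hind htop
  let b : ∀ a, Module.Basis (Module.Free.ChooseBasisIndex ℂ (X a)) ℂ (X a) := fun a =>
    Module.Free.chooseBasis ℂ (X a)
  have hXspan : ∀ (S : Set ℤ) (a : ℤ), a ∈ S → X a ≤ Submodule.span ℂ
      ((hint.collectedBasis b) '' {k | k.1 ∈ S}) := by
    intro S a ha x hx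
    have h1 : (⟨x, hx⟩ : X a) ∈ Submodule.span ℂ (Set.range (b a)) := by
      rw [(b a).span_eq]; trivial
    have h2 := Submodule.mem_map_of_mem (f := (X a).subtype) h1
    rw [Submodule.map_span] at h2
    refine Submodule.span_mono ?_ h2
    rintro _ ⟨_, ⟨k, rfl⟩, rfl⟩
    exact ⟨⟨a, k⟩, ha, by simp [DirectSum.IsInternal.collectedBasis_coe]⟩
  refine ⟨_, hint.collectedBasis b, fun k => k.1, (hint.collectedBasis b).linearIndependent,
    fun k => (hint.collectedBasis_mem b k).1, fun k => (hint.collectedBasis_mem b k).2, ?_, ?_⟩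
  · exact fun a => (hFX a).trans (iSup₂_le fun a' ha' => hXspan {j | a ≤ j} a' ha')
  · exact fun q => (hGX q).trans (iSup₂_le fun a' ha' => hXspan {j | q ≤ n - j} a' ha')

theorem linearIndependent_of_graded {W : ℤ → Submodule ℂ V} (hW : Monotone W)
    {κ : ℤ → Type} (e : ∀ n, κ n → grInc W n) (he : ∀ n, LinearIndependent ℂ (e n))
    (v : (Σ n, κ n) → V) (hv : ∀ k, v k ∈ W k.1)
    (hve : ∀ k, ((W (k.1 - 1)).submoduleOf (W k.1)).mkQ ⟨v k, hv k⟩ = e k.1 k.2) :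
    LinearIndependent ℂ v := by
  classical
  have dual : ∀ k0 : Σ n, κ n, ∃ ψ : V →ₗ[ℂ] ℂ, ψ (v k0) = 1 ∧
      ∀ k : Σ n, κ n, k.1 ≤ k0.1 → k ≠ k0 → ψ (v k) = 0 := by
    rintro ⟨n, i⟩
    obtain ⟨φ, hφ⟩ := LinearMap.exists_extend ((Module.Basis.span (he n)).coord i)
    obtain ⟨ψ, hψ⟩ := LinearMap.exists_extend (φ ∘ₗ ((W (n - 1)).submoduleOf (W n)).mkQ)
    have hφe : ∀ j, φ (e n j) = if j = i then 1 else 0 := by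
      intro j
      have h1 := LinearMap.congr_fun hφ (Module.Basis.span (he n) j)
      rw [LinearMap.comp_apply, Submodule.subtype_apply, Module.Basis.coord_apply,
        Module.Basis.repr_self, Finsupp.single_apply, Module.Basis.span_apply] at h1
      exact h1
    have hψW : ∀ (x : V) (hx : x ∈ W n), ψ x = φ (((W (n - 1)).submoduleOf (W n)).mkQ ⟨x, hx⟩) :=
      fun x hx => LinearMap.congr_fun hψ ⟨x, hx⟩
    have hψv : ∀ j, ψ (v ⟨n, j⟩) = if j = i then 1 else 0 := fun j => by
      rw [hψW _ (hv ⟨n, j⟩), hve ⟨n, j⟩, hφe]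
    refine ⟨ψ, by simp [hψv], ?_⟩
    rintro ⟨m, j⟩ hm hne
    rcases eq_or_lt_of_le hm with h1 | h1
    · dsimp only at h1
      subst h1
      rw [hψv, if_neg]
      rintro rfl; exact hne rfl
    · dsimp only at h1
      have hmn : m ≤ n - 1 := by omega
      have h2 : v ⟨m, j⟩ ∈ W (n - 1) := hW hmn (hv ⟨m, j⟩)
      have h3 : v ⟨m, j⟩ ∈ W n := hW (by omega) h2
      rw [hψW _ h3]
      have : ((W (n - 1)).submoduleOf (W n)).mkQ ⟨v ⟨m, j⟩, h3⟩ = 0 := by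
        rw [Submodule.mkQ_apply, Submodule.Quotient.mk_eq_zero]; exact h2
      rw [this, map_zero]
  rw [linearIndependent_iff]
  intro l hl
  by_contra hne
  obtain ⟨k0, hk0, hmax⟩ := Finset.exists_max_image l.support (fun k => k.1)
    (Finsupp.support_nonempty_iff.2 hne)
  obtain ⟨ψ, h1, h0⟩ := dual k0
  have h2 := congrArg ψ hl
  rw [map_zero, Finsupp.linearCombination_apply, Finsupp.sum, map_sum,
    Finset.sum_eq_single_of_mem k0 hk0] at h2
  · rw [map_smul, h1, smul_eq_mul, mul_one] at h2
    exact (Finsupp.mem_support_iff.1 hk0) h2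
  · intro k hk hkne
    rw [map_smul, h0 k (hmax k hk) hkne, smul_zero]

theorem span_of_graded {W F : ℤ → Submodule ℂ V} (hW : IsIncFiltration W) (hF : Antitone F)
    {κ : ℤ → Type} (e : ∀ n, κ n → grInc W n) (d : (Σ n, κ n) → ℤ)
    (hspan : ∀ n a, onGrInc W n F a ≤ Submodule.span ℂ (e n '' {k | a ≤ d ⟨n, k⟩}))
    (v : (Σ n, κ n) → V) (hv : ∀ k, v k ∈ W k.1) (hvF : ∀ k, v k ∈ F (d k))
    (hve : ∀ k, ((W (k.1 - 1)).submoduleOf (W k.1)).mkQ ⟨v k, hv k⟩ = e k.1 k.2) (n a : ℤ) :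
    F a ⊓ W n ≤ Submodule.span ℂ (v '' {k | a ≤ d k ∧ k.1 ≤ n}) := by
  obtain ⟨N, hN⟩ := hW.exists_bot
  have key : ∀ (m : ℕ) (n : ℤ), n - N ≤ m →
      F a ⊓ W n ≤ Submodule.span ℂ (v '' {k | a ≤ d k ∧ k.1 ≤ n}) := by
    intro m
    induction m with
    | zero =>
      intro n hn x hx
      have : x ∈ W N := hW.mono (by push_cast at hn; omega) hx.2
      rw [hN, Submodule.mem_bot] at this
      rw [this]; exact Submodule.zero_mem _
    | succ m ih =>
      rintro n hn x ⟨hxF, hxW⟩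
      push_cast at hn
      have h1 := hspan n a (mem_inducedSub.2 ⟨⟨x, hxW⟩, hxF, rfl⟩)
      have h2 : Submodule.span ℂ (e n '' {k | a ≤ d ⟨n, k⟩}) ≤
          ((F a ⊓ W n ⊓ Submodule.span ℂ (v '' {k | a ≤ d k ∧ k.1 ≤ n})).submoduleOf (W n)).map
            ((W (n - 1)).submoduleOf (W n)).mkQ := by
        rw [Submodule.span_le]
        rintro _ ⟨k, hk, rfl⟩
        refine ⟨⟨v ⟨n, k⟩, hv ⟨n, k⟩⟩, ⟨⟨?_, hv ⟨n, k⟩⟩, ?_⟩, hve ⟨n, k⟩⟩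
        · exact hF hk (hvF _)
        · exact Submodule.subset_span ⟨⟨n, k⟩, ⟨hk, le_rfl⟩, rfl⟩
      obtain ⟨y, ⟨⟨hyF, hyW⟩, hyS⟩, hy⟩ := h2 h1
      have h3 : (⟨x, hxW⟩ - y : W n) ∈ (W (n - 1)).submoduleOf (W n) := by
        rw [← Submodule.Quotient.eq]; exact hy.symm
      have h4 : x - (y : V) ∈ F a ⊓ W (n - 1) := ⟨(F a).sub_mem hxF hyF, h3⟩
      have h5 := ih (n - 1) (by omega) h4
      have h6 : x = (x - y) + y := by abel
      rw [h6]
      refine Submodule.add_mem _ (Submodule.span_mono (Set.image_mono ?_) h5) hyS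
      exact fun k hk => ⟨hk.1, by have := hk.2; omega⟩
  exact key (n - N).toNat n (Int.self_le_toNat _)

theorem Opposed.adapted {W F' F'' : ℤ → Submodule ℂ V} (hW : IsIncFiltration W)
    (h' : IsDecFiltration F') (h'' : IsDecFiltration F'') (h : Opposed W F' F'') :
    Adapted W F' F'' := by
  rw [opposed_iff] at h
  have ex : ∀ n : ℤ, _ := fun n => two_filtrations (F := onGrInc W n F') (G := onGrInc W n F'')
    ⟨onGrInc_anti h'.anti n, h'.exists_top.imp fun _ => onGrInc_top n _,
      h'.exists_bot.imp fun _ => onGrInc_bot n _⟩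
    ⟨onGrInc_anti h''.anti n, h''.exists_top.imp fun _ => onGrInc_top n _,
      h''.exists_bot.imp fun _ => onGrInc_bot n _⟩ n (h n)
  choose κ e p hli hF hG hFs hGs using ex
  have hv : ∀ k : Σ n, κ n, ∃ a : W k.1, (a : V) ∈ F' (p k.1 k.2) ∧
      ((W (k.1 - 1)).submoduleOf (W k.1)).mkQ a = e k.1 k.2 := fun k =>
    mem_inducedSub.1 (hF k.1 k.2)
  have hw : ∀ k : Σ n, κ n, ∃ a : W k.1, (a : V) ∈ F'' (k.1 - p k.1 k.2) ∧
      ((W (k.1 - 1)).submoduleOf (W k.1)).mkQ a = e k.1 k.2 := fun k =>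
    mem_inducedSub.1 (hG k.1 k.2)
  choose v hvF hve using hv
  choose w hwG hwe using hw
  have liv : LinearIndependent ℂ fun k => (v k : V) :=
    linearIndependent_of_graded hW.mono e hli _ (fun k => (v k).2) hve
  have liw : LinearIndependent ℂ fun k => (w k : V) :=
    linearIndependent_of_graded hW.mono e hli _ (fun k => (w k).2) hwe
  have sv := span_of_graded hW h'.anti e (fun k => p k.1 k.2) hFs _ (fun k => (v k).2) hvF hve
  have sw := span_of_graded hW h''.anti e (fun k => k.1 - p k.1 k.2) hGs _ (fun k => (w k).2)
    hwG hwe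
  obtain ⟨N, hN⟩ := hW.exists_top
  obtain ⟨P, hP⟩ := h'.exists_top
  obtain ⟨Q, hQ⟩ := h''.exists_top
  have svF : ∀ a, F' a = Submodule.span ℂ ((fun k => (v k : V)) '' {k | a ≤ p k.1 k.2}) := by
    intro a
    apply le_antisymm
    · have := sv N a
      rw [hN, inf_top_eq] at this
      exact this.trans (Submodule.span_mono (Set.image_mono fun k hk => hk.1))
    · rw [Submodule.span_le]
      rintro _ ⟨k, hk, rfl⟩
      exact h'.anti hk (hvF k)
  have swF : ∀ a, F'' a = Submodule.span ℂ ((fun k => (w k : V)) '' {k | a ≤ k.1 - p k.1 k.2}) := by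
    intro a
    apply le_antisymm
    · have := sw N a
      rw [hN, inf_top_eq] at this
      exact this.trans (Submodule.span_mono (Set.image_mono fun k hk => hk.1))
    · rw [Submodule.span_le]
      rintro _ ⟨k, hk, rfl⟩
      exact h''.anti hk (hwG k)
  have svW : ∀ n, W n = Submodule.span ℂ ((fun k => (v k : V)) '' {k | k.1 ≤ n}) := by
    intro n
    apply le_antisymm
    · have := sv n P
      rw [hP, top_inf_eq] at this
      exact this.trans (Submodule.span_mono (Set.image_mono fun k hk => hk.2))
    · rw [Submodule.span_le]
      rintro _ ⟨k, hk, rfl⟩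
      exact hW.mono hk (v k).2
  have swW : ∀ n, W n = Submodule.span ℂ ((fun k => (w k : V)) '' {k | k.1 ≤ n}) := by
    intro n
    apply le_antisymm
    · have := sw n Q
      rw [hQ, top_inf_eq] at this
      exact this.trans (Submodule.span_mono (Set.image_mono fun k hk => hk.2))
    · rw [Submodule.span_le]
      rintro _ ⟨k, hk, rfl⟩
      exact hW.mono hk (w k).2
  refine ⟨Σ n, κ n, Module.Basis.mk liv ?_, Module.Basis.mk liw ?_, fun k => p k.1 k.2,
    fun k => k.1 - p k.1 k.2, ?_, ?_, ?_, ?_, ?_⟩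
  · rw [← hN, svW]; exact Submodule.span_mono (Set.image_subset_range _ _)
  · rw [← hN, swW]; exact Submodule.span_mono (Set.image_subset_range _ _)
  · intro n; simpa using svW n
  · intro n; simpa using swW n
  · intro n; simpa using svF n
  · intro n; simpa using swF n
  · intro k
    have : (v k - w k : W k.1) ∈ (W (k.1 - 1)).submoduleOf (W k.1) := by
      rw [← Submodule.Quotient.eq]; exact (hve k).trans (hwe k).symm
    simpa using (show (v k : V) - w k ∈ W (k.1 - 1) from this)

theorem Adapted.opposed {W F' F'' : ℤ → Submodule ℂ V} (h : Adapted W F' F'') :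
    Opposed W F' F'' := by
  obtain ⟨ι, v, w, p, q, hWv, hWw, hF', hF'', hvw⟩ := h
  have hWmono : Monotone W := fun a b hab => by
    rw [hWv, hWv]; exact Submodule.span_mono (Set.image_mono fun k hk => le_trans hk hab)
  have hvW : ∀ k, v k ∈ W (p k + q k) := fun k => by
    rw [hWv]; exact Submodule.subset_span ⟨k, le_refl (_ : ℤ), rfl⟩
  have hwW : ∀ k, w k ∈ W (p k + q k) := fun k => by
    rw [hWw]; exact Submodule.subset_span ⟨k, le_refl (_ : ℤ), rfl⟩
  have reprW : ∀ n x, x ∈ W n → ∀ k, n < p k + q k → v.repr x k = 0 := by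
    intro n x hx k hk
    rw [hWv, Module.Basis.mem_span_image] at hx
    by_contra hne
    have := hx (Finsupp.mem_support_iff.2 hne)
    simp only [Set.mem_ofPred_eq] at this
    omega
  have coord_eq : ∀ n x, x ∈ W n → ∀ k, p k + q k = n → v.repr x k = w.repr x k := by
    classical
    intro n x hx k hk
    have : W n ≤ LinearMap.ker (v.coord k - w.coord k) := by
      rw [hWw, Submodule.span_le]
      rintro _ ⟨j, hj, rfl⟩
      have h1 := reprW _ _ (hvw j) k (by have : p j + q j ≤ n := hj; omega)
      rw [map_sub, Finsupp.sub_apply, sub_eq_zero, Module.Basis.repr_self] at h1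
      simp only [SetLike.mem_coe, LinearMap.mem_ker, LinearMap.sub_apply, Module.Basis.coord_apply,
        Module.Basis.repr_self, ← h1, sub_self]
    have h2 := this hx
    simpa [LinearMap.mem_ker, sub_eq_zero] using h2
  rw [opposed_iff]
  rintro n a b hn x ⟨hxG, hxF⟩
  obtain ⟨f, hfF, rfl⟩ := mem_inducedSub.1 hxF
  obtain ⟨g, hgG, hg⟩ := mem_inducedSub.1 hxG
  have hfg : (g : V) - f ∈ W (n - 1) :=
    (Submodule.Quotient.eq ((W (n - 1)).submoduleOf (W n))).1 hg
  set S := (onGrInc W n F'' b ⊓ onGrInc W n F' (a + 1)) ⊔ onGrInc W n F'' (b + 1) with hS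
  have hspan : (f : V) ∈ Submodule.span ℂ (v '' (v.repr f).support) :=
    v.mem_span_image.2 subset_rfl
  have hle : Submodule.span ℂ (v '' (v.repr f).support) ≤
      (S.comap ((W (n - 1)).submoduleOf (W n)).mkQ).map (W n).subtype := by
    rw [Submodule.span_le]
    rintro _ ⟨k, hk, rfl⟩
    have hkW : p k + q k ≤ n := by
      by_contra hlt
      exact Finsupp.mem_support_iff.1 hk (reprW n f f.2 k (not_le.1 hlt))
    have hkF : a ≤ p k := by
      rw [hF', Module.Basis.mem_span_image] at hfF
      exact hfF hk
    have hvk : v k ∈ W n := hWmono hkW (hvW k)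
    have hwk : w k ∈ W n := hWmono hkW (hwW k)
    refine ⟨⟨v k, hvk⟩, ?_, rfl⟩
    change ((W (n - 1)).submoduleOf (W n)).mkQ ⟨v k, hvk⟩ ∈ S
    rcases lt_or_eq_of_le hkW with hlt | heq
    · have : ((W (n - 1)).submoduleOf (W n)).mkQ ⟨v k, hvk⟩ = 0 := by
        rw [Submodule.mkQ_apply, Submodule.Quotient.mk_eq_zero]
        exact hWmono (by omega : p k + q k ≤ n - 1) (hvW k)
      rw [this]; exact Submodule.zero_mem _
    · have hkG : b ≤ q k := by
        have h1 := reprW _ _ hfg k (by omega)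
        rw [map_sub, Finsupp.sub_apply, sub_eq_zero, coord_eq n g g.2 k heq] at h1
        rw [hF'', Module.Basis.mem_span_image] at hgG
        refine hgG (Finsupp.mem_support_iff.2 ?_)
        rw [h1]; exact Finsupp.mem_support_iff.1 hk
      have hcl : ((W (n - 1)).submoduleOf (W n)).mkQ ⟨w k, hwk⟩ =
          ((W (n - 1)).submoduleOf (W n)).mkQ ⟨v k, hvk⟩ := by
        refine ((Submodule.Quotient.eq _).2 ?_).symm
        have := hvw k
        rw [heq] at this
        exact this
      have hwG : ∀ c, c ≤ q k → w k ∈ F'' c := fun c hc => by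
        rw [hF'']; exact Submodule.subset_span ⟨k, hc, rfl⟩
      by_cases hq : b + 1 ≤ q k
      · exact Submodule.mem_sup_right (mem_inducedSub.2 ⟨⟨w k, hwk⟩, hwG _ hq, hcl⟩)
      · refine Submodule.mem_sup_left ⟨mem_inducedSub.2 ⟨⟨w k, hwk⟩, hwG _ hkG, hcl⟩,
          mem_inducedSub.2 ⟨⟨v k, hvk⟩, ?_, rfl⟩⟩
        rw [hF']; exact Submodule.subset_span ⟨k, by simp only [Set.mem_ofPred_eq]; omega, rfl⟩
  obtain ⟨y, hy, hyf⟩ := hle hspan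
  have : y = f := Subtype.ext hyf
  rw [← this]; exact hy

theorem Adapted.swap {W F' F'' : ℤ → Submodule ℂ V} (h : Adapted W F' F'') :
    Adapted W F'' F' := by
  obtain ⟨ι, v, w, p, q, hWv, hWw, hF', hF'', hvw⟩ := h
  refine ⟨ι, w, v, q, p, ?_, ?_, hF'', hF', fun k => ?_⟩
  · simpa only [add_comm] using hWw
  · simpa only [add_comm] using hWv
  · rw [← neg_sub (v k), add_comm (q k)]
    exact Submodule.neg_mem _ (hvw k)

end Filtrations

section TensorFiltration

variable {V V' : Type} [AddCommGroup V] [Module ℂ V] [AddCommGroup V'] [Module ℂ V']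

/-- The tensor product of two filtrations: `(A ⊗ B)_n = ∑_{i + j = n} A_i ⊗ B_j`. -/
def tensorFil (A : ℤ → Submodule ℂ V) (B : ℤ → Submodule ℂ V') (n : ℤ) :
    Submodule ℂ (V ⊗[ℂ] V') :=
  ⨆ i : ℤ, Submodule.map₂ (TensorProduct.mk ℂ V V') (A i) (B (n - i))

theorem tmul_mem_tensorFil {A : ℤ → Submodule ℂ V} {B : ℤ → Submodule ℂ V'} {i j n : ℤ}
    (h : i + j = n) {x : V} {y : V'} (hx : x ∈ A i) (hy : y ∈ B j) :
    x ⊗ₜ[ℂ] y ∈ tensorFil A B n :=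
  Submodule.mem_iSup_of_mem i
    (Submodule.apply_mem_map₂ _ hx (by rwa [show n - i = j by omega]))

theorem tensorFil_le {A : ℤ → Submodule ℂ V} {B : ℤ → Submodule ℂ V'} {n : ℤ}
    {S : Submodule ℂ (V ⊗[ℂ] V')}
    (h : ∀ i j, i + j = n → ∀ x ∈ A i, ∀ y ∈ B j, x ⊗ₜ[ℂ] y ∈ S) : tensorFil A B n ≤ S :=
  iSup_le fun i => Submodule.map₂_le.2 fun x hx y hy => h i (n - i) (by omega) x hx y hy

theorem tensorFil_top {A : ℤ → Submodule ℂ V} {B : ℤ → Submodule ℂ V'}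
    (hA : ∃ n, A n = ⊤) (hB : ∃ n, B n = ⊤) : ∃ n, tensorFil A B n = ⊤ := by
  obtain ⟨a, ha⟩ := hA
  obtain ⟨b, hb⟩ := hB
  refine ⟨a + b, ?_⟩
  rw [eq_top_iff, ← TensorProduct.span_tmul_eq_top, Submodule.span_le]
  rintro _ ⟨x, y, rfl⟩
  exact tmul_mem_tensorFil rfl (by simp [ha]) (by simp [hb])

theorem IsIncFiltration.tensor {A : ℤ → Submodule ℂ V} {B : ℤ → Submodule ℂ V'}
    (hA : IsIncFiltration A) (hB : IsIncFiltration B) : IsIncFiltration (tensorFil A B) where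
  mono m n h := tensorFil_le fun i j hij x hx y hy =>
    tmul_mem_tensorFil (j := n - i) (by omega) hx (hB.mono (by omega) hy)
  exists_top := tensorFil_top hA.exists_top hB.exists_top
  exists_bot := by
    obtain ⟨a, ha⟩ := hA.exists_bot
    obtain ⟨b, hb⟩ := hB.exists_bot
    refine ⟨a + b, eq_bot_iff.2 (tensorFil_le fun i j hij x hx y hy => ?_)⟩
    rcases le_total i a with h | h
    · have := hA.mono h hx
      rw [ha, Submodule.mem_bot] at this
      simp [this]
    · have := hB.mono (by omega : j ≤ b) hy
      rw [hb, Submodule.mem_bot] at this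
      simp [this]

theorem IsDecFiltration.tensor {A : ℤ → Submodule ℂ V} {B : ℤ → Submodule ℂ V'}
    (hA : IsDecFiltration A) (hB : IsDecFiltration B) : IsDecFiltration (tensorFil A B) where
  anti m n h := tensorFil_le fun i j hij x hx y hy =>
    tmul_mem_tensorFil (j := m - i) (by omega) hx (hB.anti (by omega) hy)
  exists_top := tensorFil_top hA.exists_top hB.exists_top
  exists_bot := by
    obtain ⟨a, ha⟩ := hA.exists_bot
    obtain ⟨b, hb⟩ := hB.exists_bot
    refine ⟨a + b, eq_bot_iff.2 (tensorFil_le fun i j hij x hx y hy => ?_)⟩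
    rcases le_total a i with h | h
    · have := hA.anti h hx
      rw [ha, Submodule.mem_bot] at this
      simp [this]
    · have := hB.anti (by omega : b ≤ j) hy
      rw [hb, Submodule.mem_bot] at this
      simp [this]

theorem tmul_mem_span_image {ι ι' : Type} {v : ι → V} {v' : ι' → V'} {s : Set ι} {s' : Set ι'}
    {t : Set (ι × ι')} (u : ι × ι' → V ⊗[ℂ] V') (hu : ∀ k, u k = v k.1 ⊗ₜ v' k.2)
    (hst : ∀ k ∈ s, ∀ k' ∈ s', (k, k') ∈ t) {x : V} {y : V'}
    (hx : x ∈ Submodule.span ℂ (v '' s)) (hy : y ∈ Submodule.span ℂ (v' '' s')) :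
    x ⊗ₜ[ℂ] y ∈ Submodule.span ℂ (u '' t) := by
  have h := Submodule.apply_mem_map₂ (TensorProduct.mk ℂ V V') hx hy
  rw [Submodule.map₂_span_span] at h
  refine Submodule.span_mono ?_ h
  rintro _ ⟨_, ⟨k, hk, rfl⟩, _, ⟨k', hk', rfl⟩, rfl⟩
  exact ⟨(k, k'), hst k hk k' hk', hu _⟩

theorem tensorFil_span_inc {ι ι' : Type} {A : ℤ → Submodule ℂ V} {B : ℤ → Submodule ℂ V'}
    (v : ι → V) (v' : ι' → V') (d : ι → ℤ) (d' : ι' → ℤ)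
    (u : ι × ι' → V ⊗[ℂ] V') (hu : ∀ k, u k = v k.1 ⊗ₜ v' k.2)
    (hA : ∀ n, A n = Submodule.span ℂ (v '' {k | d k ≤ n}))
    (hB : ∀ n, B n = Submodule.span ℂ (v' '' {k | d' k ≤ n})) (n : ℤ) :
    tensorFil A B n = Submodule.span ℂ (u '' {k | d k.1 + d' k.2 ≤ n}) := by
  apply le_antisymm
  · refine tensorFil_le fun i j hij x hx y hy => ?_
    rw [hA] at hx
    rw [hB] at hy
    refine tmul_mem_span_image u hu (fun k hk k' hk' => ?_) hx hy
    simp only [Set.mem_ofPred_eq] at hk hk' ⊢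
    omega
  · rw [Submodule.span_le]
    rintro _ ⟨k, hk, rfl⟩
    simp only [Set.mem_ofPred_eq] at hk
    rw [hu]
    refine tmul_mem_tensorFil (i := d k.1) (j := n - d k.1) (by omega) ?_ ?_
    · rw [hA]; exact Submodule.subset_span ⟨k.1, le_refl (_ : ℤ), rfl⟩
    · rw [hB]; exact Submodule.subset_span ⟨k.2, by simp only [Set.mem_ofPred_eq]; omega, rfl⟩

theorem tensorFil_span_dec {ι ι' : Type} {A : ℤ → Submodule ℂ V} {B : ℤ → Submodule ℂ V'}
    (v : ι → V) (v' : ι' → V') (d : ι → ℤ) (d' : ι' → ℤ)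
    (u : ι × ι' → V ⊗[ℂ] V') (hu : ∀ k, u k = v k.1 ⊗ₜ v' k.2)
    (hA : ∀ n, A n = Submodule.span ℂ (v '' {k | n ≤ d k}))
    (hB : ∀ n, B n = Submodule.span ℂ (v' '' {k | n ≤ d' k})) (n : ℤ) :
    tensorFil A B n = Submodule.span ℂ (u '' {k | n ≤ d k.1 + d' k.2}) := by
  apply le_antisymm
  · refine tensorFil_le fun i j hij x hx y hy => ?_
    rw [hA] at hx
    rw [hB] at hy
    refine tmul_mem_span_image u hu (fun k hk k' hk' => ?_) hx hy
    simp only [Set.mem_ofPred_eq] at hk hk' ⊢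
    omega
  · rw [Submodule.span_le]
    rintro _ ⟨k, hk, rfl⟩
    simp only [Set.mem_ofPred_eq] at hk
    rw [hu]
    refine tmul_mem_tensorFil (i := d k.1) (j := n - d k.1) (by omega) ?_ ?_
    · rw [hA]; exact Submodule.subset_span ⟨k.1, le_refl (_ : ℤ), rfl⟩
    · rw [hB]; exact Submodule.subset_span ⟨k.2, by simp only [Set.mem_ofPred_eq]; omega, rfl⟩

theorem Adapted.tensor {W F' F'' : ℤ → Submodule ℂ V} {X G' G'' : ℤ → Submodule ℂ V'}
    (h : Adapted W F' F'') (h' : Adapted X G' G'') :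
    Adapted (tensorFil W X) (tensorFil F' G') (tensorFil F'' G'') := by
  obtain ⟨ι, v, w, p, q, hWv, hWw, hF', hF'', hvw⟩ := h
  obtain ⟨κ, x, y, a, b, hXx, hXy, hG', hG'', hxy⟩ := h'
  have hvt : ∀ k, v.tensorProduct x k = v k.1 ⊗ₜ x k.2 := fun k => v.tensorProduct_apply' x k
  have hwt : ∀ k, w.tensorProduct y k = w k.1 ⊗ₜ y k.2 := fun k => w.tensorProduct_apply' y k
  refine ⟨ι × κ, v.tensorProduct x, w.tensorProduct y, fun k => p k.1 + a k.2,
    fun k => q k.1 + b k.2, fun n => ?_, fun n => ?_, fun n => ?_, fun n => ?_, fun k => ?_⟩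
  · rw [tensorFil_span_inc v x _ _ _ hvt hWv hXx]
    simp only [add_add_add_comm]
  · rw [tensorFil_span_inc w y _ _ _ hwt hWw hXy]
    simp only [add_add_add_comm]
  · exact tensorFil_span_dec v x _ _ _ hvt hF' hG' n
  · exact tensorFil_span_dec w y _ _ _ hwt hF'' hG'' n
  · rw [hvt, hwt]
    have e : v k.1 ⊗ₜ[ℂ] x k.2 - w k.1 ⊗ₜ[ℂ] y k.2 =
        (v k.1 - w k.1) ⊗ₜ[ℂ] x k.2 + w k.1 ⊗ₜ[ℂ] (x k.2 - y k.2) := by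
      rw [TensorProduct.sub_tmul, TensorProduct.tmul_sub]; abel
    rw [e]
    refine Submodule.add_mem _ (tmul_mem_tensorFil ?_ (hvw k.1) (j := a k.2 + b k.2) ?_)
      (tmul_mem_tensorFil ?_ (i := p k.1 + q k.1) ?_ (hxy k.2))
    · ring
    · rw [hXx]; exact Submodule.subset_span ⟨k.2, le_refl (_ : ℤ), rfl⟩
    · ring
    · rw [hWw]; exact Submodule.subset_span ⟨k.1, le_refl (_ : ℤ), rfl⟩

end TensorFiltration

/-! ### Complex conjugate modules -/

/-- The complex conjugate `σ(M)` of `M`: its elements are the symbols `σ(m)`, `m ∈ M`. -/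
structure Conj (M : Type) : Type where
  /-- the symbol `σ(m)` -/
  mk ::
  /-- the element `m` of `σ(m)` -/
  val : M

/-- The bijection `σ(m) ↦ m`. -/
def conjVal (M : Type) : Conj M ≃ M := ⟨Conj.val, Conj.mk, fun _ => rfl, fun _ => rfl⟩

/-- `σ(m) + σ(m') = σ(m + m')`. -/
instance (M : Type) [AddCommGroup M] : AddCommGroup (Conj M) := (conjVal M).addCommGroup

/-- The additive bijection `m ↦ σ(m)`. -/
def toConj (M : Type) [AddCommGroup M] : M ≃+ Conj M :=
  { (conjVal M).symm with map_add' := fun _ _ => rfl }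

/-- `λ σ(m) = σ(conj(λ) m)`. -/
instance (M : Type) [AddCommGroup M] [Module ℂ M] : Module ℂ (Conj M) where
  smul c x := ⟨starRingEnd ℂ c • x.val⟩
  one_smul x := congrArg Conj.mk (by rw [map_one, one_smul])
  mul_smul c d x := congrArg Conj.mk (by rw [map_mul, mul_smul]; rfl)
  smul_zero c := congrArg Conj.mk (smul_zero _)
  smul_add c x y := congrArg Conj.mk (smul_add _ _ _)
  add_smul c d x := congrArg Conj.mk (by rw [map_add, add_smul]; rfl)
  zero_smul x := congrArg Conj.mk (by rw [map_zero, zero_smul])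

theorem conj_smul {M : Type} [AddCommGroup M] [Module ℂ M] (c : ℂ) (m : M) :
    c • toConj M m = toConj M (starRingEnd ℂ c • m) := rfl

/-- The antilinear bijection `σ : V → σ(V)`. -/
def conjEquiv (V : Type) [AddCommGroup V] [Module ℂ V] : V ≃ₛₗ[starRingEnd ℂ] Conj V :=
  { toConj V with
    map_smul' := fun c v => by
      change toConj V (c • v) = starRingEnd ℂ c • toConj V v
      rw [conj_smul, Complex.conj_conj] }

/-- `σ(A) = {σ(v) : v ∈ A}` for a subspace `A`. -/
def conjSub {V : Type} [AddCommGroup V] [Module ℂ V] (A : Submodule ℂ V) :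
    Submodule ℂ (Conj V) := A.map (conjEquiv V).toLinearMap

/-- The linear map `σ(V) → σ(V')`, `σ(v) ↦ σ(f(v))`. -/
def conjMap {V V' : Type} [AddCommGroup V] [Module ℂ V] [AddCommGroup V'] [Module ℂ V']
    (f : V →ₗ[ℂ] V') : Conj V →ₗ[ℂ] Conj V' :=
  (conjEquiv V').toLinearMap ∘ₛₗ f ∘ₛₗ (conjEquiv V).symm.toLinearMap

/-! ### Tensor categories with an action of `Gal(ℂ/ℝ)` -/

/-- An action of `Γ = Gal(ℂ/ℝ) = {1, σ}` on a `ℂ`-linear symmetric monoidal category by antilinear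
symmetric monoidal autoequivalences: a functor `σ`, with an isomorphism `σ ∘ σ ≅ 1` subject to the
usual coherence. -/
class GammaAction (C : Type*) [Category C] [Preadditive C] [Linear ℂ C] [MonoidalCategory C]
    [SymmetricCategory C] where
  /-- the action of the complex conjugation -/
  σ : C ⥤ C
  /-- `σ` is symmetric monoidal -/
  [braided : σ.Braided]
  map_add : ∀ {X Y : C} (f g : X ⟶ Y), σ.map (f + g) = σ.map f + σ.map g
  map_smul : ∀ {X Y : C} (c : ℂ) (f : X ⟶ Y), σ.map (c • f) = starRingEnd ℂ c • σ.map f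
  /-- the isomorphism `σ ∘ σ ≅ 1` -/
  sq : σ ⋙ σ ≅ 𝟭 C
  sq_monoidal : NatTrans.IsMonoidal sq.hom
  sq_coherent : ∀ X : C, σ.map (sq.hom.app X) = sq.hom.app (σ.obj X)

attribute [reducible, instance] GammaAction.braided

/-! ### Complex mixed Hodge structures -/

/-- A complex mixed Hodge structure: a finite-dimensional complex vector space with three opposite
(finite) filtrations. -/
structure ComplexMHS where
  V : Type
  [addCommGroup : AddCommGroup V]
  [module : Module ℂ V]
  [finiteDimensional : FiniteDimensional ℂ V]
  /-- the (increasing) weight filtration -/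
  W : ℤ → Submodule ℂ V
  /-- the first (decreasing) Hodge filtration -/
  F' : ℤ → Submodule ℂ V
  /-- the second (decreasing) Hodge filtration -/
  F'' : ℤ → Submodule ℂ V
  isInc_W : IsIncFiltration W
  isDec_F' : IsDecFiltration F'
  isDec_F'' : IsDecFiltration F''
  opposed : Opposed W F' F''

namespace ComplexMHS

attribute [instance] addCommGroup module finiteDimensional

theorem adapted (X : ComplexMHS) : Adapted X.W X.F' X.F'' :=
  X.opposed.adapted X.isInc_W X.isDec_F' X.isDec_F''

/-- The morphisms: linear maps which respect the three filtrations. -/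
def homs (X Y : ComplexMHS) : Submodule ℂ (X.V →ₗ[ℂ] Y.V) where
  carrier := {f | (∀ n, ∀ x ∈ X.W n, f x ∈ Y.W n) ∧ (∀ n, ∀ x ∈ X.F' n, f x ∈ Y.F' n) ∧
    (∀ n, ∀ x ∈ X.F'' n, f x ∈ Y.F'' n)}
  add_mem' hf hg := ⟨fun n x hx => add_mem (hf.1 n x hx) (hg.1 n x hx),
    fun n x hx => add_mem (hf.2.1 n x hx) (hg.2.1 n x hx),
    fun n x hx => add_mem (hf.2.2 n x hx) (hg.2.2 n x hx)⟩
  zero_mem' := ⟨fun _ _ _ => zero_mem _, fun _ _ _ => zero_mem _, fun _ _ _ => zero_mem _⟩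
  smul_mem' c _ hf := ⟨fun n x hx => Submodule.smul_mem _ c (hf.1 n x hx),
    fun n x hx => Submodule.smul_mem _ c (hf.2.1 n x hx),
    fun n x hx => Submodule.smul_mem _ c (hf.2.2 n x hx)⟩

instance : Category ComplexMHS where
  Hom X Y := homs X Y
  id X := ⟨LinearMap.id, fun _ _ h => h, fun _ _ h => h, fun _ _ h => h⟩
  comp f g := ⟨g.1 ∘ₗ f.1, fun n x h => g.2.1 n _ (f.2.1 n x h),
    fun n x h => g.2.2.1 n _ (f.2.2.1 n x h), fun n x h => g.2.2.2 n _ (f.2.2.2 n x h)⟩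

/-- The linear map underlying a morphism. -/
def Hom.lin {X Y : ComplexMHS} (f : X ⟶ Y) : X.V →ₗ[ℂ] Y.V := f.1

@[ext]
theorem hom_ext {X Y : ComplexMHS} {f g : X ⟶ Y} (h : Hom.lin f = Hom.lin g) : f = g :=
  Subtype.ext h

instance : Preadditive ComplexMHS where
  homGroup X Y := inferInstanceAs (AddCommGroup (homs X Y))
  add_comp _ _ _ f f' g := hom_ext (LinearMap.comp_add f.1 f'.1 g.1)
  comp_add _ _ _ f g g' := hom_ext (LinearMap.add_comp f.1 g'.1 g.1)

instance : Linear ℂ ComplexMHS where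
  homModule X Y := inferInstanceAs (Module ℂ (homs X Y))
  smul_comp _ _ _ c f g := hom_ext (LinearMap.comp_smul g.1 c f.1)
  comp_smul _ _ _ f c g := hom_ext (LinearMap.smul_comp c g.1 f.1)

/-- An isomorphism of complex mixed Hodge structures from a linear bijection which respects the
filtrations in both directions. -/
def isoMk {X Y : ComplexMHS} (e : X.V ≃ₗ[ℂ] Y.V) (h : e.toLinearMap ∈ homs X Y)
    (h' : e.symm.toLinearMap ∈ homs Y X) : X ≅ Y where
  hom := ⟨e.toLinearMap, h⟩
  inv := ⟨e.symm.toLinearMap, h'⟩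
  hom_inv_id := hom_ext (LinearMap.ext fun x => e.symm_apply_apply x)
  inv_hom_id := hom_ext (LinearMap.ext fun x => e.apply_symm_apply x)

/-- The increasing filtration of `ℂ` placing it in degree `0`. -/
def unitInc (n : ℤ) : Submodule ℂ ℂ := if 0 ≤ n then ⊤ else ⊥

/-- The decreasing filtration of `ℂ` placing it in degree `0`. -/
def unitDec (n : ℤ) : Submodule ℂ ℂ := if n ≤ 0 then ⊤ else ⊥

theorem mem_unitInc_zero (c : ℂ) : c ∈ unitInc 0 := by
  rw [unitInc, if_pos le_rfl]; trivial

theorem mem_unitDec_zero (c : ℂ) : c ∈ unitDec 0 := by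
  rw [unitDec, if_pos le_rfl]; trivial

theorem isIncFiltration_unitInc : IsIncFiltration unitInc :=
  ⟨fun a b h => by unfold unitInc; split_ifs <;> first | omega | simp, ⟨0, by simp [unitInc]⟩,
    ⟨-1, by simp [unitInc]⟩⟩

theorem isDecFiltration_unitDec : IsDecFiltration unitDec :=
  ⟨fun a b h => by unfold unitDec; split_ifs <;> first | omega | simp, ⟨0, by simp [unitDec]⟩,
    ⟨1, by simp [unitDec]⟩⟩

theorem adapted_unit : Adapted unitInc unitDec unitDec := by
  refine ⟨Unit, Module.Basis.singleton Unit ℂ, Module.Basis.singleton Unit ℂ, fun _ => 0,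
    fun _ => 0, ?_, ?_, ?_, ?_, ?_⟩
  iterate 4
    intro n
    simp only [unitInc, unitDec]
    split_ifs with h
    · symm; rw [eq_top_iff, ← (Module.Basis.singleton Unit ℂ).span_eq]
      refine Submodule.span_mono ?_
      rintro _ ⟨k, rfl⟩
      exact ⟨k, by simpa using h, rfl⟩
    · symm; rw [eq_bot_iff, Submodule.span_le]
      rintro _ ⟨k, hk, rfl⟩
      exact absurd (by simpa using hk) h
  intro k
  simp

/-- The unit object `ℂ(0)`: `ℂ` in weight `0` and bidegree `(0, 0)`. -/
def unit : ComplexMHS where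
  V := ℂ
  W := unitInc
  F' := unitDec
  F'' := unitDec
  isInc_W := isIncFiltration_unitInc
  isDec_F' := isDecFiltration_unitDec
  isDec_F'' := isDecFiltration_unitDec
  opposed := adapted_unit.opposed

/-- The tensor product, with the tensor product filtrations. -/
def tensor (X Y : ComplexMHS) : ComplexMHS where
  V := X.V ⊗[ℂ] Y.V
  W := tensorFil X.W Y.W
  F' := tensorFil X.F' Y.F'
  F'' := tensorFil X.F'' Y.F''
  isInc_W := X.isInc_W.tensor Y.isInc_W
  isDec_F' := X.isDec_F'.tensor Y.isDec_F'
  isDec_F'' := X.isDec_F''.tensor Y.isDec_F''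
  opposed := (X.adapted.tensor Y.adapted).opposed

section

variable {V₁ V₂ V₃ V₄ : Type} [AddCommGroup V₁] [Module ℂ V₁] [AddCommGroup V₂] [Module ℂ V₂]
  [AddCommGroup V₃] [Module ℂ V₃] [AddCommGroup V₄] [Module ℂ V₄]
  {A : ℤ → Submodule ℂ V₁} {B : ℤ → Submodule ℂ V₂} {C : ℤ → Submodule ℂ V₃}
  {D : ℤ → Submodule ℂ V₄}

theorem map_mem_tensorFil (f : V₁ →ₗ[ℂ] V₃) (g : V₂ →ₗ[ℂ] V₄) (hf : ∀ n, ∀ x ∈ A n, f x ∈ C n)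
    (hg : ∀ n, ∀ x ∈ B n, g x ∈ D n) (n : ℤ) (x : V₁ ⊗[ℂ] V₂) (hx : x ∈ tensorFil A B n) :
    TensorProduct.map f g x ∈ tensorFil C D n := by
  have : tensorFil A B n ≤ (tensorFil C D n).comap (TensorProduct.map f g) :=
    tensorFil_le fun i j hij x hx y hy => tmul_mem_tensorFil hij (hf i x hx) (hg j y hy)
  exact this hx

theorem assoc_mem_tensorFil (n : ℤ) (x : (V₁ ⊗[ℂ] V₂) ⊗[ℂ] V₃)
    (hx : x ∈ tensorFil (tensorFil A B) C n) :
    TensorProduct.assoc ℂ V₁ V₂ V₃ x ∈ tensorFil A (tensorFil B C) n := by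
  have : tensorFil (tensorFil A B) C n ≤
      (tensorFil A (tensorFil B C) n).comap (TensorProduct.assoc ℂ V₁ V₂ V₃).toLinearMap := by
    refine tensorFil_le fun i j hij x hx z hz => ?_
    have h2 : tensorFil A B i ≤ ((tensorFil A (tensorFil B C) n).comap
        (TensorProduct.assoc ℂ V₁ V₂ V₃).toLinearMap).comap
          ((TensorProduct.mk ℂ (V₁ ⊗[ℂ] V₂) V₃).flip z) :=
      tensorFil_le fun a b hab u hu w hw => tmul_mem_tensorFil (j := b + j) (by omega) hu
        (tmul_mem_tensorFil rfl hw hz)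
    exact h2 hx
  exact this hx

theorem assoc_symm_mem_tensorFil (n : ℤ) (x : V₁ ⊗[ℂ] (V₂ ⊗[ℂ] V₃))
    (hx : x ∈ tensorFil A (tensorFil B C) n) :
    (TensorProduct.assoc ℂ V₁ V₂ V₃).symm x ∈ tensorFil (tensorFil A B) C n := by
  have : tensorFil A (tensorFil B C) n ≤
      (tensorFil (tensorFil A B) C n).comap (TensorProduct.assoc ℂ V₁ V₂ V₃).symm.toLinearMap := by
    refine tensorFil_le fun i j hij x hx z hz => ?_
    have h2 : tensorFil B C j ≤ ((tensorFil (tensorFil A B) C n).comap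
        (TensorProduct.assoc ℂ V₁ V₂ V₃).symm.toLinearMap).comap
          (TensorProduct.mk ℂ V₁ (V₂ ⊗[ℂ] V₃) x) :=
      tensorFil_le fun a b hab u hu w hw => tmul_mem_tensorFil (i := i + a) (by omega)
        (tmul_mem_tensorFil rfl hx hu) hw
    exact h2 hz
  exact this hx

theorem comm_mem_tensorFil (n : ℤ) (x : V₁ ⊗[ℂ] V₂) (hx : x ∈ tensorFil A B n) :
    TensorProduct.comm ℂ V₁ V₂ x ∈ tensorFil B A n := by
  have : tensorFil A B n ≤ (tensorFil B A n).comap (TensorProduct.comm ℂ V₁ V₂).toLinearMap :=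
    tensorFil_le fun i j hij x hx y hy => tmul_mem_tensorFil (by omega) hy hx
  exact this hx

theorem lid_mem (U : ℤ → Submodule ℂ ℂ) (hU : ∀ i j, ∀ c ∈ U i, ∀ x ∈ A j, c • x ∈ A (i + j))
    (n : ℤ) (x : ℂ ⊗[ℂ] V₁) (hx : x ∈ tensorFil U A n) : TensorProduct.lid ℂ V₁ x ∈ A n := by
  have : tensorFil U A n ≤ (A n).comap (TensorProduct.lid ℂ V₁).toLinearMap :=
    tensorFil_le fun i j hij c hc x hx => by
      rw [← hij]; simpa using hU i j c hc x hx
  exact this hx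

theorem rid_mem (U : ℤ → Submodule ℂ ℂ) (hU : ∀ i j, ∀ c ∈ U i, ∀ x ∈ A j, c • x ∈ A (i + j))
    (n : ℤ) (x : V₁ ⊗[ℂ] ℂ) (hx : x ∈ tensorFil A U n) : TensorProduct.rid ℂ V₁ x ∈ A n := by
  have : tensorFil A U n ≤ (A n).comap (TensorProduct.rid ℂ V₁).toLinearMap :=
    tensorFil_le fun i j hij x hx c hc => by
      rw [← hij, add_comm]; simpa using hU j i c hc x hx
  exact this hx

end

theorem unitInc_smul {V : Type} [AddCommGroup V] [Module ℂ V] {A : ℤ → Submodule ℂ V}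
    (hA : IsIncFiltration A) (i j : ℤ) (c : ℂ) (hc : c ∈ unitInc i) (x : V) (hx : x ∈ A j) :
    c • x ∈ A (i + j) := by
  by_cases h : 0 ≤ i
  · exact Submodule.smul_mem _ _ (hA.mono (by omega) hx)
  · have : c = 0 := by simpa [unitInc, h] using hc
    simp [this]

theorem unitDec_smul {V : Type} [AddCommGroup V] [Module ℂ V] {A : ℤ → Submodule ℂ V}
    (hA : IsDecFiltration A) (i j : ℤ) (c : ℂ) (hc : c ∈ unitDec i) (x : V) (hx : x ∈ A j) :
    c • x ∈ A (i + j) := by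
  by_cases h : i ≤ 0
  · exact Submodule.smul_mem _ _ (hA.anti (by omega) hx)
  · have : c = 0 := by simpa [unitDec, h] using hc
    simp [this]

instance : MonoidalCategoryStruct ComplexMHS where
  tensorObj := tensor
  tensorUnit := unit
  tensorHom f g := ⟨TensorProduct.map f.1 g.1, map_mem_tensorFil _ _ f.2.1 g.2.1,
    map_mem_tensorFil _ _ f.2.2.1 g.2.2.1, map_mem_tensorFil _ _ f.2.2.2 g.2.2.2⟩
  whiskerLeft _ _ _ g := ⟨TensorProduct.map LinearMap.id g.1,
    map_mem_tensorFil _ _ (fun _ _ h => h) g.2.1, map_mem_tensorFil _ _ (fun _ _ h => h) g.2.2.1,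
    map_mem_tensorFil _ _ (fun _ _ h => h) g.2.2.2⟩
  whiskerRight f _ := ⟨TensorProduct.map f.1 LinearMap.id,
    map_mem_tensorFil _ _ f.2.1 (fun _ _ h => h), map_mem_tensorFil _ _ f.2.2.1 (fun _ _ h => h),
    map_mem_tensorFil _ _ f.2.2.2 (fun _ _ h => h)⟩
  associator X Y Z := isoMk (TensorProduct.assoc ℂ X.V Y.V Z.V)
    ⟨assoc_mem_tensorFil, assoc_mem_tensorFil, assoc_mem_tensorFil⟩
    ⟨assoc_symm_mem_tensorFil, assoc_symm_mem_tensorFil, assoc_symm_mem_tensorFil⟩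
  leftUnitor X := isoMk (TensorProduct.lid ℂ X.V)
    ⟨lid_mem _ (unitInc_smul X.isInc_W), lid_mem _ (unitDec_smul X.isDec_F'),
      lid_mem _ (unitDec_smul X.isDec_F'')⟩
    ⟨fun n _ hx => tmul_mem_tensorFil (zero_add n) (mem_unitInc_zero 1) hx,
      fun n _ hx => tmul_mem_tensorFil (zero_add n) (mem_unitDec_zero 1) hx,
      fun n _ hx => tmul_mem_tensorFil (zero_add n) (mem_unitDec_zero 1) hx⟩
  rightUnitor X := isoMk (TensorProduct.rid ℂ X.V)
    ⟨rid_mem _ (unitInc_smul X.isInc_W), rid_mem _ (unitDec_smul X.isDec_F'),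
      rid_mem _ (unitDec_smul X.isDec_F'')⟩
    ⟨fun n _ hx => tmul_mem_tensorFil (add_zero n) hx (mem_unitInc_zero 1),
      fun n _ hx => tmul_mem_tensorFil (add_zero n) hx (mem_unitDec_zero 1),
      fun n _ hx => tmul_mem_tensorFil (add_zero n) hx (mem_unitDec_zero 1)⟩

instance : MonoidalCategory ComplexMHS := MonoidalCategory.ofTensorHom
  (id_tensorHom_id := fun _ _ => hom_ext (TensorProduct.ext' fun _ _ => rfl))
  (id_tensorHom := fun _ _ _ _ => rfl)
  (tensorHom_id := fun _ _ => rfl)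
  (tensorHom_comp_tensorHom := fun _ _ _ _ => hom_ext (TensorProduct.ext' fun _ _ => rfl))
  (associator_naturality := fun _ _ _ => hom_ext (TensorProduct.ext_threefold fun _ _ _ => rfl))
  (leftUnitor_naturality := fun f => hom_ext (TensorProduct.ext' fun c x =>
    (f.1.map_smul (show ℂ from c) x).symm))
  (rightUnitor_naturality := fun f => hom_ext (TensorProduct.ext' fun x c =>
    (f.1.map_smul (show ℂ from c) x).symm))
  (pentagon := fun _ _ _ _ => hom_ext (TensorProduct.ext_fourfold fun _ _ _ _ => rfl))
  (triangle := fun _ _ => hom_ext (TensorProduct.ext_threefold fun x c y =>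
    (TensorProduct.smul_tmul (R := ℂ) (show ℂ from c) x y).symm))

instance : SymmetricCategory ComplexMHS where
  braiding X Y := isoMk (TensorProduct.comm ℂ X.V Y.V)
    ⟨comm_mem_tensorFil, comm_mem_tensorFil, comm_mem_tensorFil⟩
    ⟨comm_mem_tensorFil, comm_mem_tensorFil, comm_mem_tensorFil⟩
  braiding_naturality_right _ _ _ _ := hom_ext (TensorProduct.ext' fun _ _ => rfl)
  braiding_naturality_left _ _ := hom_ext (TensorProduct.ext' fun _ _ => rfl)
  hexagon_forward _ _ _ := hom_ext (TensorProduct.ext_threefold fun _ _ _ => rfl)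
  hexagon_reverse X Y Z := by
    rw [← cancel_epi (α_ X Y Z).hom]
    exact hom_ext (TensorProduct.ext_threefold fun _ _ _ => rfl)
  symmetry _ _ := hom_ext (TensorProduct.ext' fun _ _ => rfl)

/-! #### Complex conjugation of mixed Hodge structures -/

section

variable {V V' : Type} [AddCommGroup V] [Module ℂ V] [AddCommGroup V'] [Module ℂ V']

theorem mem_conjSub {A : Submodule ℂ V} {x : V} : conjEquiv V x ∈ conjSub A ↔ x ∈ A := by
  refine ⟨?_, fun h => Submodule.mem_map_of_mem h⟩
  rintro ⟨y, hy, hxy⟩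
  rwa [← (conjEquiv V).injective hxy]

theorem conjMap_mem {f : V →ₗ[ℂ] V'} {A : Submodule ℂ V} {B : Submodule ℂ V'}
    (h : ∀ x ∈ A, f x ∈ B) (x : Conj V) (hx : x ∈ conjSub A) : conjMap f x ∈ conjSub B := by
  obtain ⟨y, rfl⟩ := (conjEquiv V).surjective x
  exact mem_conjSub.2 (h y (mem_conjSub.1 hx))

theorem conjSub_top : conjSub (⊤ : Submodule ℂ V) = ⊤ := by
  rw [eq_top_iff]; rintro x -
  obtain ⟨y, rfl⟩ := (conjEquiv V).surjective x
  exact mem_conjSub.2 trivial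

theorem conjSub_bot : conjSub (⊥ : Submodule ℂ V) = ⊥ := Submodule.map_bot _

theorem conjSub_mono {A B : Submodule ℂ V} (h : A ≤ B) : conjSub A ≤ conjSub B :=
  Submodule.map_mono h

theorem isIncFiltration_conj {A : ℤ → Submodule ℂ V} (hA : IsIncFiltration A) :
    IsIncFiltration fun n => conjSub (A n) :=
  ⟨fun _ _ h => conjSub_mono (hA.mono h),
    hA.exists_top.imp fun n h => by rw [h, conjSub_top],
    hA.exists_bot.imp fun n h => by rw [h, conjSub_bot]⟩

theorem isDecFiltration_conj {A : ℤ → Submodule ℂ V} (hA : IsDecFiltration A) :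
    IsDecFiltration fun n => conjSub (A n) :=
  ⟨fun _ _ h => conjSub_mono (hA.anti h),
    hA.exists_top.imp fun n h => by rw [h, conjSub_top],
    hA.exists_bot.imp fun n h => by rw [h, conjSub_bot]⟩

theorem conjSub_span (S : Set V) :
    conjSub (Submodule.span ℂ S) = Submodule.span ℂ (conjEquiv V '' S) :=
  Submodule.map_span _ _

/-- The basis of `σ(V)` formed by the `σ(b_i)`. -/
def conjBasis {ι : Type} (b : Module.Basis ι ℂ V) : Module.Basis ι ℂ (Conj V) :=
  Module.Basis.mk (v := fun i => conjEquiv V (b i))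
    (by
      rw [linearIndependent_iff']
      intro s g hg i hi
      have h1 : conjEquiv V (∑ i ∈ s, starRingEnd ℂ (g i) • b i) = 0 := by
        rw [map_sum, ← hg]
        refine Finset.sum_congr rfl fun i _ => ?_
        rw [LinearEquiv.map_smulₛₗ, Complex.conj_conj]
      rw [LinearEquiv.map_eq_zero_iff] at h1
      have h2 := linearIndependent_iff'.1 b.linearIndependent s _ h1 i hi
      simpa using h2)
    (by
      rw [Set.range_comp' (conjEquiv V) b, ← conjSub_span, b.span_eq, conjSub_top])

theorem conjBasis_apply {ι : Type} (b : Module.Basis ι ℂ V) (i : ι) :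
    conjBasis b i = conjEquiv V (b i) := by
  simp [conjBasis]

theorem adapted_conj {W F' F'' : ℤ → Submodule ℂ V} (h : Adapted W F' F'') :
    Adapted (fun n => conjSub (W n)) (fun n => conjSub (F' n)) (fun n => conjSub (F'' n)) := by
  obtain ⟨ι, v, w, p, q, hWv, hWw, hF', hF'', hvw⟩ := h
  have im : ∀ (b : Module.Basis ι ℂ V) (s : Set ι),
      conjSub (Submodule.span ℂ (b '' s)) = Submodule.span ℂ (conjBasis b '' s) := fun b s => by
    rw [conjSub_span, Set.image_image]
    simp only [conjBasis_apply]
  refine ⟨ι, conjBasis v, conjBasis w, p, q, fun n => ?_, fun n => ?_, fun n => ?_, fun n => ?_,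
    fun k => ?_⟩
  · exact (congrArg conjSub (hWv n)).trans (im _ _)
  · exact (congrArg conjSub (hWw n)).trans (im _ _)
  · exact (congrArg conjSub (hF' n)).trans (im _ _)
  · exact (congrArg conjSub (hF'' n)).trans (im _ _)
  · rw [conjBasis_apply, conjBasis_apply, ← map_sub]
    exact mem_conjSub.2 (hvw k)

/-- `σ(V) ⊗ σ(V') = σ(V ⊗ V')`. -/
def conjTensor (V V' : Type) [AddCommGroup V] [Module ℂ V] [AddCommGroup V'] [Module ℂ V'] :
    Conj V ⊗[ℂ] Conj V' ≃ₗ[ℂ] Conj (V ⊗[ℂ] V') :=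
  (TensorProduct.congr (conjEquiv V) (conjEquiv V')).symm.trans (conjEquiv (V ⊗[ℂ] V'))

theorem conjTensor_tmul (x : V) (y : V') :
    conjTensor V V' (conjEquiv V x ⊗ₜ conjEquiv V' y) = conjEquiv _ (x ⊗ₜ y) := rfl

theorem conjTensor_mem {A : ℤ → Submodule ℂ V} {B : ℤ → Submodule ℂ V'} (n : ℤ)
    (x : Conj V ⊗[ℂ] Conj V')
    (hx : x ∈ tensorFil (fun n => conjSub (A n)) (fun n => conjSub (B n)) n) :
    conjTensor V V' x ∈ conjSub (tensorFil A B n) := by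
  have : tensorFil (fun n => conjSub (A n)) (fun n => conjSub (B n)) n ≤
      (conjSub (tensorFil A B n)).comap (conjTensor V V').toLinearMap := by
    refine tensorFil_le fun i j hij x hx y hy => ?_
    obtain ⟨x, hx, rfl⟩ := hx
    obtain ⟨y, hy, rfl⟩ := hy
    exact mem_conjSub.2 (tmul_mem_tensorFil hij hx hy)
  exact this hx

theorem conjTensor_symm_mem {A : ℤ → Submodule ℂ V} {B : ℤ → Submodule ℂ V'} (n : ℤ)
    (x : Conj (V ⊗[ℂ] V')) (hx : x ∈ conjSub (tensorFil A B n)) :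
    (conjTensor V V').symm x ∈
      tensorFil (fun n => conjSub (A n)) (fun n => conjSub (B n)) n := by
  obtain ⟨x, rfl⟩ := (conjEquiv _).surjective x
  let T := tensorFil (fun n => conjSub (A n)) (fun n => conjSub (B n)) n
  let φ : V ⊗[ℂ] V' →ₛₗ[starRingEnd ℂ] Conj V ⊗[ℂ] Conj V' :=
    (conjTensor V V').symm.toLinearMap ∘ₛₗ (conjEquiv (V ⊗[ℂ] V')).toLinearMap
  have hφ : ∀ x y, φ (x ⊗ₜ y) = conjEquiv V x ⊗ₜ conjEquiv V' y := fun x y => by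
    change (conjTensor V V').symm (conjEquiv _ (x ⊗ₜ y)) = _
    rw [← conjTensor_tmul, LinearEquiv.symm_apply_apply]
  have : tensorFil A B n ≤ T.comap φ := by
    refine tensorFil_le fun i j hij x hx y hy => ?_
    rw [Submodule.mem_comap, hφ]
    exact tmul_mem_tensorFil hij (mem_conjSub.2 hx) (mem_conjSub.2 hy)
  exact this (mem_conjSub.1 hx)

end

/-- The complex conjugate structure `(σ(V), σ(W), σ(F''), σ(F'))`. -/
def conj (X : ComplexMHS) : ComplexMHS where
  V := Conj X.V
  finiteDimensional := Module.Finite.of_basis (conjBasis (Module.finBasis ℂ X.V))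
  W n := conjSub (X.W n)
  F' n := conjSub (X.F'' n)
  F'' n := conjSub (X.F' n)
  isInc_W := isIncFiltration_conj X.isInc_W
  isDec_F' := isDecFiltration_conj X.isDec_F''
  isDec_F'' := isDecFiltration_conj X.isDec_F'
  opposed := (adapted_conj X.adapted).swap.opposed

/-- The functor `σ` of complex conjugation. -/
def conjFunctor : ComplexMHS ⥤ ComplexMHS where
  obj := conj
  map {X Y} f := ⟨conjMap (V := X.V) (V' := Y.V) f.1, fun n => conjMap_mem (f.2.1 n),
    fun n => conjMap_mem (f.2.2.2 n), fun n => conjMap_mem (f.2.2.1 n)⟩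

/-- The isomorphism `ℂ ≅ σ(ℂ)`, `c ↦ c σ(1) = σ(conj(c))`. -/
def conjUnit : ℂ ≃ₗ[ℂ] Conj ℂ where
  toFun c := conjEquiv ℂ (starRingEnd ℂ c)
  invFun x := starRingEnd ℂ x.val
  map_add' a b := by rw [map_add, map_add]
  map_smul' a b := by
    rw [smul_eq_mul, map_mul, ← smul_eq_mul, LinearEquiv.map_smulₛₗ, Complex.conj_conj]; rfl
  left_inv c := Complex.conj_conj c
  right_inv x := congrArg Conj.mk (Complex.conj_conj x.val)

theorem star_mem_subspace {A : Submodule ℂ ℂ} {x : ℂ} (hx : x ∈ A) : starRingEnd ℂ x ∈ A := by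
  rcases eq_or_ne x 0 with rfl | h
  · simp
  · have := A.smul_mem (starRingEnd ℂ x / x) hx
    rwa [smul_eq_mul, div_mul_cancel₀ _ h] at this

theorem conjUnit_mem {A : Submodule ℂ ℂ} (x : ℂ) (hx : x ∈ A) : conjUnit x ∈ conjSub A :=
  mem_conjSub.2 (star_mem_subspace hx)

theorem conjUnit_symm_mem {A : Submodule ℂ ℂ} (x : Conj ℂ) (hx : x ∈ conjSub A) :
    conjUnit.symm x ∈ A := by
  obtain ⟨y, rfl⟩ := (conjEquiv ℂ).surjective x
  exact star_mem_subspace (mem_conjSub.1 hx)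

/-- `σ(σ(V)) = V`. -/
def conjConj (V : Type) [AddCommGroup V] [Module ℂ V] : Conj (Conj V) ≃ₗ[ℂ] V :=
  (conjEquiv (Conj V)).symm.trans (conjEquiv V).symm

theorem conjConj_mem {V : Type} [AddCommGroup V] [Module ℂ V] {A : Submodule ℂ V}
    (x : Conj (Conj V)) (hx : x ∈ conjSub (conjSub A)) : conjConj V x ∈ A := by
  obtain ⟨y, rfl⟩ := (conjEquiv (Conj V)).surjective x
  obtain ⟨z, rfl⟩ := (conjEquiv V).surjective y
  exact mem_conjSub.1 (mem_conjSub.1 hx)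

theorem conjConj_symm_mem {V : Type} [AddCommGroup V] [Module ℂ V] {A : Submodule ℂ V}
    (x : V) (hx : x ∈ A) : (conjConj V).symm x ∈ conjSub (conjSub A) :=
  mem_conjSub.2 (mem_conjSub.2 hx)

/-- Complex conjugation commutes with tensor products. -/
def conjCore : conjFunctor.CoreMonoidal where
  εIso := isoMk (X := unit) (Y := conj unit) conjUnit
    ⟨fun _ => conjUnit_mem, fun _ => conjUnit_mem, fun _ => conjUnit_mem⟩
    ⟨fun _ => conjUnit_symm_mem, fun _ => conjUnit_symm_mem, fun _ => conjUnit_symm_mem⟩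
  μIso X Y := isoMk (X := tensor (conj X) (conj Y)) (Y := conj (tensor X Y)) (conjTensor X.V Y.V)
    ⟨conjTensor_mem, conjTensor_mem, conjTensor_mem⟩
    ⟨conjTensor_symm_mem, conjTensor_symm_mem, conjTensor_symm_mem⟩
  μIso_hom_natural_left _ _ := hom_ext (TensorProduct.ext' fun _ _ => rfl)
  μIso_hom_natural_right _ _ := hom_ext (TensorProduct.ext' fun _ _ => rfl)
  associativity _ _ _ := hom_ext (TensorProduct.ext_threefold fun _ _ _ => rfl)
  left_unitality _ := hom_ext (TensorProduct.ext' fun _ _ => rfl)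
  right_unitality _ := hom_ext (TensorProduct.ext' fun _ _ => rfl)

instance : conjFunctor.Monoidal := conjCore.toMonoidal

instance : conjFunctor.Braided where
  braided _ _ := hom_ext (TensorProduct.ext' fun _ _ => rfl)

instance : GammaAction ComplexMHS where
  σ := conjFunctor
  map_add _ _ := rfl
  map_smul c f := hom_ext (LinearMap.ext fun x =>
    congrArg (fun d : ℂ => Conj.mk (d • f.1 x.val)) (Complex.conj_conj c).symm)
  sq := NatIso.ofComponents (fun X => isoMk (X := conj (conj X)) (conjConj X.V)
    ⟨fun _ => conjConj_mem, fun _ => conjConj_mem, fun _ => conjConj_mem⟩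
    ⟨fun _ => conjConj_symm_mem, fun _ => conjConj_symm_mem, fun _ => conjConj_symm_mem⟩)
    (fun _ => rfl)
  sq_monoidal :=
    { unit := hom_ext (LinearMap.ext fun c => Complex.conj_conj (show ℂ from c))
      tensor := fun _ _ => hom_ext (TensorProduct.ext' fun _ _ => rfl) }
  sq_coherent _ := rfl

end ComplexMHS

/-! ### The affine plane, its torus action and its real structure -/

/-- The coordinate ring `ℂ[t₁, t₂]` of the affine plane. -/
abbrev Poly : Type := MvPolynomial (Fin 2) ℂ

/-- The complex points of the torus `𝔾_m²`. -/
abbrev Torus : Type := Fin 2 → ℂˣ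

/-- The character `l ↦ l₁^{a₁} l₂^{a₂}` of the torus. -/
def torusChar (a : Fin 2 → ℤ) (l : Torus) : ℂ := ((∏ i, l i ^ a i : ℂˣ) : ℂ)

/-- The substitution `t_i ↦ l_i t_i`. -/
def scaleHom (l : Torus) : Poly →ₐ[ℂ] Poly :=
  MvPolynomial.aeval fun i => MvPolynomial.C (l i : ℂ) * MvPolynomial.X i

theorem scaleHom_X (l : Torus) (i : Fin 2) :
    scaleHom l (MvPolynomial.X i) = MvPolynomial.C (l i : ℂ) * MvPolynomial.X i :=
  MvPolynomial.aeval_X _ _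

theorem scaleHom_mul (l m : Torus) : scaleHom (l * m) = (scaleHom l).comp (scaleHom m) := by
  refine MvPolynomial.algHom_ext fun i => ?_
  rw [AlgHom.comp_apply, scaleHom_X, scaleHom_X, map_mul, ← MvPolynomial.algebraMap_eq,
    AlgHom.commutes, scaleHom_X, MvPolynomial.algebraMap_eq, ← mul_assoc, ← map_mul, Pi.mul_apply,
    Units.val_mul, mul_comm (l i : ℂ)]

theorem scaleHom_one : scaleHom 1 = AlgHom.id ℂ Poly :=
  MvPolynomial.algHom_ext fun i => by simp [scaleHom_X]

/-- The action of the torus on functions on the affine plane: `(l · f)(t) = f(l t)`. -/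
def torusPoly (l : Torus) : Poly ≃ₐ[ℂ] Poly :=
  AlgEquiv.ofAlgHom (scaleHom l) (scaleHom l⁻¹)
    (by rw [← scaleHom_mul, mul_inv_cancel, scaleHom_one])
    (by rw [← scaleHom_mul, inv_mul_cancel, scaleHom_one])

theorem torusPoly_apply (l : Torus) (f : Poly) : torusPoly l f = scaleHom l f := rfl

theorem torusPoly_mul (l m : Torus) (f : Poly) :
    torusPoly (l * m) f = torusPoly l (torusPoly m f) :=
  DFunLike.congr_fun (scaleHom_mul l m) f

theorem torusPoly_one (f : Poly) : torusPoly 1 f = f := DFunLike.congr_fun scaleHom_one f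

/-- The action of complex conjugation on functions induced by `σ(t₁, t₂) = (conj t₂, conj t₁)`,
as a ring homomorphism: `(σ f)(t) = conj (f (σ t))`. -/
def polyConjHom : Poly →+* Poly :=
  (MvPolynomial.rename (Equiv.swap (0 : Fin 2) 1)).toRingHom.comp
    (MvPolynomial.map (starRingEnd ℂ))

theorem polyConjHom_C (c : ℂ) :
    polyConjHom (MvPolynomial.C c) = MvPolynomial.C (starRingEnd ℂ c) := by
  simp [polyConjHom]

theorem polyConjHom_X (i : Fin 2) :
    polyConjHom (MvPolynomial.X i) = MvPolynomial.X (Equiv.swap (0 : Fin 2) 1 i) := by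
  simp [polyConjHom]

theorem polyConjHom_polyConjHom (f : Poly) : polyConjHom (polyConjHom f) = f := by
  have : polyConjHom.comp polyConjHom = RingHom.id Poly :=
    MvPolynomial.ringHom_ext (fun c => by simp [polyConjHom_C]) (fun i => by simp [polyConjHom_X])
  exact RingHom.congr_fun this f

/-- The action of complex conjugation on functions on the affine plane, as a ring automorphism. -/
def polyConj : Poly ≃+* Poly :=
  RingEquiv.ofRingHom polyConjHom polyConjHom (RingHom.ext polyConjHom_polyConjHom)
    (RingHom.ext polyConjHom_polyConjHom)

theorem polyConj_C (c : ℂ) : polyConj (MvPolynomial.C c) = MvPolynomial.C (starRingEnd ℂ c) :=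
  polyConjHom_C c

theorem polyConj_polyConj (f : Poly) : polyConj (polyConj f) = f := polyConjHom_polyConjHom f

theorem polyConj_smul (c : ℂ) (f : Poly) : polyConj (c • f) = starRingEnd ℂ c • polyConj f := by
  rw [MvPolynomial.smul_eq_C_mul, map_mul, polyConj_C, MvPolynomial.smul_eq_C_mul]

/-- The action of complex conjugation on the torus: `σ(l₁, l₂) = (conj l₂, conj l₁)`. -/
def torusConj : Torus →* Torus where
  toFun l i := Units.map (starRingEnd ℂ).toMonoidHom (l (Equiv.swap (0 : Fin 2) 1 i))
  map_one' := by ext i; simp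
  map_mul' l m := by ext i; simp

theorem torusPoly_torusConj (l : Torus) (f : Poly) :
    torusPoly (torusConj l) (polyConj f) = polyConj (torusPoly l f) := by
  have : (scaleHom (torusConj l)).toRingHom.comp polyConjHom =
      polyConjHom.comp (scaleHom l).toRingHom := by
    refine MvPolynomial.ringHom_ext (fun c => ?_) (fun i => ?_)
    · simp [polyConjHom_C, ← MvPolynomial.algebraMap_eq]
    · simp [polyConjHom_C, polyConjHom_X, scaleHom_X, torusConj]
  exact RingHom.congr_fun this f

theorem torusConj_torusConj (l : Torus) : torusConj (torusConj l) = l := by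
  ext i; simp [torusConj]

/-- Vector fields on the affine plane. -/
abbrev VectField : Type := Derivation ℂ Poly Poly

/-- The transport `e ∘ D ∘ e⁻¹` of a vector field by a ring automorphism of `ℂ[t₁, t₂]` whose
inverse preserves the constants. -/
def transport (e : Poly ≃+* Poly) (he : ∀ c : ℂ, ∃ c' : ℂ, e.symm (MvPolynomial.C c) =
    MvPolynomial.C c') (D : VectField) : VectField :=
  Derivation.mk'
    { toFun := fun f => e (D (e.symm f))
      map_add' := fun f g => by rw [map_add, map_add, map_add]
      map_smul' := fun c f => by
        obtain ⟨c', hc'⟩ := he c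
        rw [RingHom.id_apply, MvPolynomial.smul_eq_C_mul, map_mul, hc',
          ← MvPolynomial.smul_eq_C_mul, D.map_smul, MvPolynomial.smul_eq_C_mul, map_mul, ← hc',
          RingEquiv.apply_symm_apply, MvPolynomial.smul_eq_C_mul] }
    (fun f g => by
      simp only [LinearMap.coe_mk, AddHom.coe_mk]
      rw [map_mul, Derivation.leibniz, map_add, smul_eq_mul, smul_eq_mul, map_mul, map_mul,
        RingEquiv.apply_symm_apply, RingEquiv.apply_symm_apply, smul_eq_mul, smul_eq_mul])

theorem transport_apply (e : Poly ≃+* Poly) (he) (D : VectField) (f : Poly) :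
    transport e he D f = e (D (e.symm f)) := rfl

/-- The action of the torus on vector fields. -/
def torusVect (l : Torus) : VectField → VectField :=
  transport (torusPoly l).toRingEquiv fun c => ⟨c, (torusPoly l).symm.commutes c⟩

theorem torusVect_apply (l : Torus) (D : VectField) (f : Poly) :
    torusVect l D f = torusPoly l (D ((torusPoly l).symm f)) := rfl

/-- The action of complex conjugation on vector fields. -/
def vectConj : VectField → VectField :=
  transport polyConj fun c => ⟨starRingEnd ℂ c, polyConj_C c⟩

theorem vectConj_apply (D : VectField) (f : Poly) : vectConj D f = polyConj (D (polyConj f)) := rfl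

theorem vectConj_vectConj (D : VectField) : vectConj (vectConj D) = D :=
  Derivation.ext fun f => by simp only [vectConj_apply, polyConj_polyConj]

theorem torusVect_torusConj (l : Torus) (D : VectField) :
    torusVect (torusConj l) (vectConj D) = vectConj (torusVect l D) := by
  refine Derivation.ext fun f => ?_
  have h : polyConj ((torusPoly (torusConj l)).symm f) = (torusPoly l).symm (polyConj f) := by
    rw [AlgEquiv.eq_symm_apply, ← torusConj_torusConj l, torusPoly_torusConj,
      torusConj_torusConj, AlgEquiv.apply_symm_apply]
  rw [torusVect_apply, vectConj_apply, vectConj_apply, torusVect_apply, torusPoly_torusConj, h]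

/-! ### Equivariant vector bundles with equivariant connection -/

/-- A `𝔾_m²`-equivariant algebraic vector bundle with equivariant connection on the affine plane
over `ℂ`, given by its module of global sections: an algebraic vector bundle on `Spec ℂ[t₁, t₂]` is a
finitely generated projective module, an equivariant structure is an algebraic action of the torus
on the sections which is compatible with the action on functions (`ℂ` being algebraically closed and
`𝔾_m²` reduced, the action of the complex points of the torus determines it), and a connection is
given by its covariant derivatives. The connection is not assumed to be flat. -/
structure EquivBunConn where
  /-- the global sections -/
  M : Type
  [addCommGroup : AddCommGroup M]
  [modulePoly : Module Poly M]
  [module : Module ℂ M]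
  [tower : IsScalarTower ℂ Poly M]
  /-- vector bundles are the finitely generated projective modules -/
  [finite : Module.Finite Poly M]
  [projective : Module.Projective Poly M]
  /-- the action of the torus on sections -/
  act : Torus →* Module.End ℂ M
  /-- the action lifts the action on the affine plane -/
  act_smul : ∀ l (f : Poly) m, act l (f • m) = torusPoly l f • act l m
  /-- the action is algebraic: `l ↦ l · m` is a Laurent polynomial in `l` with coefficients in `M` -/
  act_algebraic : ∀ m, ∃ c : (Fin 2 → ℤ) →₀ M, ∀ l, act l m = c.sum fun a v => torusChar a l • v
  /-- the covariant derivatives along vector fields -/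
  nabla : VectField →ₗ[Poly] Module.End ℂ M
  leibniz : ∀ D (f : Poly) m, nabla D (f • m) = D f • m + f • nabla D m
  nabla_equivariant : ∀ l D m, act l (nabla D m) = nabla (torusVect l D) (act l m)

namespace EquivBunConn

attribute [instance] addCommGroup modulePoly module tower finite projective

/-- The morphisms: homomorphisms of bundles which commute with the torus action and with the
connections. -/
def homs (E E' : EquivBunConn) : Submodule ℂ (E.M →ₗ[Poly] E'.M) where
  carrier := {f | (∀ l m, f (E.act l m) = E'.act l (f m)) ∧
    (∀ D m, f (E.nabla D m) = E'.nabla D (f m))}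
  add_mem' hf hg := ⟨fun l m => by simp [hf.1, hg.1], fun D m => by simp [hf.2, hg.2]⟩
  zero_mem' := ⟨fun l m => by simp, fun D m => by simp⟩
  smul_mem' c _ hf := ⟨fun l m => by simp [hf.1], fun D m => by simp [hf.2]⟩

instance : Category EquivBunConn where
  Hom E E' := homs E E'
  id E := ⟨LinearMap.id, fun _ _ => rfl, fun _ _ => rfl⟩
  comp f g := ⟨g.1 ∘ₗ f.1,
    fun l m => (congrArg g.1 (f.2.1 l m)).trans (g.2.1 l _),
    fun D m => (congrArg g.1 (f.2.2 D m)).trans (g.2.2 D _)⟩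

/-- The homomorphism of modules underlying a morphism. -/
def Hom.lin {E E' : EquivBunConn} (f : E ⟶ E') : E.M →ₗ[Poly] E'.M := f.1

@[ext]
theorem hom_ext {E E' : EquivBunConn} {f g : E ⟶ E'} (h : Hom.lin f = Hom.lin g) : f = g :=
  Subtype.ext h

instance : Preadditive EquivBunConn where
  homGroup E E' := inferInstanceAs (AddCommGroup (homs E E'))
  add_comp _ _ _ f f' g := hom_ext (LinearMap.comp_add f.1 f'.1 g.1)
  comp_add _ _ _ f g g' := hom_ext (LinearMap.add_comp f.1 g'.1 g.1)

theorem map_smul_complex {E E' : EquivBunConn} (f : E.M →ₗ[Poly] E'.M) (c : ℂ) (m : E.M) :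
    f (c • m) = c • f m := by
  rw [← algebraMap_smul Poly c m, map_smul, algebraMap_smul]

instance : Linear ℂ EquivBunConn where
  homModule E E' := inferInstanceAs (Module ℂ (homs E E'))
  smul_comp _ _ _ c f g := hom_ext (LinearMap.ext fun m => map_smul_complex g.1 c (f.1 m))
  comp_smul _ _ _ _ _ _ := hom_ext (LinearMap.ext fun _ => rfl)

/-- An isomorphism from a linear bijection which commutes with the torus actions and with the
connections. -/
def isoMk {E E' : EquivBunConn} (e : E.M ≃ₗ[Poly] E'.M) (h : e.toLinearMap ∈ homs E E') :
    E ≅ E' where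
  hom := ⟨e.toLinearMap, h⟩
  inv := ⟨e.symm.toLinearMap,
    fun l m => e.injective <| by
      have := h.1 l (e.symm m)
      simp only [LinearEquiv.coe_coe, LinearEquiv.apply_symm_apply] at this ⊢
      exact this.symm,
    fun D m => e.injective <| by
      have := h.2 D (e.symm m)
      simp only [LinearEquiv.coe_coe, LinearEquiv.apply_symm_apply] at this ⊢
      exact this.symm⟩
  hom_inv_id := hom_ext (LinearMap.ext fun x => e.symm_apply_apply x)
  inv_hom_id := hom_ext (LinearMap.ext fun x => e.apply_symm_apply x)

/-! #### Algebraic vectors -/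

theorem torusChar_add (a b : Fin 2 → ℤ) (l : Torus) :
    torusChar (a + b) l = torusChar a l * torusChar b l := by
  simp only [torusChar, Pi.add_apply, zpow_add, Finset.prod_mul_distrib, Units.val_mul]

theorem algebraic_add {M : Type} [AddCommGroup M] [Module ℂ M] {u u' : Torus → M}
    (h : ∃ c : (Fin 2 → ℤ) →₀ M, ∀ l, u l = c.sum fun a v => torusChar a l • v)
    (h' : ∃ c : (Fin 2 → ℤ) →₀ M, ∀ l, u' l = c.sum fun a v => torusChar a l • v) :
    ∃ c : (Fin 2 → ℤ) →₀ M, ∀ l, u l + u' l = c.sum fun a v => torusChar a l • v := by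
  obtain ⟨c, hc⟩ := h
  obtain ⟨c', hc'⟩ := h'
  refine ⟨c + c', fun l => ?_⟩
  rw [hc, hc', Finsupp.sum_add_index' (fun _ => smul_zero _) (fun _ _ _ => smul_add _ _ _)]

/-! #### The unit -/

theorem torusPoly_monomial (l : Torus) (s : Fin 2 →₀ ℕ) (a : ℂ) :
    torusPoly l (MvPolynomial.monomial s a) =
      torusChar (fun i => (s i : ℤ)) l • MvPolynomial.monomial s a := by
  rw [torusPoly_apply, scaleHom, MvPolynomial.aeval_monomial, MvPolynomial.algebraMap_eq,
    MvPolynomial.monomial_eq (s := s), MvPolynomial.smul_eq_C_mul, torusChar]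
  simp only [mul_pow, Finsupp.prod_mul, zpow_natCast]
  have : (s.prod fun i k => (MvPolynomial.C (l i : ℂ) : Poly) ^ k) =
      MvPolynomial.C (((∏ i, l i ^ s i : ℂˣ)) : ℂ) := by
    rw [Finsupp.prod_fintype _ _ (fun _ => pow_zero _)]
    simp
  rw [this]
  ring

theorem torusPoly_algebraic (f : Poly) :
    ∃ c : (Fin 2 → ℤ) →₀ Poly, ∀ l, torusPoly l f = c.sum fun a v => torusChar a l • v := by
  induction f using MvPolynomial.induction_on' with
  | monomial s a =>
    refine ⟨Finsupp.single (fun i => (s i : ℤ)) (MvPolynomial.monomial s a), fun l => ?_⟩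
    rw [Finsupp.sum_single_index (by exact smul_zero _)]
    exact torusPoly_monomial l s a
  | add p q hp hq =>
    obtain ⟨c, hc⟩ := algebraic_add hp hq
    exact ⟨c, fun l => by rw [map_add, hc]⟩

/-- The trivial bundle, with its standard equivariant structure and connection. -/
def unit : EquivBunConn where
  M := Poly
  act :=
    { toFun := fun l => (torusPoly l).toLinearMap
      map_one' := LinearMap.ext torusPoly_one
      map_mul' := fun l m => LinearMap.ext (torusPoly_mul l m) }
  act_smul l f m := map_mul (torusPoly l) f m
  act_algebraic := torusPoly_algebraic
  nabla :=
    { toFun := fun D => D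
      map_add' := fun _ _ => rfl
      map_smul' := fun _ _ => rfl }
  leibniz D f m := by
    have := D.leibniz f m
    simp only [smul_eq_mul] at this ⊢
    change D (f * m) = D f * m + f * D m
    rw [this]; ring
  nabla_equivariant l D m := by
    change torusPoly l (D m) = torusPoly l (D ((torusPoly l).symm (torusPoly l m)))
    rw [AlgEquiv.symm_apply_apply]

/-! #### The tensor product -/

/-- The action of an element of the torus, as a semilinear map. -/
def actSemi (E : EquivBunConn) (l : Torus) :
    E.M →ₛₗ[((torusPoly l : Poly ≃ₐ[ℂ] Poly) : Poly →+* Poly)] E.M :=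
  { E.act l with map_smul' := fun f m => E.act_smul l f m }

/-- The action on the tensor product: `l · (m ⊗ n) = l · m ⊗ l · n`. -/
def tensorAct (E E' : EquivBunConn) (l : Torus) : Module.End ℂ (E.M ⊗[Poly] E'.M) :=
  { TensorProduct.map (E.actSemi l) (E'.actSemi l) with
    map_smul' := fun c x => by
      have h := (TensorProduct.map (E.actSemi l) (E'.actSemi l)).map_smulₛₗ
        (algebraMap ℂ Poly c) x
      rw [algebraMap_smul] at h
      refine h.trans ?_
      rw [show ((torusPoly l : Poly ≃ₐ[ℂ] Poly) : Poly →+* Poly) (algebraMap ℂ Poly c) =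
        algebraMap ℂ Poly c from (torusPoly l).commutes c, algebraMap_smul]
      rfl }

theorem tensorAct_tmul (E E' : EquivBunConn) (l : Torus) (m : E.M) (n : E'.M) :
    tensorAct E E' l (m ⊗ₜ n) = E.act l m ⊗ₜ E'.act l n := rfl

/-- The covariant derivative on the tensor product:
`∇_D (m ⊗ n) = ∇_D m ⊗ n + m ⊗ ∇_D n`. -/
def tensorNablaAdd (E E' : EquivBunConn) (D : VectField) :
    E.M ⊗[Poly] E'.M →+ E.M ⊗[Poly] E'.M :=
  TensorProduct.liftAddHom
    (AddMonoidHom.mk' (fun m => AddMonoidHom.mk'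
      (fun n => E.nabla D m ⊗ₜ[Poly] n + m ⊗ₜ[Poly] E'.nabla D n)
      (fun n n' => by simp only [map_add, TensorProduct.tmul_add]; abel))
      (fun m m' => by
        ext n
        simp only [AddMonoidHom.mk'_apply, AddMonoidHom.add_apply, map_add,
          TensorProduct.add_tmul]
        abel))
    (fun f m n => by
      simp only [AddMonoidHom.mk'_apply, leibniz, TensorProduct.add_tmul, TensorProduct.tmul_add,
        TensorProduct.smul_tmul]
      abel)

theorem tensorNablaAdd_tmul (E E' : EquivBunConn) (D : VectField) (m : E.M) (n : E'.M) :
    tensorNablaAdd E E' D (m ⊗ₜ n) = E.nabla D m ⊗ₜ n + m ⊗ₜ E'.nabla D n := rfl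

theorem tensorNablaAdd_leibniz (E E' : EquivBunConn) (D : VectField) (f : Poly)
    (x : E.M ⊗[Poly] E'.M) :
    tensorNablaAdd E E' D (f • x) = D f • x + f • tensorNablaAdd E E' D x := by
  induction x with
  | zero => simp
  | tmul m n =>
    rw [TensorProduct.smul_tmul', tensorNablaAdd_tmul, tensorNablaAdd_tmul, leibniz,
      TensorProduct.add_tmul, smul_add, TensorProduct.smul_tmul', TensorProduct.smul_tmul',
      TensorProduct.smul_tmul', add_assoc]
  | add x y hx hy => rw [smul_add, map_add, hx, hy, map_add, smul_add, smul_add]; abel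

/-- The connection on the tensor product. -/
def tensorNabla (E E' : EquivBunConn) : VectField →ₗ[Poly] Module.End ℂ (E.M ⊗[Poly] E'.M) where
  toFun D :=
    { tensorNablaAdd E E' D with
      map_smul' := fun c x => by
        have h := tensorNablaAdd_leibniz E E' D (algebraMap ℂ Poly c) x
        rw [D.map_algebraMap, zero_smul, zero_add, algebraMap_smul, algebraMap_smul] at h
        exact h }
  map_add' D D' := by
    refine LinearMap.ext fun x => ?_
    change tensorNablaAdd E E' (D + D') x = tensorNablaAdd E E' D x + tensorNablaAdd E E' D' x
    induction x with
    | zero => simp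
    | tmul m n =>
      simp only [tensorNablaAdd_tmul, map_add, LinearMap.add_apply, TensorProduct.add_tmul,
        TensorProduct.tmul_add]
      abel
    | add x y hx hy => simp only [map_add, hx, hy]; abel
  map_smul' f D := by
    refine LinearMap.ext fun x => ?_
    change tensorNablaAdd E E' (f • D) x = f • tensorNablaAdd E E' D x
    induction x with
    | zero => simp
    | tmul m n =>
      simp only [tensorNablaAdd_tmul, map_smul, LinearMap.smul_apply, smul_add,
        TensorProduct.smul_tmul', TensorProduct.tmul_smul]
    | add x y hx hy => simp only [map_add, hx, hy, smul_add]

theorem tensorNabla_tmul (E E' : EquivBunConn) (D : VectField) (m : E.M) (n : E'.M) :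
    tensorNabla E E' D (m ⊗ₜ n) = E.nabla D m ⊗ₜ n + m ⊗ₜ E'.nabla D n := rfl

/-- The tensor product of equivariant bundles with connection. -/
def tensor (E E' : EquivBunConn) : EquivBunConn where
  M := E.M ⊗[Poly] E'.M
  act :=
    { toFun := tensorAct E E'
      map_one' := by
        refine LinearMap.ext fun x => ?_
        induction x with
        | zero => simp
        | tmul m n => rw [tensorAct_tmul, map_one, map_one]; rfl
        | add x y hx hy => rw [map_add, hx, hy, map_add]
      map_mul' := fun l l' => by
        refine LinearMap.ext fun x => ?_
        induction x with
        | zero => simp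
        | tmul m n => rw [tensorAct_tmul, map_mul, map_mul]; rfl
        | add x y hx hy => rw [map_add, hx, hy, map_add] }
  act_smul l f x := (TensorProduct.map (E.actSemi l) (E'.actSemi l)).map_smulₛₗ f x
  act_algebraic x := by
    induction x with
    | zero => exact ⟨0, fun l => by simp⟩
    | tmul m n =>
      obtain ⟨c, hc⟩ := E.act_algebraic m
      obtain ⟨d, hd⟩ := E'.act_algebraic n
      refine ⟨c.sum fun a v => d.sum fun b w => Finsupp.single (a + b) (v ⊗ₜ[Poly] w), fun l => ?_⟩
      rw [Finsupp.sum_sum_index (fun _ => smul_zero _) (fun _ _ _ => smul_add _ _ _)]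
      refine (congrArg₂ (fun u v => u ⊗ₜ[Poly] v) (hc l) (hd l)).trans ?_
      rw [Finsupp.sum, TensorProduct.sum_tmul]
      refine Finset.sum_congr rfl fun a _ => ?_
      dsimp only
      rw [Finsupp.sum_sum_index (fun _ => smul_zero _) (fun _ _ _ => smul_add _ _ _),
        Finsupp.sum, TensorProduct.tmul_sum]
      refine Finset.sum_congr rfl fun b _ => ?_
      dsimp only
      rw [Finsupp.sum_single_index (by exact smul_zero _), torusChar_add, mul_smul,
        ← algebraMap_smul Poly (torusChar b l) (d b), TensorProduct.tmul_smul, algebraMap_smul,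
        ← TensorProduct.smul_tmul', smul_comm]
    | add x y hx hy =>
      obtain ⟨c, hc⟩ := algebraic_add hx hy
      exact ⟨c, fun l => by rw [map_add, hc]⟩
  nabla := tensorNabla E E'
  leibniz D f x := tensorNablaAdd_leibniz E E' D f x
  nabla_equivariant l D x := by
    change tensorAct E E' l (tensorNabla E E' D x) =
      tensorNabla E E' (torusVect l D) (tensorAct E E' l x)
    induction x with
    | zero => simp
    | tmul m n =>
      rw [tensorNabla_tmul, map_add, tensorAct_tmul, tensorAct_tmul, tensorAct_tmul,
        tensorNabla_tmul, nabla_equivariant, nabla_equivariant]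
    | add x y hx hy => simp only [map_add, hx, hy]

theorem mem_homs_tensor {E E' G : EquivBunConn} (φ : E.M ⊗[Poly] E'.M →ₗ[Poly] G.M)
    (h1 : ∀ l m n, φ (E.act l m ⊗ₜ E'.act l n) = G.act l (φ (m ⊗ₜ n)))
    (h2 : ∀ D m n, φ (E.nabla D m ⊗ₜ n) + φ (m ⊗ₜ E'.nabla D n) = G.nabla D (φ (m ⊗ₜ n))) :
    φ ∈ homs (tensor E E') G := by
  refine ⟨fun l (x : E.M ⊗[Poly] E'.M) => ?_, fun D (x : E.M ⊗[Poly] E'.M) => ?_⟩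
  · change φ (tensorAct E E' l x) = G.act l (φ x)
    induction x with
    | zero => simp
    | tmul m n => rw [tensorAct_tmul, h1]
    | add x y hx hy => simp only [map_add, hx, hy]
  · change φ (tensorNabla E E' D x) = G.nabla D (φ x)
    induction x with
    | zero => simp
    | tmul m n => rw [tensorNabla_tmul, map_add, h2]
    | add x y hx hy => simp only [map_add, hx, hy]

theorem map_mem_homs {E E' G G' : EquivBunConn} {f : E.M →ₗ[Poly] G.M} {g : E'.M →ₗ[Poly] G'.M}
    (hf : f ∈ homs E G) (hg : g ∈ homs E' G') :
    TensorProduct.map f g ∈ homs (tensor E E') (tensor G G') :=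
  mem_homs_tensor (G := tensor G G') _
    (fun l m n => congrArg₂ (fun u v => u ⊗ₜ[Poly] v) (hf.1 l m) (hg.1 l n))
    (fun D m n => congrArg₂ (fun u v => u ⊗ₜ[Poly] g n + f m ⊗ₜ[Poly] v) (hf.2 D m) (hg.2 D n))

theorem assoc_mem_homs (E E' E'' : EquivBunConn) :
    (TensorProduct.assoc Poly E.M E'.M E''.M).toLinearMap ∈
      homs (tensor (tensor E E') E'') (tensor E (tensor E' E'')) := by
  refine mem_homs_tensor (E := tensor E E') (E' := E'') (G := tensor E (tensor E' E'')) _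
    (fun l (x : E.M ⊗[Poly] E'.M) n => ?_) (fun D (x : E.M ⊗[Poly] E'.M) n => ?_)
  · let T : Module.End ℂ (E.M ⊗[Poly] (E'.M ⊗[Poly] E''.M)) := tensorAct E (tensor E' E'') l
    change TensorProduct.assoc Poly E.M E'.M E''.M (tensorAct E E' l x ⊗ₜ E''.act l n) =
      T (TensorProduct.assoc Poly E.M E'.M E''.M (x ⊗ₜ n))
    induction x with
    | zero => simp
    | tmul m m' => rfl
    | add x y hx hy => simp only [map_add, TensorProduct.add_tmul, hx, hy]
  · let T : Module.End ℂ (E.M ⊗[Poly] (E'.M ⊗[Poly] E''.M)) := tensorNabla E (tensor E' E'') D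
    have hT : ∀ m z, T (m ⊗ₜ z) = E.nabla D m ⊗ₜ z + m ⊗ₜ tensorNabla E' E'' D z :=
      fun _ _ => rfl
    change TensorProduct.assoc Poly E.M E'.M E''.M (tensorNabla E E' D x ⊗ₜ n) +
        TensorProduct.assoc Poly E.M E'.M E''.M (x ⊗ₜ E''.nabla D n) =
      T (TensorProduct.assoc Poly E.M E'.M E''.M (x ⊗ₜ n))
    induction x with
    | zero => simp
    | tmul m m' =>
      rw [tensorNabla_tmul, TensorProduct.add_tmul, map_add, TensorProduct.assoc_tmul,
        TensorProduct.assoc_tmul, TensorProduct.assoc_tmul, TensorProduct.assoc_tmul, hT,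
        tensorNabla_tmul, TensorProduct.tmul_add, add_assoc]
    | add x y hx hy =>
      rw [map_add, TensorProduct.add_tmul, TensorProduct.add_tmul, TensorProduct.add_tmul,
        map_add, map_add, map_add, map_add, ← hx, ← hy]
      abel

instance : MonoidalCategoryStruct EquivBunConn where
  tensorObj := tensor
  tensorUnit := unit
  tensorHom f g := ⟨TensorProduct.map f.1 g.1, map_mem_homs f.2 g.2⟩
  whiskerLeft X _ _ g := ⟨TensorProduct.map LinearMap.id g.1, map_mem_homs (𝟙 X : X ⟶ X).2 g.2⟩
  whiskerRight f Y := ⟨TensorProduct.map f.1 LinearMap.id, map_mem_homs f.2 (𝟙 Y : Y ⟶ Y).2⟩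
  associator X Y Z := isoMk (E := tensor (tensor X Y) Z) (E' := tensor X (tensor Y Z))
    (TensorProduct.assoc Poly X.M Y.M Z.M) (assoc_mem_homs X Y Z)
  leftUnitor X := isoMk (E := tensor unit X) (TensorProduct.lid Poly X.M)
    (mem_homs_tensor (E := unit) _ (fun l f m => (X.act_smul l f m).symm)
      (fun D f m => (X.leibniz D f m).symm))
  rightUnitor X := isoMk (E := tensor X unit) (TensorProduct.rid Poly X.M)
    (mem_homs_tensor (E' := unit) _ (fun l m f => (X.act_smul l f m).symm)
      (fun D m f => (add_comm _ _).trans (X.leibniz D f m).symm))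

instance : MonoidalCategory EquivBunConn := MonoidalCategory.ofTensorHom
  (id_tensorHom_id := fun _ _ => hom_ext (TensorProduct.ext' fun _ _ => rfl))
  (id_tensorHom := fun _ _ _ _ => rfl)
  (tensorHom_id := fun _ _ => rfl)
  (tensorHom_comp_tensorHom := fun _ _ _ _ => hom_ext (TensorProduct.ext' fun _ _ => rfl))
  (associator_naturality := fun _ _ _ => hom_ext (TensorProduct.ext_threefold fun _ _ _ => rfl))
  (leftUnitor_naturality := fun f => hom_ext (TensorProduct.ext' fun c x =>
    (f.1.map_smul (show Poly from c) x).symm))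
  (rightUnitor_naturality := fun f => hom_ext (TensorProduct.ext' fun x c =>
    (f.1.map_smul (show Poly from c) x).symm))
  (pentagon := fun _ _ _ _ => hom_ext (TensorProduct.ext_fourfold fun _ _ _ _ => rfl))
  (triangle := fun _ _ => hom_ext (TensorProduct.ext_threefold fun x c y =>
    (TensorProduct.smul_tmul (R := Poly) (show Poly from c) x y).symm))

instance : SymmetricCategory EquivBunConn where
  braiding X Y := isoMk (E := tensor X Y) (E' := tensor Y X) (TensorProduct.comm Poly X.M Y.M)
    (mem_homs_tensor (G := tensor Y X) _ (fun _ _ _ => rfl) (fun _ _ _ => add_comm _ _))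
  braiding_naturality_right _ _ _ _ := hom_ext (TensorProduct.ext' fun _ _ => rfl)
  braiding_naturality_left _ _ := hom_ext (TensorProduct.ext' fun _ _ => rfl)
  hexagon_forward _ _ _ := hom_ext (TensorProduct.ext_threefold fun _ _ _ => rfl)
  hexagon_reverse X Y Z := by
    rw [← cancel_epi (α_ X Y Z).hom]
    exact hom_ext (TensorProduct.ext_threefold fun _ _ _ => rfl)
  symmetry _ _ := hom_ext (TensorProduct.ext' fun _ _ => rfl)

/-! #### Complex conjugation of bundles -/

/-- `f σ(m) = σ(σ(f) m)`. -/
instance (M : Type) [AddCommGroup M] [Module Poly M] : Module Poly (Conj M) where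
  smul f x := ⟨polyConj f • x.val⟩
  one_smul x := congrArg Conj.mk (by rw [map_one, one_smul])
  mul_smul c d x := congrArg Conj.mk (by rw [map_mul, mul_smul]; rfl)
  smul_zero c := congrArg Conj.mk (smul_zero _)
  smul_add c x y := congrArg Conj.mk (smul_add _ _ _)
  add_smul c d x := congrArg Conj.mk (by rw [map_add, add_smul]; rfl)
  zero_smul x := congrArg Conj.mk (by rw [map_zero, zero_smul])

instance (M : Type) [AddCommGroup M] [Module Poly M] [Module ℂ M] [IsScalarTower ℂ Poly M] :
    IsScalarTower ℂ Poly (Conj M) where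
  smul_assoc c f x := congrArg Conj.mk (by
    rw [polyConj_smul, smul_assoc]; rfl)

instance : RingHomInvPair (polyConj : Poly →+* Poly) (polyConj : Poly →+* Poly) :=
  ⟨RingHom.ext polyConj_polyConj, RingHom.ext polyConj_polyConj⟩

/-- The semilinear bijection `m ↦ σ(m)`. -/
def conjPoly (M : Type) [AddCommGroup M] [Module Poly M] :
    M ≃ₛₗ[(polyConj : Poly →+* Poly)] Conj M :=
  { toConj M with
    map_smul' := fun f m => congrArg Conj.mk (by
      rw [show (polyConj : Poly →+* Poly) f = polyConj f from rfl, polyConj_polyConj]; rfl) }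

/-- The linear map `σ(M) → σ(M')`, `σ(m) ↦ σ(f(m))`. -/
def conjMapPoly {M M' : Type} [AddCommGroup M] [Module Poly M] [AddCommGroup M'] [Module Poly M']
    (f : M →ₗ[Poly] M') : Conj M →ₗ[Poly] Conj M' :=
  (conjPoly M').toLinearMap ∘ₛₗ f ∘ₛₗ (conjPoly M).symm.toLinearMap

theorem torusChar_torusConj (a : Fin 2 → ℤ) (l : Torus) :
    torusChar a (torusConj l) =
      starRingEnd ℂ (torusChar (fun i => a (Equiv.swap (0 : Fin 2) 1 i)) l) := by
  simp [torusChar, torusConj, Fin.prod_univ_two, mul_comm]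

/-- The complex conjugate bundle, i.e. the transform of the bundle by the involution
`σ(t₁, t₂) = (conj t₂, conj t₁)` of the affine plane and the similar involution of the torus. -/
def conj (E : EquivBunConn) : EquivBunConn where
  M := Conj E.M
  finite := Module.Finite.of_surjective (conjPoly E.M).toLinearMap (conjPoly E.M).surjective
  projective := Module.Projective.of_equiv (conjPoly E.M)
  act :=
    { toFun := fun l => conjMap (E.act (torusConj l))
      map_one' := by rw [map_one, map_one]; rfl
      map_mul' := fun l l' => by rw [map_mul, map_mul]; rfl }
  act_smul l f x := congrArg Conj.mk (by
    refine (E.act_smul (torusConj l) (polyConj f) x.val).trans ?_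
    rw [torusPoly_torusConj]; rfl)
  act_algebraic x := by
    obtain ⟨c, hc⟩ := E.act_algebraic x.val
    let s : (Fin 2 → ℤ) ≃ (Fin 2 → ℤ) := Equiv.arrowCongr (Equiv.swap 0 1) (Equiv.refl ℤ)
    refine ⟨(c.mapRange (toConj E.M) (map_zero _)).equivMapDomain s, fun l => ?_⟩
    have h1 : conjMap (E.act (torusConj l)) x = toConj E.M (E.act (torusConj l) x.val) := rfl
    refine h1.trans ?_
    rw [hc, Finsupp.sum_equivMapDomain, Finsupp.sum_mapRange_index (fun _ => smul_zero _),
      Finsupp.sum, map_sum]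
    refine Finset.sum_congr rfl fun a _ => ?_
    dsimp only
    rw [torusChar_torusConj, conj_smul]
    rfl
  nabla :=
    { toFun := fun D => conjMap (E.nabla (vectConj D))
      map_add' := fun D D' => by
        have : vectConj (D + D') = vectConj D + vectConj D' :=
          Derivation.ext fun f => by simp [vectConj_apply]
        rw [this, map_add]; rfl
      map_smul' := fun f D => by
        have : vectConj (f • D) = polyConj f • vectConj D :=
          Derivation.ext fun g => by simp [vectConj_apply]
        rw [this, map_smul]; rfl }
  leibniz D f x := congrArg Conj.mk (by
    refine (E.leibniz (vectConj D) (polyConj f) x.val).trans ?_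
    rw [vectConj_apply, polyConj_polyConj]; rfl)
  nabla_equivariant l D x := congrArg Conj.mk (by
    refine (E.nabla_equivariant (torusConj l) (vectConj D) x.val).trans ?_
    rw [torusVect_torusConj]; rfl)

/-- The functor `σ` of complex conjugation. -/
def conjFunctor : EquivBunConn ⥤ EquivBunConn where
  obj := conj
  map {E E'} f := ⟨conjMapPoly (M := E.M) (M' := E'.M) f.1,
    fun l x => congrArg Conj.mk (f.2.1 (torusConj l) x.val),
    fun D x => congrArg Conj.mk (f.2.2 (vectConj D) x.val)⟩

/-- `σ(M) ⊗ σ(M') = σ(M ⊗ M')`. -/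
def conjTensor (M M' : Type) [AddCommGroup M] [Module Poly M] [AddCommGroup M'] [Module Poly M'] :
    Conj M ⊗[Poly] Conj M' ≃ₗ[Poly] Conj (M ⊗[Poly] M') :=
  (TensorProduct.congr (conjPoly M) (conjPoly M')).symm.trans (conjPoly (M ⊗[Poly] M'))

/-- The isomorphism `ℂ[t₁, t₂] ≅ σ(ℂ[t₁, t₂])`, `f ↦ f σ(1)`. -/
def conjUnit : Poly ≃ₗ[Poly] Conj Poly where
  toFun f := ⟨polyConj f⟩
  invFun x := polyConj x.val
  map_add' a b := congrArg Conj.mk (map_add polyConj a b)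
  map_smul' a b := congrArg Conj.mk (map_mul polyConj a b)
  left_inv c := polyConj_polyConj c
  right_inv x := congrArg Conj.mk (polyConj_polyConj x.val)

/-- `σ(σ(M)) = M`. -/
def conjConj (M : Type) [AddCommGroup M] [Module Poly M] : Conj (Conj M) ≃ₗ[Poly] M :=
  (conjPoly (Conj M)).symm.trans (conjPoly M).symm

/-- Complex conjugation commutes with tensor products. -/
def conjCore : conjFunctor.CoreMonoidal where
  εIso := isoMk (E := unit) (E' := conj unit) conjUnit
    ⟨fun l f => congrArg Conj.mk (torusPoly_torusConj l f).symm,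
      fun D f => congrArg (fun g : Poly => Conj.mk (polyConj (D g))) (polyConj_polyConj f).symm⟩
  μIso X Y := isoMk (E := tensor (conj X) (conj Y)) (E' := conj (tensor X Y)) (conjTensor X.M Y.M)
    (mem_homs_tensor (E := conj X) (E' := conj Y) (G := conj (tensor X Y)) _ (fun _ _ _ => rfl)
      (fun _ _ _ => rfl))
  μIso_hom_natural_left _ _ := hom_ext (TensorProduct.ext' fun _ _ => rfl)
  μIso_hom_natural_right _ _ := hom_ext (TensorProduct.ext' fun _ _ => rfl)
  associativity _ _ _ := hom_ext (TensorProduct.ext_threefold fun _ _ _ => rfl)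
  left_unitality _ := hom_ext (TensorProduct.ext' fun _ _ => rfl)
  right_unitality _ := hom_ext (TensorProduct.ext' fun _ _ => rfl)

instance : conjFunctor.Monoidal := conjCore.toMonoidal

instance : conjFunctor.Braided where
  braided _ _ := hom_ext (TensorProduct.ext' fun _ _ => rfl)

instance : GammaAction EquivBunConn where
  σ := conjFunctor
  map_add _ _ := rfl
  map_smul c f := hom_ext (LinearMap.ext fun x =>
    congrArg (fun d : ℂ => Conj.mk (d • f.1 x.val)) (Complex.conj_conj c).symm)
  sq := NatIso.ofComponents (fun X => isoMk (E := conj (conj X)) (conjConj X.M)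
    ⟨fun l x => by
        change X.act (torusConj (torusConj l)) x.val.val = _
        rw [torusConj_torusConj]; rfl,
      fun D x => by
        change X.nabla (vectConj (vectConj D)) x.val.val = _
        rw [vectConj_vectConj]; rfl⟩)
    (fun _ => rfl)
  sq_monoidal :=
    { unit := hom_ext (LinearMap.ext fun f => polyConj_polyConj f)
      tensor := fun _ _ => hom_ext (TensorProduct.ext' fun _ _ => rfl) }
  sq_coherent _ := rfl

end EquivBunConn

end HodgeConn

end

/-! Both categories are described by the same linear algebra: a finite-dimensional bigraded space
`V` with an operator `δ` all of whose components strictly lower both degrees. A `Frame` is such an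
object with a bihomogeneous basis chosen; its morphisms (`IsHom`) preserve both degrees and commute
with `δ`.

Hodge side. A frame gives the weight filtration by total degree, `F'` as the image under `exp(δ/2)`
of the filtration by the first degree, and `F''` as the image under `exp(-δ/2)` of the filtration by
the second. Every mixed Hodge structure arises so (`exists_frame`): two adapted bases, one splitting
`W` and `F'`, the other `W` and `F''`, differ by a unipotent `g`, and weight by weight `g` is
factored through an automorphism preserving the first filtration, an exponential `exp y`, and an
automorphism preserving the second (`exists_factorization`). The factorization is possible because a
bidegree shift which does not raise the weight either does not lower the first degree, or lowers
both, or does not lower the second. The near disjointness of these three cases gives rigidity: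
morphisms of mixed Hodge structures are exactly morphisms of frames (`isHom_of_mem_homs`, resting on
`isHom_of_intertwine`). In particular bigrading and `δ` are determined by the structure and are
functorial.

Bundle side. A frame gives the free module `ℂ[t₁, t₂] ⊗ V`, on which the torus acts through the
bigrading, with the connection `d + (t₁ dt₂ - t₂ dt₁) N`. Here `N` is `δ` with its component from
degree `d` to degree `e` multiplied by `t^(d - e - 1)`: the exponents are nonnegative because both
degrees drop strictly, and the extra `-1` compensates the bidegree `(1, 1)` of the form. This is a
radial gauge, since the form vanishes on the Euler field. So `1 ⊗ V` is the space of sections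
horizontal along the Euler field, it is preserved by morphisms, and morphisms of bundles are again
those of frames (`exists_isHom`).

Conversely, for an arbitrary bundle let `∇_E` be the covariant derivative along the Euler field. On
the `k`-th step of the filtration by powers of the ideal of the origin it is multiplication by `k`
modulo the next step; in a fixed total degree that filtration is finite, because a finitely
generated module has degrees bounded below. So the sections are the sum of the eigenspaces of `∇_E`
with eigenvalues `0, 1, 2, …` (`iSup_eulerSpace`). The kernel generates (`span_eulerSpace_zero`)
and, by projectivity and Nakayama's lemma, freely (`eulerLift_injective`). For a horizontal `v` the
relation `t₁ ∇₁ v + t₂ ∇₂ v = 0` forces `∇ v = (t₁ dt₂ - t₂ dt₁) n` (`exists_nabla_eq`), and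
equivariance makes the coordinates of `n` scalar multiples of monomials: these scalars are the
matrix of `δ` (`exists_frame_bun`).

The functor `hodgeBun` picks a frame of each structure; by rigidity the resulting bundle does not
depend on it (`Frame.id_mem`). Tensor products and conjugates may thus be computed in the tensor
product and conjugate frames. On the tensor product `δ` acts as a derivation. Conjugation swaps the
two degrees and replaces `δ` by `-σ(δ)`, because it exchanges `F'` and `F''`; the sign matches the
one that `t₁ dt₂ - t₂ dt₁` acquires when the coordinates are exchanged. -/

noncomputable section

namespace HodgeConn

/-! ### Exponentials of nilpotent elements -/

section NilExp

variable {A : Type} [Ring A] [Algebra ℂ A]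

/-- The rational structure of a complex algebra. -/
@[reducible] def ratAlgebra (A : Type) [Ring A] [Algebra ℂ A] : Algebra ℚ A :=
  Algebra.compHom A (algebraMap ℚ ℂ)

/-- The exponential of a nilpotent element of a complex algebra. -/
def nexp (a : A) : A :=
  letI := ratAlgebra A
  IsNilpotent.exp a

theorem nexp_eq_sum {a : A} {k : ℕ} (h : a ^ k = 0) :
    nexp a = ∑ n ∈ Finset.range k, ((n.factorial : ℂ)⁻¹) • a ^ n := by
  let := ratAlgebra A
  refine (IsNilpotent.exp_eq_sum h).trans (Finset.sum_congr rfl fun n _ => ?_)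
  change (algebraMap ℚ ℂ (n.factorial : ℚ)⁻¹) • a ^ n = _
  simp

theorem nexp_add {a b : A} (h : Commute a b) (ha : IsNilpotent a) (hb : IsNilpotent b) :
    nexp (a + b) = nexp a * nexp b := by
  let := ratAlgebra A
  exact IsNilpotent.exp_add_of_commute h ha hb

theorem nexp_neg_mul {a : A} (h : IsNilpotent a) : nexp (-a) * nexp a = 1 := by
  let := ratAlgebra A
  exact IsNilpotent.exp_neg_mul_exp_self h

theorem nexp_mul_neg {a : A} (h : IsNilpotent a) : nexp a * nexp (-a) = 1 := by
  let := ratAlgebra A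
  exact IsNilpotent.exp_mul_exp_neg_self h

theorem nexp_zero : nexp (0 : A) = 1 := by
  let := ratAlgebra A
  exact IsNilpotent.exp_zero

/-- An additive map which intertwines two nilpotent endomorphisms intertwines their
exponentials. -/
theorem nexp_intertwine {V V' : Type} [AddCommGroup V] [Module ℂ V] [AddCommGroup V'] [Module ℂ V']
    {a : Module.End ℂ V} {a' : Module.End ℂ V'} (ha : IsNilpotent a) (ha' : IsNilpotent a')
    (f : V →+ V') (h : ∀ x, f (a x) = a' (f x)) (x : V) : f (nexp a x) = nexp a' (f x) := by
  obtain ⟨m, hm⟩ := ha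
  obtain ⟨n, hn⟩ := ha'
  -- A common exponent lets both exponentials be written as sums over the same range.
  have hm' : a ^ (m + n) = 0 := by rw [pow_add, hm, zero_mul]
  have hn' : a' ^ (m + n) = 0 := by rw [pow_add, hn, mul_zero]
  have hp : ∀ k x, f ((a ^ k) x) = (a' ^ k) (f x) := by
    intro k
    induction k with
    | zero => intro x; rfl
    | succ k ih => intro x; rw [pow_succ, pow_succ, Module.End.mul_apply, Module.End.mul_apply, ih, h]
  rw [nexp_eq_sum hm', nexp_eq_sum hn', LinearMap.sum_apply, LinearMap.sum_apply, map_sum]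
  refine Finset.sum_congr rfl fun k _ => ?_
  -- The coefficients are rational, so additivity of `f` is enough. This covers the antilinear map
  -- `σ`, used in `conj_expδ`.
  rw [LinearMap.smul_apply, LinearMap.smul_apply, map_inv_natCast_smul f ℂ ℂ, hp]

end NilExp

/-! ### Linear maps with restricted matrix entries -/

section Supp

variable {V V' V'' : Type} [AddCommGroup V] [Module ℂ V] [AddCommGroup V'] [Module ℂ V']
  [AddCommGroup V''] [Module ℂ V''] {ι κ μ : Type}

/-- The linear maps whose matrix entries vanish outside of a relation. -/
def supp (b : Module.Basis ι ℂ V) (c : Module.Basis κ ℂ V') (R : κ → ι → Prop) :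
    Submodule ℂ (V →ₗ[ℂ] V') where
  carrier := {f | ∀ j k, c.repr (f (b k)) j ≠ 0 → R j k}
  zero_mem' j k h := by simp at h
  add_mem' {f g} hf hg j k h := by
    by_contra hR
    have h1 : c.repr (f (b k)) j = 0 := by by_contra h1; exact hR (hf j k h1)
    have h2 : c.repr (g (b k)) j = 0 := by by_contra h2; exact hR (hg j k h2)
    simp [h1, h2] at h
  smul_mem' s f hf j k h := hf j k fun h1 => h (by simp [h1])

variable {b : Module.Basis ι ℂ V} {c : Module.Basis κ ℂ V'} {e : Module.Basis μ ℂ V''}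

theorem supp_mono {R S : κ → ι → Prop} (h : ∀ j k, R j k → S j k) : supp b c R ≤ supp b c S :=
  fun _ hf j k hjk => h j k (hf j k hjk)

theorem supp_inf {R S : κ → ι → Prop} {f : V →ₗ[ℂ] V'} (hR : f ∈ supp b c R)
    (hS : f ∈ supp b c S) : f ∈ supp b c fun j k => R j k ∧ S j k :=
  fun j k h => ⟨hR j k h, hS j k h⟩

theorem supp_false {f : V →ₗ[ℂ] V'} (h : f ∈ supp b c fun _ _ => False) : f = 0 :=
  b.ext fun k => c.repr.injective (Finsupp.ext fun j => by
    by_contra h1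
    exact h j k (by simpa using h1))

theorem supp_comp {R : κ → ι → Prop} {S : μ → κ → Prop} {T : μ → ι → Prop} {g : V' →ₗ[ℂ] V''}
    {f : V →ₗ[ℂ] V'} (hg : g ∈ supp c e S) (hf : f ∈ supp b c R)
    (h : ∀ i j k, S i j → R j k → T i k) : g ∘ₗ f ∈ supp b e T := by
  intro i k hik
  rw [LinearMap.comp_apply, ← c.linearCombination_repr (f (b k)), Finsupp.linearCombination_apply,
    Finsupp.sum, map_sum, map_sum, Finsupp.finsetSum_apply] at hik
  obtain ⟨j, -, hj⟩ := Finset.exists_ne_zero_of_sum_ne_zero hik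
  rw [map_smul, map_smul, Finsupp.smul_apply, smul_eq_mul] at hj
  exact h i j k (hg i j (right_ne_zero_of_mul hj)) (hf j k (left_ne_zero_of_mul hj))

theorem one_mem_supp {R : ι → ι → Prop} (h : ∀ k, R k k) : (1 : Module.End ℂ V) ∈ supp b b R := by
  classical
  intro j k hjk
  rw [Module.End.one_apply, b.repr_self, Finsupp.single_apply] at hjk
  have : k = j := by by_contra h1; exact hjk (if_neg h1)
  exact this ▸ h k

/-- Turns preservation of a filtration spanned by basis vectors into a condition on single matrix
entries, so that conditions for several filtrations can be intersected and split entry by entry. -/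
theorem mem_supp_dec {p : ι → ℤ} {p' : κ → ℤ} {f : V →ₗ[ℂ] V'} :
    f ∈ supp b c (fun j k => p k ≤ p' j) ↔ ∀ n, ∀ x ∈ Submodule.span ℂ (b '' {k | n ≤ p k}),
      f x ∈ Submodule.span ℂ (c '' {j | n ≤ p' j}) := by
  constructor
  · intro hf n x hx
    have : Submodule.span ℂ (b '' {k | n ≤ p k}) ≤
        (Submodule.span ℂ (c '' {j | n ≤ p' j})).comap f := by
      rw [Submodule.span_le]
      rintro _ ⟨k, hk, rfl⟩
      rw [SetLike.mem_coe, Submodule.mem_comap, Module.Basis.mem_span_image]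
      exact fun j hj => le_trans hk (hf j k (Finsupp.mem_support_iff.1 hj))
    exact this hx
  · intro h j k hjk
    have := h (p k) (b k) (Submodule.subset_span ⟨k, le_refl (_ : ℤ), rfl⟩)
    rw [Module.Basis.mem_span_image] at this
    exact this (Finsupp.mem_support_iff.2 hjk)

theorem mem_supp_inc {p : ι → ℤ} {p' : κ → ℤ} {f : V →ₗ[ℂ] V'} :
    f ∈ supp b c (fun j k => p' j ≤ p k) ↔ ∀ n, ∀ x ∈ Submodule.span ℂ (b '' {k | p k ≤ n}),
      f x ∈ Submodule.span ℂ (c '' {j | p' j ≤ n}) := by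
  constructor
  · intro hf n x hx
    have : Submodule.span ℂ (b '' {k | p k ≤ n}) ≤
        (Submodule.span ℂ (c '' {j | p' j ≤ n})).comap f := by
      rw [Submodule.span_le]
      rintro _ ⟨k, hk, rfl⟩
      rw [SetLike.mem_coe, Submodule.mem_comap, Module.Basis.mem_span_image]
      exact fun j hj => le_trans (hf j k (Finsupp.mem_support_iff.1 hj)) hk
    exact this hx
  · intro h j k hjk
    have := h (p k) (b k) (Submodule.subset_span ⟨k, le_refl (_ : ℤ), rfl⟩)
    rw [Module.Basis.mem_span_image] at this
    exact this (Finsupp.mem_support_iff.2 hjk)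

open Classical in
/-- The linear map obtained by keeping the matrix entries in a relation only. -/
def part (b : Module.Basis ι ℂ V) (c : Module.Basis κ ℂ V') (R : κ → ι → Prop) (f : V →ₗ[ℂ] V') :
    V →ₗ[ℂ] V' :=
  b.constr ℂ fun k => c.repr.symm ((c.repr (f (b k))).filter fun j => R j k)

open Classical in
theorem repr_part (R : κ → ι → Prop) (f : V →ₗ[ℂ] V') (j : κ) (k : ι) :
    c.repr (part b c R f (b k)) j = if R j k then c.repr (f (b k)) j else 0 := by
  rw [part, Module.Basis.constr_basis, LinearEquiv.apply_symm_apply, Finsupp.filter_apply]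

theorem part_mem {R S : κ → ι → Prop} {f : V →ₗ[ℂ] V'} (hf : f ∈ supp b c S) :
    part b c R f ∈ supp b c fun j k => R j k ∧ S j k := by
  classical
  intro j k h
  rw [repr_part] at h
  by_cases hR : R j k
  · rw [if_pos hR] at h
    exact ⟨hR, hf j k h⟩
  · rw [if_neg hR] at h
    exact absurd rfl h

theorem sub_part_mem {R S : κ → ι → Prop} {f : V →ₗ[ℂ] V'} (hf : f ∈ supp b c S) :
    f - part b c R f ∈ supp b c fun j k => ¬ R j k ∧ S j k := by
  classical
  intro j k h
  rw [LinearMap.sub_apply, map_sub, Finsupp.sub_apply, repr_part] at h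
  by_cases hR : R j k
  · rw [if_pos hR] at h
    exact absurd (sub_self _) h
  · rw [if_neg hR, sub_zero] at h
    exact ⟨hR, hf j k h⟩

variable (b c) in
/-- The linear maps which lower the weight by at least `n`. -/
def lowers (w : ι → ℤ) (w' : κ → ℤ) (n : ℤ) : Submodule ℂ (V →ₗ[ℂ] V') :=
  supp b c fun j k => w' j + n ≤ w k

variable {w : ι → ℤ} {w' : κ → ℤ} {w'' : μ → ℤ}

theorem lowers_anti {m n : ℤ} (h : m ≤ n) : lowers b c w w' n ≤ lowers b c w w' m :=
  supp_mono fun _ _ _ => by omega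

theorem lowers_comp {l m n : ℤ} {g : V' →ₗ[ℂ] V''} {f : V →ₗ[ℂ] V'}
    (hg : g ∈ lowers c e w' w'' m) (hf : f ∈ lowers b c w w' n) (h : l ≤ m + n) :
    g ∘ₗ f ∈ lowers b e w w'' l :=
  supp_comp hg hf fun _ _ _ _ _ => by omega

theorem lowers_one : (1 : Module.End ℂ V) ∈ lowers b b w w 0 := one_mem_supp fun _ => by simp

theorem lowers_pow {f : Module.End ℂ V} (hf : f ∈ lowers b b w w 1) (n : ℕ) :
    f ^ n ∈ lowers b b w w n := by
  induction n with
  | zero => exact lowers_one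
  | succ n ih => rw [pow_succ]; exact lowers_comp ih hf (by push_cast; exact le_rfl)

/-- A finite basis has bounded weights, so no nonzero map lowers them too much. This ends all the
inductions on the weight. -/
theorem exists_lowers_eq_zero [Finite ι] [Finite κ] (b : Module.Basis ι ℂ V)
    (c : Module.Basis κ ℂ V') (w : ι → ℤ) (w' : κ → ℤ) :
    ∃ N : ℕ, ∀ f ∈ lowers b c w w' N, f = 0 := by
  obtain ⟨A, hA⟩ := (Set.finite_range w).bddAbove
  obtain ⟨B, hB⟩ := (Set.finite_range w').bddBelow
  refine ⟨(A - B + 1).toNat, fun f hf => supp_false (b := b) (c := c) fun j k hjk => ?_⟩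
  have h1 := hf j k hjk
  have h2 := hA ⟨k, rfl⟩
  have h3 := hB ⟨j, rfl⟩
  have h4 := Int.self_le_toNat (A - B + 1)
  dsimp only at h1
  omega

theorem lowers_nilpotent [Finite ι] {f : Module.End ℂ V} (hf : f ∈ lowers b b w w 1) :
    IsNilpotent f := by
  obtain ⟨N, hN⟩ := exists_lowers_eq_zero b b w w
  exact ⟨N, hN _ (lowers_pow hf N)⟩

/-- To leading order in the weight, `exp` is `1 + a`. If the commutator of `f` with the exponents
lowers weights by `n`, its commutator with their `(k + 1)`-st powers lowers them by `n + k`, so the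
terms of the exponential series beyond the linear one contribute only at `n + 1`. -/
theorem nexp_comp_sub_mem [Finite ι] [Finite κ] {f : V →ₗ[ℂ] V'} {a : Module.End ℂ V}
    {a' : Module.End ℂ V'} {n : ℤ} (ha : a ∈ lowers b b w w 1) (ha' : a' ∈ lowers c c w' w' 1)
    (h : a' ∘ₗ f - f ∘ₗ a ∈ lowers b c w w' n) :
    nexp a' ∘ₗ f - f ∘ₗ nexp a - (a' ∘ₗ f - f ∘ₗ a) ∈ lowers b c w w' (n + 1) := by
  have hp : ∀ k : ℕ, (a' ^ (k + 1)) ∘ₗ f - f ∘ₗ (a ^ (k + 1)) ∈ lowers b c w w' (n + k) := by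
    intro k
    induction k with
    | zero => simpa using h
    | succ k ih =>
      have e : (a' ^ (k + 1 + 1)) ∘ₗ f - f ∘ₗ (a ^ (k + 1 + 1)) =
          a' ∘ₗ ((a' ^ (k + 1)) ∘ₗ f - f ∘ₗ (a ^ (k + 1))) +
            (a' ∘ₗ f - f ∘ₗ a) ∘ₗ (a ^ (k + 1)) := by
        refine LinearMap.ext fun x => ?_
        rw [pow_succ' a' (k + 1), pow_succ' a (k + 1)]
        simp only [LinearMap.sub_apply, LinearMap.comp_apply, Module.End.mul_apply,
          LinearMap.add_apply, map_sub]
        abel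
      rw [e]
      refine Submodule.add_mem _ (lowers_comp ha' ih ?_) (lowers_comp h (lowers_pow ha (k + 1)) ?_)
      · push_cast; omega
      · push_cast; omega
  obtain ⟨r, hr⟩ := lowers_nilpotent ha
  obtain ⟨s, hs⟩ := lowers_nilpotent ha'
  have hr' : a ^ (r + s + 2) = 0 := by rw [add_assoc, pow_add, hr, zero_mul]
  have hs' : a' ^ (r + s + 2) = 0 := by rw [add_comm r s, add_assoc, pow_add, hs, zero_mul]
  -- The constant terms cancel and the linear ones are subtracted on the left, hence the shift by
  -- two in the index.
  have e : nexp a' ∘ₗ f - f ∘ₗ nexp a - (a' ∘ₗ f - f ∘ₗ a) = ∑ k ∈ Finset.range (r + s),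
      (((k + 1 + 1).factorial : ℂ)⁻¹) • ((a' ^ (k + 1 + 1)) ∘ₗ f - f ∘ₗ (a ^ (k + 1 + 1))) := by
    refine LinearMap.ext fun x => ?_
    rw [nexp_eq_sum hr', nexp_eq_sum hs', Finset.sum_range_succ', Finset.sum_range_succ',
      Finset.sum_range_succ', Finset.sum_range_succ']
    simp only [LinearMap.sub_apply, LinearMap.comp_apply, LinearMap.add_apply, LinearMap.sum_apply,
      LinearMap.smul_apply, map_add, map_sum, map_smul, smul_sub, Finset.sum_sub_distrib]
    simp
    abel
  rw [e]
  refine Submodule.sum_mem _ fun k _ => Submodule.smul_mem _ _ (lowers_anti ?_ (hp (k + 1)))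
  push_cast; omega

theorem nexp_sub_one_mem [Finite ι] {a : Module.End ℂ V} (ha : a ∈ lowers b b w w 1) :
    nexp a - 1 ∈ lowers b b w w 1 := by
  have h := nexp_comp_sub_mem (f := (1 : Module.End ℂ V)) (zero_mem _) ha (n := 1)
    (by simpa [Module.End.one_eq_id] using ha)
  have h2 := Submodule.add_mem _ (lowers_anti (by norm_num : (1:ℤ) ≤ 1 + 1) h) ha
  have e : nexp a - 1 = nexp a ∘ₗ (1 : Module.End ℂ V) - (1 : Module.End ℂ V) ∘ₗ nexp 0 -
      (a ∘ₗ (1 : Module.End ℂ V) - (1 : Module.End ℂ V) ∘ₗ 0) + a := by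
    rw [nexp_zero]
    refine LinearMap.ext fun x => ?_
    simp
  rw [e]
  exact h2

end Supp

/-! ### Bigraded vector spaces with an operator lowering both degrees -/

/-- A basis of bihomogeneous vectors, together with an endomorphism `δ` which strictly lowers both
degrees. -/
structure Frame (V : Type) [AddCommGroup V] [Module ℂ V] where
  /-- the index set of the basis -/
  ι : Type
  [fintype : Fintype ι]
  /-- the basis -/
  b : Module.Basis ι ℂ V
  /-- the bidegrees of the basis vectors -/
  d : ι → Fin 2 → ℤ
  /-- the operator lowering both degrees -/
  δ : Module.End ℂ V
  δ_mem : δ ∈ supp b b fun j k => ∀ i, d j i < d k i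

attribute [instance] Frame.fintype

namespace Frame

variable {V V' : Type} [AddCommGroup V'] [Module ℂ V'] [AddCommGroup V] [Module ℂ V]

/-- The weight of a basis vector. -/
def wt (B : Frame V) (k : B.ι) : ℤ := B.d k 0 + B.d k 1

/-- The increasing filtration by the weight. -/
def weightFil (B : Frame V) (n : ℤ) : Submodule ℂ V := Submodule.span ℂ (B.b '' {k | B.wt k ≤ n})

/-- The decreasing filtration by one of the two degrees. -/
def degFil (B : Frame V) (i : Fin 2) (n : ℤ) : Submodule ℂ V :=
  Submodule.span ℂ (B.b '' {k | n ≤ B.d k i})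

/-- The linear maps which preserve the weight filtration and one of the two filtrations by the
degree. -/
def stab (B : Frame V) (C : Frame V') (i : Fin 2) : Submodule ℂ (V →ₗ[ℂ] V') :=
  supp B.b C.b fun j k => C.wt j ≤ B.wt k ∧ B.d k i ≤ C.d j i

theorem smul_δ_mem (B : Frame V) (s : ℂ) : s • B.δ ∈ lowers B.b B.b B.wt B.wt 1 :=
  Submodule.smul_mem _ _ (supp_mono (fun j k h => by
    have h0 := h 0
    have h1 := h 1
    simp only [wt]
    omega) B.δ_mem)

theorem δ_lowers (B : Frame V) : B.δ ∈ lowers B.b B.b B.wt B.wt 1 := by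
  simpa using B.smul_δ_mem 1

theorem smul_δ_nilpotent (B : Frame V) (s : ℂ) : IsNilpotent (s • B.δ) :=
  lowers_nilpotent (B.smul_δ_mem s)

/-- The automorphism `exp(s δ)`. -/
def expδ (B : Frame V) (s : ℂ) : V ≃ₗ[ℂ] V :=
  LinearEquiv.ofLinearMap (nexp (s • B.δ)) (nexp (-(s • B.δ)))
    (nexp_mul_neg (B.smul_δ_nilpotent s)) (nexp_neg_mul (B.smul_δ_nilpotent s))

theorem expδ_apply (B : Frame V) (s : ℂ) (x : V) : B.expδ s x = nexp (s • B.δ) x := rfl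

theorem expδ_symm (B : Frame V) (s : ℂ) : (B.expδ s).symm = B.expδ (-s) :=
  LinearEquiv.ext fun x => by
    change nexp (-(s • B.δ)) x = nexp ((-s) • B.δ) x
    rw [neg_smul]

theorem expδ_add (B : Frame V) (s t : ℂ) (x : V) : B.expδ (s + t) x = B.expδ s (B.expδ t x) := by
  rw [expδ_apply, add_smul, nexp_add _ (B.smul_δ_nilpotent s) (B.smul_δ_nilpotent t)]
  · rfl
  · exact (Commute.refl B.δ).smul_left s |>.smul_right t

theorem expδ_sub_one_mem (B : Frame V) (s : ℂ) :
    (B.expδ s).toLinearMap - 1 ∈ lowers B.b B.b B.wt B.wt 1 :=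
  nexp_sub_one_mem (B.smul_δ_mem s)

theorem expδ_mem (B : Frame V) (s : ℂ) :
    (B.expδ s).toLinearMap ∈ lowers B.b B.b B.wt B.wt 0 := by
  have := Submodule.add_mem _ (lowers_anti (by norm_num : (0 : ℤ) ≤ 1) (B.expδ_sub_one_mem s))
    (lowers_one (b := B.b) (w := B.wt))
  simpa using this

theorem expδ_weightFil (B : Frame V) (s : ℂ) (n : ℤ) (x : V) (hx : x ∈ B.weightFil n) :
    B.expδ s x ∈ B.weightFil n :=
  mem_supp_inc.1 (supp_mono (fun j k h => by simpa using h) (B.expδ_mem s)) n x hx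

theorem map_expδ_weightFil (B : Frame V) (s : ℂ) (n : ℤ) :
    (B.weightFil n).map (B.expδ s).toLinearMap = B.weightFil n := by
  apply le_antisymm
  · rintro _ ⟨x, hx, rfl⟩
    exact B.expδ_weightFil s n x hx
  · intro x hx
    refine ⟨(B.expδ s).symm x, ?_, (B.expδ s).apply_symm_apply x⟩
    rw [expδ_symm]
    exact B.expδ_weightFil (-s) n x hx

/-- The first Hodge filtration of a frame. -/
def F' (B : Frame V) (n : ℤ) : Submodule ℂ V := (B.degFil 0 n).map (B.expδ (1 / 2)).toLinearMap

/-- The second Hodge filtration of a frame. -/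
def F'' (B : Frame V) (n : ℤ) : Submodule ℂ V :=
  (B.degFil 1 n).map (B.expδ (-(1 / 2))).toLinearMap

theorem mem_F' {B : Frame V} {n : ℤ} {x : V} :
    B.expδ (1 / 2) x ∈ B.F' n ↔ x ∈ B.degFil 0 n :=
  ⟨fun ⟨_, hy, h⟩ => (B.expδ _).injective h ▸ hy, fun h => ⟨x, h, rfl⟩⟩

theorem mem_F'' {B : Frame V} {n : ℤ} {x : V} :
    B.expδ (-(1 / 2)) x ∈ B.F'' n ↔ x ∈ B.degFil 1 n :=
  ⟨fun ⟨_, hy, h⟩ => (B.expδ _).injective h ▸ hy, fun h => ⟨x, h, rfl⟩⟩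

/-- The images of the basis under `exp(δ/2)` and `exp(-δ/2)` serve as the two adapted bases: `δ`
lowers weights, so both preserve the weight filtration and agree with the identity modulo lower
weight. -/
theorem adapted (B : Frame V) : Adapted B.weightFil B.F' B.F'' := by
  refine ⟨B.ι, B.b.map (B.expδ (1 / 2)), B.b.map (B.expδ (-(1 / 2))), fun k => B.d k 0,
    fun k => B.d k 1, fun n => ?_, fun n => ?_, fun n => ?_, fun n => ?_, fun k => ?_⟩
  · rw [← B.map_expδ_weightFil (1 / 2), weightFil, Submodule.map_span, Set.image_image]; rfl
  · rw [← B.map_expδ_weightFil (-(1 / 2)), weightFil, Submodule.map_span, Set.image_image]; rfl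
  · rw [F', degFil, Submodule.map_span, Set.image_image]; rfl
  · rw [F'', degFil, Submodule.map_span, Set.image_image]; rfl
  · have h := Submodule.sub_mem _ (B.expδ_sub_one_mem (1 / 2)) (B.expδ_sub_one_mem (-(1 / 2)))
    rw [sub_sub_sub_cancel_right] at h
    rw [weightFil, Module.Basis.mem_span_image]
    intro j hj
    have := h j k (Finsupp.mem_support_iff.1 hj)
    simp only [Set.mem_ofPred_eq, wt] at this ⊢
    omega

theorem exists_span_top {ι : Type} [Finite ι] (b : Module.Basis ι ℂ V) (p : ι → ℤ) :
    (∃ n, Submodule.span ℂ (b '' {k | n ≤ p k}) = ⊤) ∧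
      ∃ n, Submodule.span ℂ (b '' {k | n ≤ p k}) = ⊥ := by
  obtain ⟨A, hA⟩ := (Set.finite_range p).bddBelow
  obtain ⟨A', hA'⟩ := (Set.finite_range p).bddAbove
  constructor
  · refine ⟨A, ?_⟩
    rw [Set.eq_univ_of_forall (s := {k | A ≤ p k}) fun k => hA ⟨k, rfl⟩, Set.image_univ, b.span_eq]
  · refine ⟨A' + 1, ?_⟩
    rw [Set.eq_empty_of_forall_notMem (s := {k | A' + 1 ≤ p k}) fun k hk => ?_, Set.image_empty,
      Submodule.span_empty]
    have := hA' ⟨k, rfl⟩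
    simp only [Set.mem_ofPred_eq] at hk
    omega

/-- The mixed Hodge structure attached to a frame. -/
def mhs (B : Frame V) : ComplexMHS where
  V := V
  finiteDimensional := Module.Finite.of_basis B.b
  W := B.weightFil
  F' := B.F'
  F'' := B.F''
  isInc_W := by
    obtain ⟨⟨n, hn⟩, m, hm⟩ := exists_span_top B.b fun k => - B.wt k
    refine ⟨fun m n h => Submodule.span_mono (Set.image_mono fun k hk => le_trans hk h),
      ⟨-n, ?_⟩, ⟨-m, ?_⟩⟩
    · rw [← hn, weightFil]; simp only [le_neg]
    · rw [← hm, weightFil]; simp only [le_neg]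
  isDec_F' := by
    obtain ⟨⟨n, hn⟩, m, hm⟩ := exists_span_top B.b fun k => B.d k 0
    refine ⟨fun m n h => Submodule.map_mono
      (Submodule.span_mono (Set.image_mono fun k hk => le_trans h hk)), ⟨n, ?_⟩, ⟨m, ?_⟩⟩
    · rw [F', degFil, hn, Submodule.map_top, LinearEquiv.range]
    · rw [F', degFil, hm, Submodule.map_bot]
  isDec_F'' := by
    obtain ⟨⟨n, hn⟩, m, hm⟩ := exists_span_top B.b fun k => B.d k 1
    refine ⟨fun m n h => Submodule.map_mono
      (Submodule.span_mono (Set.image_mono fun k hk => le_trans h hk)), ⟨n, ?_⟩, ⟨m, ?_⟩⟩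
    · rw [F'', degFil, hn, Submodule.map_top, LinearEquiv.range]
    · rw [F'', degFil, hm, Submodule.map_bot]
  opposed := B.adapted.opposed

/-! ### Morphisms of frames and of mixed Hodge structures -/

/-- The linear maps which preserve both degrees. -/
def degreeZero (B : Frame V) (C : Frame V') : Submodule ℂ (V →ₗ[ℂ] V') :=
  supp B.b C.b fun j k => C.d j = B.d k

/-- A linear map is a morphism of frames if it preserves both degrees and commutes with `δ`. -/
structure IsHom (B : Frame V) (C : Frame V') (f : V →ₗ[ℂ] V') : Prop where
  mem : f ∈ degreeZero B C
  comm : f ∘ₗ B.δ = C.δ ∘ₗ f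

theorem IsHom.expδ {B : Frame V} {C : Frame V'} {f : V →ₗ[ℂ] V'} (h : IsHom B C f) (s : ℂ) (x : V) :
    f (B.expδ s x) = C.expδ s (f x) :=
  nexp_intertwine (B.smul_δ_nilpotent s) (C.smul_δ_nilpotent s) f.toAddMonoidHom (fun x => by
    have := LinearMap.congr_fun h.comm x
    simp only [LinearMap.comp_apply] at this
    simp [this]) x

/-- The frame `B` of the space underlying a mixed Hodge structure defines its three filtrations. -/
structure IsFrameOf (B : Frame V) (W G' G'' : ℤ → Submodule ℂ V) : Prop where
  W : ∀ n, W n = B.weightFil n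
  F' : ∀ n, G' n = B.F' n
  F'' : ∀ n, G'' n = B.F'' n

/-- Commuting with `δ` implies commuting with `exp(±δ/2)`, which reduces the Hodge filtrations to
the degree filtrations. -/
theorem IsHom.mem_homs {X Y : ComplexMHS} {B : Frame X.V} {C : Frame Y.V}
    (hB : B.IsFrameOf X.W X.F' X.F'') (hC : C.IsFrameOf Y.W Y.F' Y.F'') {f : X.V →ₗ[ℂ] Y.V}
    (h : IsHom B C f) : f ∈ ComplexMHS.homs X Y := by
  have hd : ∀ i n x, x ∈ B.degFil i n → f x ∈ C.degFil i n := fun i n x hx =>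
    mem_supp_dec.1 (supp_mono (fun j k hjk => by simp [hjk]) h.mem) n x hx
  refine ⟨fun n x hx => ?_, fun n x hx => ?_, fun n x hx => ?_⟩
  · rw [hB.W] at hx
    rw [hC.W]
    exact mem_supp_inc.1 (supp_mono (fun j k hjk => by simp [wt, hjk]) h.mem) n x hx
  · rw [hB.F'] at hx
    rw [hC.F']
    obtain ⟨y, hy, rfl⟩ := hx
    rw [LinearEquiv.coe_coe, h.expδ]
    exact mem_F'.2 (hd 0 n y hy)
  · rw [hB.F''] at hx
    rw [hC.F'']
    obtain ⟨y, hy, rfl⟩ := hx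
    rw [LinearEquiv.coe_coe, h.expδ]
    exact mem_F''.2 (hd 1 n y hy)

/-- Linear maps preserving the weights, intertwined by the exponentials, the first preserving the
first degree filtration and the second one the second. -/
theorem isHom_of_intertwine {B : Frame V} {C : Frame V'} {f g : V →ₗ[ℂ] V'}
    (hf : f ∈ stab B C 0) (hg : g ∈ stab B C 1)
    (h : (C.expδ 1).toLinearMap ∘ₗ f = g ∘ₗ (B.expδ 1).toLinearMap) : IsHom B C f := by
  -- The bidegree `(0, 0)` part of `f`. The claim is that `f - f₀`, `g - f₀` and the commutator of
  -- `f₀` with `δ` all vanish.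
  set f₀ := part B.b C.b (fun j k => C.d j = B.d k) f with hf₀
  have h₀ : f₀ ∈ degreeZero B C := supp_mono (fun j k hjk => hjk.1) (part_mem hf)
  have h₀' : f₀ ∈ lowers B.b C.b B.wt C.wt 0 :=
    supp_mono (fun j k hjk => by simp [wt, hjk]) h₀
  have hx : f - f₀ ∈ supp B.b C.b fun j k => C.d j ≠ B.d k ∧ C.wt j ≤ B.wt k ∧ B.d k 0 ≤ C.d j 0 :=
    sub_part_mem hf
  have hz : g - f₀ ∈ stab B C 1 := Submodule.sub_mem _ hg
    (supp_mono (fun j k hjk => by simp [wt, hjk]) h₀)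
  have hD : C.δ ∘ₗ f₀ - f₀ ∘ₗ B.δ ∈ supp B.b C.b fun j k => ∀ i, C.d j i < B.d k i :=
    Submodule.sub_mem _ (supp_comp C.δ_mem h₀ fun i j k h1 h2 a => by rw [← h2]; exact h1 a)
      (supp_comp h₀ B.δ_mem fun i j k h1 h2 a => by rw [h1]; exact h2 a)
  -- All three are shown together to lower weights by at least `n`, for every `n`.
  have key : ∀ n : ℕ, f - f₀ ∈ lowers B.b C.b B.wt C.wt n ∧
      g - f₀ ∈ lowers B.b C.b B.wt C.wt n ∧
      C.δ ∘ₗ f₀ - f₀ ∘ₗ B.δ ∈ lowers B.b C.b B.wt C.wt n := by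
    intro n
    induction n with
    | zero =>
      refine ⟨supp_mono (fun j k hjk => by simpa using hjk.2.1) hx,
        supp_mono (fun j k hjk => by simpa using hjk.1) hz,
        supp_mono (fun j k hjk => ?_) hD⟩
      have h0 := hjk 0
      have h1 := hjk 1
      simp only [wt, CharP.cast_eq_zero, add_zero]
      omega
    | succ n ih =>
      obtain ⟨i1, i2, i3⟩ := ih
      have a1 := nexp_comp_sub_mem B.δ_lowers C.δ_lowers i3
      have e1 : nexp C.δ = (C.expδ 1).toLinearMap := by
        refine LinearMap.ext fun x => ?_; simp [expδ_apply]
      have e2 : nexp B.δ = (B.expδ 1).toLinearMap := by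
        refine LinearMap.ext fun x => ?_; simp [expδ_apply]
      rw [e1, e2] at a1
      have a2 : ((C.expδ 1).toLinearMap - 1) ∘ₗ (f - f₀) ∈ lowers B.b C.b B.wt C.wt (n + 1) :=
        lowers_comp (C.expδ_sub_one_mem 1) i1 (by omega)
      have a3 : (g - f₀) ∘ₗ ((B.expδ 1).toLinearMap - 1) ∈ lowers B.b C.b B.wt C.wt (n + 1) :=
        lowers_comp i2 (B.expδ_sub_one_mem 1) (by omega)
      -- The relation `exp(δ) f = g exp(δ)` to leading order: the factors `exp(δ) - 1` lower the
      -- weight once more, and the commutator of `f₀` with `exp(δ)` is replaced by the one with `δ`.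
      have a4 : (C.δ ∘ₗ f₀ - f₀ ∘ₗ B.δ) + (f - f₀) - (g - f₀) ∈
          lowers B.b C.b B.wt C.wt (n + 1) := by
        have := Submodule.sub_mem _ (Submodule.sub_mem _ a3 a2) a1
        convert this using 1
        refine LinearMap.ext fun x => ?_
        have hx := LinearMap.congr_fun h x
        simp only [LinearMap.comp_apply, LinearEquiv.coe_coe] at hx
        simp only [LinearMap.sub_apply, LinearMap.add_apply, LinearMap.comp_apply, map_sub,
          LinearEquiv.coe_coe, Module.End.one_apply, hx]
        abel
      -- Among entries dropping the weight by exactly `n`, the three terms have disjoint supports.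
      -- The commutator lowers both degrees, while `f - f₀` does not lower the first and `g - f₀`
      -- does not lower the second. An entry common to the last two would lower neither degree
      -- without raising the weight, hence have bidegree `(0, 0)`, which `f - f₀` excludes. So a
      -- vanishing sum means that each term vanishes.
      have cancel : ∀ j k, B.wt k = C.wt j + n →
          C.b.repr ((f - f₀) (B.b k)) j = 0 ∧ C.b.repr ((g - f₀) (B.b k)) j = 0 ∧
            C.b.repr ((C.δ ∘ₗ f₀ - f₀ ∘ₗ B.δ) (B.b k)) j = 0 := by
        intro j k hjk
        have hs : C.b.repr ((C.δ ∘ₗ f₀ - f₀ ∘ₗ B.δ) (B.b k)) j +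
            C.b.repr ((f - f₀) (B.b k)) j - C.b.repr ((g - f₀) (B.b k)) j = 0 := by
          by_contra hne
          have := a4 j k (by
            rwa [LinearMap.sub_apply, LinearMap.add_apply, map_sub, map_add, Finsupp.sub_apply,
              Finsupp.add_apply])
          dsimp only at this
          omega
        have n1 := hx j k
        have n2 := hz j k
        have n3 := hD j k
        simp only [wt, ne_eq, funext_iff, Fin.forall_fin_two] at hjk n1 n2 n3
        by_cases c3 : C.b.repr ((C.δ ∘ₗ f₀ - f₀ ∘ₗ B.δ) (B.b k)) j = 0
        · rw [c3, zero_add] at hs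
          by_cases c1 : C.b.repr ((f - f₀) (B.b k)) j = 0
          · rw [c1, zero_sub, neg_eq_zero] at hs
            exact ⟨c1, hs, c3⟩
          · have c2 : C.b.repr ((g - f₀) (B.b k)) j ≠ 0 := by
              rw [← sub_eq_zero.1 hs]; exact c1
            have := n1 c1
            have := n2 c2
            omega
        · have := n3 c3
          have c1 : C.b.repr ((f - f₀) (B.b k)) j = 0 := by
            by_contra c1
            have := n1 c1
            omega
          have c2 : C.b.repr ((g - f₀) (B.b k)) j = 0 := by
            by_contra c2
            have := n2 c2
            omega
          rw [c1, c2] at hs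
          simp only [add_zero, sub_zero] at hs
          exact absurd hs c3
      push_cast
      refine ⟨fun j k hjk => ?_, fun j k hjk => ?_, fun j k hjk => ?_⟩
      · have h1 := i1 j k hjk
        have h2 : B.wt k ≠ C.wt j + n := fun h2 => hjk (cancel j k h2).1
        dsimp only at h1
        omega
      · have h1 := i2 j k hjk
        have h2 : B.wt k ≠ C.wt j + n := fun h2 => hjk (cancel j k h2).2.1
        dsimp only at h1
        omega
      · have h1 := i3 j k hjk
        have h2 : B.wt k ≠ C.wt j + n := fun h2 => hjk (cancel j k h2).2.2
        dsimp only at h1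
        omega
  obtain ⟨N, hN⟩ := exists_lowers_eq_zero B.b C.b B.wt C.wt
  obtain ⟨k1, -, k3⟩ := key N
  have e0 : f = f₀ := sub_eq_zero.1 (hN _ k1)
  rw [e0]
  exact ⟨h₀, (sub_eq_zero.1 (hN _ k3)).symm⟩

/-- Morphisms of mixed Hodge structures are morphisms of frames. -/
theorem isHom_of_mem_homs {X Y : ComplexMHS} {B : Frame X.V} {C : Frame Y.V}
    (hB : B.IsFrameOf X.W X.F' X.F'') (hC : C.IsFrameOf Y.W Y.F' Y.F'') {f : X.V →ₗ[ℂ] Y.V}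
    (h : f ∈ ComplexMHS.homs X Y) : IsHom B C f := by
  -- Conjugating `f` by exponentials: at `s = 1/2` preservation of `F'` becomes preservation of the
  -- first degree filtration, at `s = -1/2` that of `F''` becomes preservation of the second, and
  -- the two conjugates are intertwined by `exp(δ)`.
  let g : ℂ → X.V →ₗ[ℂ] Y.V := fun s =>
    (C.expδ (-s)).toLinearMap ∘ₗ f ∘ₗ (B.expδ s).toLinearMap
  have g_apply : ∀ s x, g s x = C.expδ (-s) (f (B.expδ s x)) := fun _ _ => rfl
  have hgW : ∀ s, g s ∈ supp B.b C.b fun j k => C.wt j ≤ B.wt k := fun s =>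
    mem_supp_inc.2 fun n x hx => C.expδ_weightFil _ n _ (by
      have := h.1 n (B.expδ s x) (by rw [hB.W]; exact B.expδ_weightFil s n x hx)
      rwa [hC.W] at this)
  have hf : g (1 / 2) ∈ stab B C 0 := supp_inf (hgW _) (mem_supp_dec.2 fun n x hx => by
    have := h.2.1 n (B.expδ (1 / 2) x) (by rw [hB.F']; exact mem_F'.2 hx)
    rw [hC.F', ← LinearEquiv.apply_symm_apply (C.expδ (1 / 2)) (f _), mem_F', expδ_symm] at this
    exact this)
  have hg : g (-(1 / 2)) ∈ stab B C 1 := supp_inf (hgW _) (mem_supp_dec.2 fun n x hx => by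
    have := h.2.2 n (B.expδ (-(1 / 2)) x) (by rw [hB.F'']; exact mem_F''.2 hx)
    rw [hC.F'', ← LinearEquiv.apply_symm_apply (C.expδ (-(1 / 2))) (f _), mem_F'', expδ_symm] at this
    exact this)
  have hh := isHom_of_intertwine hf hg (LinearMap.ext fun x => by
    simp only [LinearMap.comp_apply, LinearEquiv.coe_coe, g_apply]
    rw [← C.expδ_add, ← B.expδ_add]
    norm_num)
  -- The conjugate `g (1 / 2)` commutes with `δ`, so undoing the conjugation changes nothing.
  have e : f = g (1 / 2) := by
    refine LinearMap.ext fun x => ?_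
    have h1 := hh.expδ (1 / 2) ((B.expδ (1 / 2)).symm x)
    rw [LinearEquiv.apply_symm_apply] at h1
    rw [h1, g_apply, ← C.expδ_symm, LinearEquiv.apply_symm_apply, LinearEquiv.apply_symm_apply]
  rw [e]
  exact hh

end Frame

/-! ### Existence of frames -/

section Existence

variable {V : Type} [AddCommGroup V] [Module ℂ V] {ι : Type} {b : Module.Basis ι ℂ V}

theorem lowers_mul {w : ι → ℤ} {l m n : ℤ} {g f : Module.End ℂ V} (hg : g ∈ lowers b b w w m)
    (hf : f ∈ lowers b b w w n) (h : l ≤ m + n) : g * f ∈ lowers b b w w l :=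
  lowers_comp hg hf h

/-- A unipotent automorphism which lowers weights is, up to automorphisms of the same kind
preserving one of the two degree filtrations, the exponential of an operator lowering both
degrees. -/
theorem exists_factorization [Finite ι] (d : ι → Fin 2 → ℤ) {g : Module.End ℂ V}
    (hg : g - 1 ∈ lowers b b (fun k => d k 0 + d k 1) (fun k => d k 0 + d k 1) 1) :
    ∃ x y z : Module.End ℂ V,
      x ∈ supp b b (fun j k => d k 0 ≤ d j 0 ∧ d j 0 + d j 1 + 1 ≤ d k 0 + d k 1) ∧
      y ∈ supp b b (fun j k => ∀ i, d j i < d k i) ∧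
      z ∈ supp b b (fun j k => d k 1 ≤ d j 1 ∧ d j 0 + d j 1 + 1 ≤ d k 0 + d k 1) ∧
      (1 + x) * nexp y = g * (1 + z) := by
  set w : ι → ℤ := fun k => d k 0 + d k 1 with hw
  have toLow : ∀ {R : ι → ι → Prop} {f : Module.End ℂ V} {n : ℤ},
      f ∈ supp b b (fun j k => R j k ∧ w j + n ≤ w k) → f ∈ lowers b b w w n :=
    fun hf => supp_mono (fun _ _ h => h.2) hf
  have yLow : ∀ {f : Module.End ℂ V}, f ∈ supp b b (fun j k => ∀ i, d j i < d k i) →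
      f ∈ lowers b b w w 1 := fun hf => supp_mono (fun j k h => by
    have h0 := h 0
    have h1 := h 1
    simp only [hw]
    omega) hf
  -- Successive approximation, the error lowering weights by at least `n + 1` at stage `n`.
  have key : ∀ n : ℕ, ∃ x y z : Module.End ℂ V,
      x ∈ supp b b (fun j k => d k 0 ≤ d j 0 ∧ w j + 1 ≤ w k) ∧
      y ∈ supp b b (fun j k => ∀ i, d j i < d k i) ∧
      z ∈ supp b b (fun j k => d k 1 ≤ d j 1 ∧ w j + 1 ≤ w k) ∧
      g * (1 + z) - (1 + x) * nexp y ∈ lowers b b w w (n + 1) := by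
    intro n
    induction n with
    | zero =>
      refine ⟨0, 0, 0, zero_mem _, zero_mem _, zero_mem _, ?_⟩
      simpa [nexp_zero] using hg
    | succ n ih =>
      obtain ⟨x, y, z, hx, hy, hz, hE⟩ := ih
      set E := g * (1 + z) - (1 + x) * nexp y with hEdef
      -- The error is cut into three pieces: the entries not lowering the first degree correct `x`,
      -- those lowering both degrees correct `y`, and the rest correct `z`. The rest lowers the
      -- first degree but not both, hence does not lower the second.
      set x₁ := part b b (fun j k => d k 0 ≤ d j 0) E with hx₁
      have mx₁ := part_mem (R := fun j k => d k 0 ≤ d j 0) hE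
      rw [← hx₁] at mx₁
      have mr := sub_part_mem (R := fun j k => d k 0 ≤ d j 0) hE
      rw [← hx₁] at mr
      set y₁ := part b b (fun j k => ∀ i, d j i < d k i) (E - x₁) with hy₁
      have my₁ := part_mem (R := fun j k => ∀ i, d j i < d k i) mr
      rw [← hy₁] at my₁
      have mz₁ := sub_part_mem (R := fun j k => ∀ i, d j i < d k i) mr
      rw [← hy₁] at mz₁
      have my₁' : y₁ ∈ supp b b (fun j k => ∀ i, d j i < d k i) := supp_mono (fun _ _ h => h.1) my₁
      have lx₁ : x₁ ∈ lowers b b w w (n + 1) := toLow mx₁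
      have ly₁ : y₁ ∈ lowers b b w w (n + 1) := supp_mono (fun _ _ h => h.2.2) my₁
      have lz₁ : E - x₁ - y₁ ∈ lowers b b w w (n + 1) := supp_mono (fun _ _ h => h.2.2) mz₁
      have lx : x ∈ lowers b b w w 1 := toLow hx
      have hyy : y + y₁ ∈ supp b b (fun j k => ∀ i, d j i < d k i) := Submodule.add_mem _ hy my₁'
      have d1 := nexp_comp_sub_mem (f := (1 : Module.End ℂ V)) (n := n + 1) (yLow hy) (yLow hyy)
        (by
          have e : (y + y₁) ∘ₗ (1 : Module.End ℂ V) - (1 : Module.End ℂ V) ∘ₗ y = y₁ := by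
            refine LinearMap.ext fun v => ?_
            simp
          rw [e]; exact ly₁)
      have e1 : nexp (y + y₁) ∘ₗ (1 : Module.End ℂ V) - (1 : Module.End ℂ V) ∘ₗ nexp y -
          ((y + y₁) ∘ₗ (1 : Module.End ℂ V) - (1 : Module.End ℂ V) ∘ₗ y) =
            nexp (y + y₁) - nexp y - y₁ := by
        refine LinearMap.ext fun v => ?_
        simp
      rw [e1] at d1
      have d2 : nexp (y + y₁) - nexp y ∈ lowers b b w w (n + 1) := by
        have := Submodule.add_mem _ (lowers_anti (by omega) d1) ly₁
        simpa using this
      refine ⟨x + x₁, y + y₁, z - (E - x₁ - y₁), Submodule.add_mem _ hx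
        (supp_mono (fun j k h => ⟨h.1, by have := h.2; omega⟩) mx₁), hyy, Submodule.sub_mem _ hz
        (supp_mono (fun j k h => ?_) mz₁), ?_⟩
      · have := h.1
        have := h.2.1
        have := h.2.2
        simp only [Fin.forall_fin_two, hw] at *
        omega
      -- The three corrections cancel `E` to leading order. Each remaining product carries one more
      -- factor lowering weights: `g - 1`, `x`, or the exponential minus `1`; `d1` handles the
      -- nonlinearity of the exponential.
      · have e2 : g * (1 + (z - (E - x₁ - y₁))) - (1 + (x + x₁)) * nexp (y + y₁) =
            -((g - 1) * (E - x₁ - y₁)) - (nexp (y + y₁) - nexp y - y₁) -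
              x * (nexp (y + y₁) - nexp y) - x₁ * (nexp (y + y₁) - 1) := by
          have : g * (1 + z) = E + (1 + x) * nexp y := by rw [hEdef]; abel
          have e3 : g * (1 + (z - (E - x₁ - y₁))) = g * (1 + z) - g * (E - x₁ - y₁) := by
            noncomm_ring
          rw [e3, this]
          noncomm_ring
        rw [e2]
        push_cast
        refine Submodule.sub_mem _ (Submodule.sub_mem _ (Submodule.sub_mem _
          (Submodule.neg_mem _ (lowers_mul hg lz₁ (by omega))) d1) (lowers_mul lx d2 (by omega)))
          (lowers_mul lx₁ (nexp_sub_one_mem (yLow hyy)) (by omega))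
  obtain ⟨N, hN⟩ := exists_lowers_eq_zero b b w w
  obtain ⟨x, y, z, hx, hy, hz, hE⟩ := key N
  exact ⟨x, y, z, hx, hy, hz, (sub_eq_zero.1 (hN _ (lowers_anti (by omega) hE))).symm⟩

theorem map_eq_of_map_le [FiniteDimensional ℂ V] (e : V ≃ₗ[ℂ] V) {S : Submodule ℂ V}
    (h : ∀ x ∈ S, e x ∈ S) : S.map e.toLinearMap = S :=
  Submodule.eq_of_le_of_finrank_eq (by rintro _ ⟨x, hx, rfl⟩; exact h x hx)
    (LinearEquiv.finrank_map_eq e S)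

theorem exists_equiv_one_add [Finite ι] {w : ι → ℤ} {x : Module.End ℂ V}
    (hx : x ∈ lowers b b w w 1) : ∃ e : V ≃ₗ[ℂ] V, e.toLinearMap = 1 + x := by
  have hu : IsUnit (1 + x) := (lowers_nilpotent hx).isUnit_one_add
  obtain ⟨u, hu⟩ := hu
  refine ⟨LinearEquiv.ofLinearMap (u : Module.End ℂ V) ((u⁻¹ : (Module.End ℂ V)ˣ) : Module.End ℂ V)
    u.mul_inv u.inv_mul, hu⟩

/-- Every complex mixed Hodge structure is defined by a frame. -/
theorem exists_frame (X : ComplexMHS) : ∃ B : Frame X.V, B.IsFrameOf X.W X.F' X.F'' := by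
  obtain ⟨ι, v, v', p, q, hWv, hWv', hF', hF'', hvv'⟩ := X.adapted
  have : Fintype ι := FiniteDimensional.fintypeBasisIndex v
  let d : ι → Fin 2 → ℤ := fun k => ![p k, q k]
  have d0 : ∀ k, d k 0 = p k := fun _ => rfl
  have d1 : ∀ k, d k 1 = q k := fun _ => rfl
  let w : ι → ℤ := fun k => d k 0 + d k 1
  -- The change from the basis adapted to `F'` to the one adapted to `F''`; it is unipotent because
  -- the bases agree modulo lower weight.
  let g : X.V ≃ₗ[ℂ] X.V := v.equiv v' (Equiv.refl ι)
  have gv : ∀ k, g (v k) = v' k := fun k => by simp [g]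
  have hg : g.toLinearMap - 1 ∈ lowers v v w w 1 := by
    intro j k hjk
    have := (Submodule.neg_mem_iff _).2 (hvv' k)
    rw [neg_sub, hWv, Module.Basis.mem_span_image] at this
    have := this ((Finsupp.mem_support_iff (a := j)).2 (by
      simpa [gv] using hjk))
    simp only [Set.mem_ofPred_eq, w, d0, d1] at this ⊢
    omega
  obtain ⟨x, y, z, hx, hy, hz, hxyz⟩ := exists_factorization d hg
  obtain ⟨s, hs⟩ := exists_equiv_one_add (b := v) (w := w) (x := x)
    (supp_mono (fun _ _ h => h.2) hx)
  obtain ⟨t, ht⟩ := exists_equiv_one_add (b := v) (w := w) (x := z)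
    (supp_mono (fun _ _ h => h.2) hz)
  have hs' : ∀ a, s a = (1 + x) a := fun a => LinearMap.congr_fun hs a
  have ht' : ∀ a, t a = (1 + z) a := fun a => LinearMap.congr_fun ht a
  -- The sign and the halves are chosen so that, with `δ₀ = -y` and `c = s exp(-δ₀/2)`, one has `c
  -- exp(δ₀/2) = s`, which preserves the first filtration, and `c exp(-δ₀/2) = s exp(y) = g t`,
  -- where `t` preserves the second degree filtration of `v`. The frame sought is `B₀` transported
  -- by `c`.
  let B₀ : Frame X.V := ⟨ι, v, d, -y, Submodule.neg_mem _ hy⟩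
  let c : X.V ≃ₗ[ℂ] X.V := (B₀.expδ (-(1 / 2))).trans s
  let B : Frame X.V := ⟨ι, v.map c, d, c.conj (-y), fun j k h => hy j k (by
    simpa [LinearEquiv.conj_apply] using h)⟩
  have hexp : ∀ r a, B.expδ r (c a) = c (B₀.expδ r a) := fun r a =>
    (nexp_intertwine (B₀.smul_δ_nilpotent r) (B.smul_δ_nilpotent r) c.toLinearMap.toAddMonoidHom
      (fun a => by simp [B, B₀, LinearEquiv.conj_apply]) a).symm
  have hspan : ∀ S : Set ι, Submodule.span ℂ (B.b '' S) =
      (Submodule.span ℂ (v '' S)).map c.toLinearMap := fun S => by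
    rw [Submodule.map_span, Set.image_image]
    rfl
  refine ⟨B, fun n => ?_, fun n => ?_, fun n => ?_⟩
  · have h1 := hspan {k | d k 0 + d k 1 ≤ n}
    rw [map_eq_of_map_le] at h1
    · exact (hWv n).trans h1.symm
    · intro a ha
      change s (B₀.expδ _ a) ∈ _
      rw [hs', LinearMap.add_apply, Module.End.one_apply]
      have h2 := B₀.expδ_weightFil (-(1 / 2)) n a ha
      exact Submodule.add_mem _ h2 (mem_supp_inc.1
        (supp_mono (b := v) (c := v) (S := fun j k => w j ≤ w k)
          (fun j k h => by have := h.2; simp only [w]; omega) hx) n _ h2)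
  · have h1 : B.F' n = ((Submodule.span ℂ (v '' {k | n ≤ d k 0})).map c.toLinearMap).map
        (B.expδ (1 / 2)).toLinearMap := by rw [← hspan]; rfl
    have h2 : (Submodule.span ℂ (v '' {k | n ≤ d k 0})).map s.toLinearMap = X.F' n := by
      rw [map_eq_of_map_le]
      · exact (hF' n).symm
      · intro a ha
        rw [hs', LinearMap.add_apply, Module.End.one_apply]
        exact Submodule.add_mem _ ha (mem_supp_dec.1
          (supp_mono (b := v) (c := v) (fun j k h => h.1) hx) n _ ha)
    rw [h1, ← h2, ← Submodule.map_comp]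
    congr 1
    refine LinearMap.ext fun a => ?_
    simp only [LinearMap.comp_apply, LinearEquiv.coe_coe, hexp]
    change s a = s (B₀.expδ (-(1 / 2)) (B₀.expδ (1 / 2) a))
    rw [← B₀.expδ_symm, LinearEquiv.symm_apply_apply]
  · have h1 : B.F'' n = ((Submodule.span ℂ (v '' {k | n ≤ d k 1})).map c.toLinearMap).map
        (B.expδ (-(1 / 2))).toLinearMap := by rw [← hspan]; rfl
    have h2 : (Submodule.span ℂ (v '' {k | n ≤ d k 1})).map t.toLinearMap =
        Submodule.span ℂ (v '' {k | n ≤ d k 1}) := by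
      rw [map_eq_of_map_le]
      intro a ha
      rw [ht', LinearMap.add_apply, Module.End.one_apply]
      exact Submodule.add_mem _ ha (mem_supp_dec.1
        (supp_mono (b := v) (c := v) (fun j k h => h.1) hz) n _ ha)
    -- `g` carries the second degree filtration of `v` to `F''`, by the choice of the second adapted
    -- basis.
    have h3 : X.F'' n = (Submodule.span ℂ (v '' {k | n ≤ d k 1})).map g.toLinearMap := by
      rw [Submodule.map_span, Set.image_image, hF'']
      congr 1
      exact Set.image_congr fun k _ => (gv k).symm
    rw [h3, ← h2, h1, ← Submodule.map_comp, ← Submodule.map_comp]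
    congr 1
    refine LinearMap.ext fun a => ?_
    simp only [LinearMap.comp_apply, LinearEquiv.coe_coe, hexp]
    change g (t a) = s (B₀.expδ (-(1 / 2)) (B₀.expδ (-(1 / 2)) a))
    rw [← B₀.expδ_add, ht', hs', Frame.expδ_apply]
    have h4 := LinearMap.congr_fun hxyz a
    have h5 : (-(1 / 2) + -(1 / 2) : ℂ) • B₀.δ = y := by
      change (-(1 / 2) + -(1 / 2) : ℂ) • (-y) = y
      rw [← neg_add]; norm_num
    rw [h5]
    exact h4.symm

end Existence

namespace Frame

variable {V V' : Type} [AddCommGroup V'] [Module ℂ V'] [AddCommGroup V] [Module ℂ V]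

/-! ### Unit, tensor product and complex conjugate of frames -/

/-- The frame of the unit object. -/
def unit : Frame ℂ where
  ι := Unit
  b := Module.Basis.singleton Unit ℂ
  d _ := 0
  δ := 0
  δ_mem := zero_mem _

theorem isFrameOf_unit : unit.IsFrameOf ComplexMHS.unit.W ComplexMHS.unit.F'
    ComplexMHS.unit.F'' := by
  have hexp : ∀ s, (unit.expδ s).toLinearMap = LinearMap.id := fun s => by
    refine LinearMap.ext fun x => ?_
    change nexp (s • (0 : Module.End ℂ ℂ)) x = x
    rw [smul_zero, nexp_zero, Module.End.one_apply]
  have hspan : ∀ S : Prop, ∀ _ : Decidable S, (if S then (⊤ : Submodule ℂ ℂ) else ⊥) =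
      Submodule.span ℂ (unit.b '' {_k | S}) := by
    intro S _
    split_ifs with h
    · rw [Set.eq_univ_of_forall (s := {_k | S}) fun k => h, Set.image_univ, unit.b.span_eq]
    · rw [Set.eq_empty_of_forall_notMem (s := {_k | S}) fun k hk => h hk, Set.image_empty,
        Submodule.span_empty]
  refine ⟨fun n => ?_, fun n => ?_, fun n => ?_⟩
  · exact (hspan _ _).trans (by simp [weightFil, wt, unit])
  · rw [F', hexp, Submodule.map_id]
    exact (hspan _ _).trans (by simp [degFil, unit])
  · rw [F'', hexp, Submodule.map_id]
    exact (hspan _ _).trans (by simp [degFil, unit])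

/-- The tensor product of frames, on which `δ` acts as a derivation. -/
def tensor (B : Frame V) (C : Frame V') : Frame (V ⊗[ℂ] V') where
  ι := B.ι × C.ι
  b := B.b.tensorProduct C.b
  d k := B.d k.1 + C.d k.2
  δ := TensorProduct.map B.δ LinearMap.id + TensorProduct.map LinearMap.id C.δ
  δ_mem := by
    classical
    refine Submodule.add_mem _ (fun j k h => ?_) (fun j k h => ?_)
    · rw [Module.Basis.tensorProduct_apply', TensorProduct.map_tmul,
        Module.Basis.tensorProduct_repr_tmul_apply, smul_eq_mul] at h
      have h1 := B.δ_mem _ _ (right_ne_zero_of_mul h)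
      have h2 := left_ne_zero_of_mul h
      rw [LinearMap.id_apply, C.b.repr_self, Finsupp.single_apply] at h2
      have h3 : k.2 = j.2 := by by_contra h3; exact h2 (if_neg h3)
      intro i
      have := h1 i
      simp only [Pi.add_apply, h3]
      omega
    · rw [Module.Basis.tensorProduct_apply', TensorProduct.map_tmul,
        Module.Basis.tensorProduct_repr_tmul_apply, smul_eq_mul] at h
      have h1 := C.δ_mem _ _ (left_ne_zero_of_mul h)
      have h2 := right_ne_zero_of_mul h
      rw [LinearMap.id_apply, B.b.repr_self, Finsupp.single_apply] at h2
      have h3 : k.1 = j.1 := by by_contra h3; exact h2 (if_neg h3)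
      intro i
      have := h1 i
      simp only [Pi.add_apply, h3]
      omega

theorem tensor_b (B : Frame V) (C : Frame V') (k : B.ι × C.ι) :
    (tensor B C).b k = B.b k.1 ⊗ₜ C.b k.2 := Module.Basis.tensorProduct_apply' _ _ _

theorem tensor_δ (B : Frame V) (C : Frame V') (x : V) (y : V') :
    (tensor B C).δ (x ⊗ₜ y) = B.δ x ⊗ₜ y + x ⊗ₜ C.δ y := rfl

/-- `δ ⊗ 1` and `1 ⊗ δ` commute and are nilpotent, so the exponential of their sum is the product of
their exponentials, each of which is computed by intertwining with `x ⊗ -` or `- ⊗ y`. -/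
theorem tensor_expδ (B : Frame V) (C : Frame V') (s : ℂ) (x : V) (y : V') :
    (tensor B C).expδ s (x ⊗ₜ y) = B.expδ s x ⊗ₜ C.expδ s y := by
  let l : Module.End ℂ (V ⊗[ℂ] V') := TensorProduct.map (s • B.δ) LinearMap.id
  let r : Module.End ℂ (V ⊗[ℂ] V') := TensorProduct.map LinearMap.id (s • C.δ)
  have hl : IsNilpotent l := by
    obtain ⟨n, hn⟩ := B.smul_δ_nilpotent s
    refine ⟨n, ?_⟩
    have := TensorProduct.map_pow (s • B.δ) (LinearMap.id : V' →ₗ[ℂ] V') n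
    rw [hn, TensorProduct.map_zero_left] at this
    exact this
  have hr : IsNilpotent r := by
    obtain ⟨n, hn⟩ := C.smul_δ_nilpotent s
    refine ⟨n, ?_⟩
    have := TensorProduct.map_pow (LinearMap.id : V →ₗ[ℂ] V) (s • C.δ) n
    rw [hn, TensorProduct.map_zero_right] at this
    exact this
  have e : s • (tensor B C).δ = l + r := by
    refine TensorProduct.ext' fun x y => ?_
    simp [l, r, tensor_δ, TensorProduct.smul_tmul']
  have hlr : Commute l r := TensorProduct.ext' fun x y => by simp [l, r]
  rw [expδ_apply, e, nexp_add hlr hl hr, Module.End.mul_apply]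
  have h1 := nexp_intertwine (C.smul_δ_nilpotent s) hr (TensorProduct.mk ℂ V V' x).toAddMonoidHom
    (fun y => rfl) y
  have h2 := nexp_intertwine (B.smul_δ_nilpotent s) hl
    ((TensorProduct.mk ℂ V V').flip (nexp (s • C.δ) y)).toAddMonoidHom (fun y => rfl) x
  exact (congrArg (fun u => nexp l u) h1.symm).trans h2.symm

theorem tensorFil_map {A : ℤ → Submodule ℂ V} {A' : ℤ → Submodule ℂ V'} (e : V ≃ₗ[ℂ] V)
    (e' : V' ≃ₗ[ℂ] V') (f : V ⊗[ℂ] V' ≃ₗ[ℂ] V ⊗[ℂ] V')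
    (h : ∀ x y, f (x ⊗ₜ y) = e x ⊗ₜ e' y) (n : ℤ) :
    tensorFil (fun n => (A n).map e.toLinearMap) (fun n => (A' n).map e'.toLinearMap) n =
      (tensorFil A A' n).map f.toLinearMap := by
  apply le_antisymm
  · refine tensorFil_le fun i j hij x hx y hy => ?_
    obtain ⟨x, hx, rfl⟩ := hx
    obtain ⟨y, hy, rfl⟩ := hy
    exact ⟨x ⊗ₜ y, tmul_mem_tensorFil hij hx hy, h x y⟩
  · rw [Submodule.map_le_iff_le_comap]
    refine tensorFil_le fun i j hij x hx y hy => ?_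
    rw [Submodule.mem_comap, LinearEquiv.coe_coe, h]
    exact tmul_mem_tensorFil hij ⟨x, hx, rfl⟩ ⟨y, hy, rfl⟩

theorem IsFrameOf.tensor {X Y : ComplexMHS} {B : Frame X.V} {C : Frame Y.V}
    (hB : B.IsFrameOf X.W X.F' X.F'') (hC : C.IsFrameOf Y.W Y.F' Y.F'') :
    (B.tensor C).IsFrameOf (X.tensor Y).W (X.tensor Y).F' (X.tensor Y).F'' := by
  refine ⟨fun n => ?_, fun n => ?_, fun n => ?_⟩
  · refine (tensorFil_span_inc B.b C.b B.wt C.wt _ (tensor_b B C) hB.W hC.W n).trans ?_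
    simp [weightFil, wt, Frame.tensor, add_add_add_comm]
  · have h1 : (X.tensor Y).F' n = tensorFil B.F' C.F' n := by
      rw [← funext hB.F', ← funext hC.F']; rfl
    rw [h1]
    refine (tensorFil_map _ _ ((B.tensor C).expδ (1 / 2)) (tensor_expδ B C _) n).trans ?_
    exact congrArg (Submodule.map _) (tensorFil_span_dec B.b C.b (fun k => B.d k 0)
      (fun k => C.d k 0) _ (tensor_b B C) (fun _ => rfl) (fun _ => rfl) n)
  · have h1 : (X.tensor Y).F'' n = tensorFil B.F'' C.F'' n := by
      rw [← funext hB.F'', ← funext hC.F'']; rfl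
    rw [h1]
    refine (tensorFil_map _ _ ((B.tensor C).expδ (-(1 / 2))) (tensor_expδ B C _) n).trans ?_
    exact congrArg (Submodule.map _) (tensorFil_span_dec B.b C.b (fun k => B.d k 1)
      (fun k => C.d k 1) _ (tensor_b B C) (fun _ => rfl) (fun _ => rfl) n)

theorem conjBasis_repr {ι : Type} (b : Module.Basis ι ℂ V) (x : V) (i : ι) :
    (ComplexMHS.conjBasis b).repr (conjEquiv V x) i = starRingEnd ℂ (b.repr x i) := by
  classical
  induction b.mem_span x using Submodule.span_induction with
  | zero => simp
  | add x y _ _ hx hy => simp only [map_add, Finsupp.add_apply, hx, hy]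
  | smul c x _ hx =>
    rw [LinearEquiv.map_smulₛₗ, map_smul, map_smul, Finsupp.smul_apply, hx, Finsupp.smul_apply,
      smul_eq_mul, smul_eq_mul, map_mul]
  | mem x hx =>
    obtain ⟨k, rfl⟩ := hx
    rw [← ComplexMHS.conjBasis_apply, Module.Basis.repr_self, Module.Basis.repr_self,
      Finsupp.single_apply]
    split_ifs <;> simp

/-- The complex conjugate of a frame. -/
def conj (B : Frame V) : Frame (Conj V) where
  ι := B.ι
  b := ComplexMHS.conjBasis B.b
  d k i := B.d k (Equiv.swap (0 : Fin 2) 1 i)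
  -- Conjugation exchanges `F'` and `F''`, hence `exp(δ/2)` and `exp(-δ/2)`: this forces the sign,
  -- just as it forces the swap of the degrees.
  δ := - conjMap B.δ
  δ_mem := by
    refine Submodule.neg_mem _ fun j k h i => B.δ_mem j k ?_ _
    rw [ComplexMHS.conjBasis_apply] at h
    change (ComplexMHS.conjBasis B.b).repr (conjEquiv V (B.δ (B.b k))) j ≠ 0 at h
    rw [conjBasis_repr] at h
    simpa using h

/-- The parameter changes sign with `δ`; it has to be real because `σ` is antilinear. -/
theorem conj_expδ (B : Frame V) {s : ℂ} (hs : starRingEnd ℂ s = s) (x : V) :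
    B.conj.expδ s (conjEquiv V x) = conjEquiv V (B.expδ (-s) x) :=
  (nexp_intertwine (B.smul_δ_nilpotent (-s)) (B.conj.smul_δ_nilpotent s)
    (conjEquiv V).toLinearMap.toAddMonoidHom (fun x => by
      change conjEquiv V ((-s) • B.δ x) = s • - conjEquiv V (B.δ x)
      rw [LinearEquiv.map_smulₛₗ, map_neg, hs, neg_smul, smul_neg]) x).symm

theorem conjSub_map {A : Submodule ℂ V} {e : V ≃ₗ[ℂ] V} {f : Conj V ≃ₗ[ℂ] Conj V}
    (h : ∀ x, f (conjEquiv V x) = conjEquiv V (e x)) :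
    conjSub (A.map e.toLinearMap) = (conjSub A).map f.toLinearMap := by
  apply le_antisymm
  · rintro _ ⟨_, ⟨x, hx, rfl⟩, rfl⟩
    exact ⟨conjEquiv V x, ComplexMHS.mem_conjSub.2 hx, h x⟩
  · rintro _ ⟨_, ⟨x, hx, rfl⟩, rfl⟩
    exact ⟨e x, ⟨x, hx, rfl⟩, (h x).symm⟩

theorem conjSub_span_basis {ι : Type} (b : Module.Basis ι ℂ V) (s : Set ι) :
    conjSub (Submodule.span ℂ (b '' s)) = Submodule.span ℂ (ComplexMHS.conjBasis b '' s) := by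
  rw [ComplexMHS.conjSub_span, Set.image_image]
  simp only [ComplexMHS.conjBasis_apply]

theorem star_half : starRingEnd ℂ (1 / 2) = 1 / 2 := by rw [map_div₀, map_one, map_ofNat]

theorem IsFrameOf.conj {X : ComplexMHS} {B : Frame X.V} (hB : B.IsFrameOf X.W X.F' X.F'') :
    B.conj.IsFrameOf X.conj.W X.conj.F' X.conj.F'' := by
  refine ⟨fun n => ?_, fun n => ?_, fun n => ?_⟩
  · refine (congrArg conjSub (hB.W n)).trans ((conjSub_span_basis _ _).trans ?_)
    simp [weightFil, wt, Frame.conj, add_comm]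
    rfl
  · refine (congrArg conjSub (hB.F'' n)).trans ?_
    rw [Frame.F'', conjSub_map (f := B.conj.expδ (1 / 2)) (fun x => B.conj_expδ star_half x), degFil,
      conjSub_span_basis]
    rfl
  · refine (congrArg conjSub (hB.F' n)).trans ?_
    rw [Frame.F', conjSub_map (f := B.conj.expδ (-(1 / 2))) (fun x => by
      rw [B.conj_expδ (by rw [map_neg, star_half]), neg_neg]), degFil,
      conjSub_span_basis]
    rfl

end Frame

/-! ### Vector fields on the affine plane -/

/-- The contraction of vector fields with the form `t₁ dt₂ - t₂ dt₁`. -/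
def rot : VectField →ₗ[Poly] Poly where
  toFun D := D (MvPolynomial.X 1) * MvPolynomial.X 0 - D (MvPolynomial.X 0) * MvPolynomial.X 1
  map_add' D D' := by simp only [Derivation.add_apply]; ring
  map_smul' f D := by simp only [Derivation.smul_apply, smul_eq_mul, RingHom.id_apply]; ring

theorem rot_apply (D : VectField) :
    rot D = D (MvPolynomial.X 1) * MvPolynomial.X 0 - D (MvPolynomial.X 0) * MvPolynomial.X 1 := rfl

theorem rot_pderiv_one : rot (MvPolynomial.pderiv 1) = MvPolynomial.X 0 := by
  simp [rot_apply, MvPolynomial.pderiv_X]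

theorem vectField_eq (D : VectField) : D = D (MvPolynomial.X 0) • MvPolynomial.pderiv 0 +
    D (MvPolynomial.X 1) • MvPolynomial.pderiv 1 := by
  refine MvPolynomial.derivation_ext fun i => ?_
  fin_cases i <;> simp [MvPolynomial.pderiv_X]

theorem torusChar_zero (l : Torus) : torusChar 0 l = 1 := by simp [torusChar]

theorem torusChar_neg_mul (a : Fin 2 → ℤ) (l : Torus) : torusChar (-a) l * torusChar a l = 1 := by
  rw [← EquivBunConn.torusChar_add, neg_add_cancel, torusChar_zero]

theorem torusChar_mul (a : Fin 2 → ℤ) (l m : Torus) :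
    torusChar a (l * m) = torusChar a l * torusChar a m := by
  simp [torusChar, Finset.prod_mul_distrib, mul_zpow]

theorem torusChar_one (a : Fin 2 → ℤ) : torusChar a 1 = 1 := by simp [torusChar]

theorem torusChar_injective {a b : Fin 2 → ℤ} (h : ∀ l, torusChar a l = torusChar b l) : a = b := by
  funext i
  have := h (Function.update 1 i (Units.mk0 2 two_ne_zero))
  have key : ∀ c : Fin 2 → ℤ,
      torusChar c (Function.update 1 i (Units.mk0 2 two_ne_zero)) = (2 : ℂ) ^ c i := by
    intro c
    rw [torusChar, Finset.prod_eq_single i]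
    · simp
    · intro j _ hj
      simp [Function.update_of_ne hj]
    · simp
  rw [key, key] at this
  have h2 : ((2 : ℝ) : ℂ) ^ a i = ((2 : ℝ) : ℂ) ^ b i := by push_cast; exact this
  rw [← Complex.ofReal_zpow, ← Complex.ofReal_zpow, Complex.ofReal_inj] at h2
  exact zpow_right_injective₀ (by norm_num) (by norm_num) h2

theorem torusVect_X (l : Torus) (D : VectField) (i : Fin 2) :
    torusVect l D (MvPolynomial.X i) =
      ((l i : ℂ)⁻¹) • torusPoly l (D (MvPolynomial.X i)) := by
  have : (torusPoly l).symm (MvPolynomial.X i) = ((l i : ℂ)⁻¹) • MvPolynomial.X i := by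
    rw [AlgEquiv.symm_apply_eq, map_smul, torusPoly_apply, scaleHom_X,
      ← MvPolynomial.smul_eq_C_mul, smul_smul, inv_mul_cancel₀ (Units.ne_zero _), one_smul]
  rw [torusVect_apply, this, D.map_smul, map_smul]

/-- The form `t₁ dt₂ - t₂ dt₁` has bidegree `(1, 1)`; this is what the `-1` in the exponents of
`mono` compensates. -/
theorem rot_torusVect (l : Torus) (D : VectField) :
    rot (torusVect l D) = torusChar (-1) l • torusPoly l (rot D) := by
  have h : torusChar (-1) l = (l 0 : ℂ)⁻¹ * (l 1 : ℂ)⁻¹ := by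
    simp [torusChar, Fin.prod_univ_two, mul_comm]
  have h0 : (l 0 : ℂ)⁻¹ * (l 0 : ℂ) = 1 := inv_mul_cancel₀ (Units.ne_zero _)
  have h1 : (l 1 : ℂ)⁻¹ * (l 1 : ℂ) = 1 := inv_mul_cancel₀ (Units.ne_zero _)
  rw [rot_apply, torusVect_X, torusVect_X, rot_apply, map_sub, map_mul, map_mul,
    torusPoly_apply l (MvPolynomial.X 0), torusPoly_apply l (MvPolynomial.X 1), scaleHom_X,
    scaleHom_X, h]
  simp only [MvPolynomial.smul_eq_C_mul, map_mul]
  have h0' := congrArg (MvPolynomial.C (σ := Fin 2)) h0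
  have h1' := congrArg (MvPolynomial.C (σ := Fin 2)) h1
  simp only [map_mul, map_one] at h0' h1'
  linear_combination (MvPolynomial.C (l 0 : ℂ)⁻¹ * torusPoly l (D (MvPolynomial.X 0)) *
    MvPolynomial.X 1) * h1' - (MvPolynomial.C (l 1 : ℂ)⁻¹ * torusPoly l (D (MvPolynomial.X 1)) *
    MvPolynomial.X 0) * h0'

theorem polyConj_X (i : Fin 2) :
    polyConj (MvPolynomial.X i) = MvPolynomial.X (Equiv.swap (0 : Fin 2) 1 i) := polyConjHom_X i

/-- Exchanging the coordinates reverses `t₁ dt₂ - t₂ dt₁`. This sign meets the one in `Frame.conj`.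
-/
theorem rot_vectConj (D : VectField) : rot (vectConj D) = - polyConj (rot D) := by
  simp only [rot_apply, vectConj_apply, polyConj_X, map_sub, map_mul, Equiv.swap_apply_left,
    Equiv.swap_apply_right]
  ring

/-- The Euler vector field `t₁ ∂₁ + t₂ ∂₂`. -/
def euler : VectField := (MvPolynomial.X 0 : Poly) • MvPolynomial.pderiv 0 +
  (MvPolynomial.X 1 : Poly) • MvPolynomial.pderiv 1

theorem euler_X (i : Fin 2) : euler (MvPolynomial.X i) = MvPolynomial.X i := by
  fin_cases i <;> simp [euler, MvPolynomial.pderiv_X]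

/-- The reason for this choice of form: the connection attached to a frame is trivial along the
Euler field. -/
theorem rot_euler : rot euler = 0 := by rw [rot_apply, euler_X, euler_X]; ring

theorem torusVect_euler (l : Torus) : torusVect l euler = euler := by
  refine MvPolynomial.derivation_ext fun i => ?_
  rw [torusVect_X, euler_X, torusPoly_apply, scaleHom_X, ← MvPolynomial.smul_eq_C_mul, smul_smul,
    inv_mul_cancel₀ (Units.ne_zero _), one_smul]

theorem coeff_euler (s : Fin 2 →₀ ℕ) (f : Poly) :
    (euler f).coeff s = ((s 0 + s 1 : ℕ) : ℂ) * f.coeff s := by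
  induction f using MvPolynomial.induction_on' with
  | monomial u a =>
    have : euler (MvPolynomial.monomial u a) =
        ((u 0 + u 1 : ℕ) : ℂ) • MvPolynomial.monomial u a := by
      simp only [euler, Derivation.add_apply, Derivation.smul_apply, smul_eq_mul]
      have h : ∀ i : Fin 2, (MvPolynomial.X i : Poly) * MvPolynomial.pderiv i
          (MvPolynomial.monomial u a) = (u i : ℂ) • MvPolynomial.monomial u a := by
        intro i
        rw [MvPolynomial.X_mul_pderiv_monomial, Nat.cast_smul_eq_nsmul]
      rw [h, h, ← add_smul, Nat.cast_add]
    rw [this, MvPolynomial.coeff_smul, smul_eq_mul, MvPolynomial.coeff_monomial]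
    split_ifs with h
    · rw [h]
    · simp
  | add p q hp hq => rw [map_add, MvPolynomial.coeff_add, hp, hq, MvPolynomial.coeff_add, mul_add]

/-- The Euler field multiplies a monomial by its total degree, which vanishes only for constants. -/
theorem eq_C_of_euler_eq_zero {f : Poly} (h : euler f = 0) :
    f = MvPolynomial.C (MvPolynomial.constantCoeff f) := by
  ext s
  rw [MvPolynomial.coeff_C]
  split_ifs with hs
  · rw [← hs]; rfl
  · have h1 := coeff_euler s f
    rw [h, MvPolynomial.coeff_zero, zero_eq_mul, Nat.cast_eq_zero] at h1
    refine h1.resolve_left fun h2 => hs ?_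
    ext i
    fin_cases i
    · simp; omega
    · simp; omega

/-! ### Monomials -/

/-- The monomial `t₁^{a₁ - 1} t₂^{a₂ - 1}`. -/
def mono (a : Fin 2 → ℤ) : Poly :=
  -- The truncation by `toNat` is harmless when all `a i` are positive, which is the case at every
  -- nonzero entry of an operator strictly lowering both degrees.
  MvPolynomial.monomial (Finsupp.equivFunOnFinite.symm fun i => (a i - 1).toNat) 1

theorem mono_ne_zero (a : Fin 2 → ℤ) : mono a ≠ 0 := by
  simp [mono, MvPolynomial.monomial_eq_zero]

theorem torusPoly_mono {a : Fin 2 → ℤ} (ha : ∀ i, 0 < a i) (l : Torus) :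
    torusPoly l (mono a) = torusChar (a - 1) l • mono a := by
  rw [mono, EquivBunConn.torusPoly_monomial]
  congr 2
  funext i
  have := ha i
  simp
  omega

theorem polyConj_mono (a : Fin 2 → ℤ) :
    polyConj (mono fun i => a (Equiv.swap (0 : Fin 2) 1 i)) = mono a := by
  change polyConjHom _ = _
  rw [mono, mono, polyConjHom]
  simp only [AlgHom.toRingHom_eq_coe, RingHom.comp_apply, MvPolynomial.map_monomial, map_one,
    RingHom.coe_coe, MvPolynomial.rename_monomial]
  congr 2
  refine Finsupp.ext fun i => ?_
  rw [Finsupp.mapDomain_equiv_apply]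
  simp

/-! ### Morphisms of bundles checked on generators -/

namespace EquivBunConn

/-- It suffices to check on generators that a homomorphism of modules is a morphism. -/
theorem mem_homs_of_span {E E' : EquivBunConn} {S : Set E.M} (hS : Submodule.span Poly S = ⊤)
    (φ : E.M →ₗ[Poly] E'.M) (h1 : ∀ l, ∀ m ∈ S, φ (E.act l m) = E'.act l (φ m))
    (h2 : ∀ D, ∀ m ∈ S, φ (E.nabla D m) = E'.nabla D (φ m)) : φ ∈ homs E E' := by
  refine ⟨fun l m => ?_, fun D m => ?_⟩
  · have hm : m ∈ Submodule.span Poly S := hS ▸ Submodule.mem_top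
    induction hm using Submodule.span_induction with
    | mem m hm => exact h1 l m hm
    | zero => simp
    | add x y _ _ hx hy => simp only [map_add, hx, hy]
    | smul f x _ hx => rw [E.act_smul, map_smul, hx, map_smul, E'.act_smul]
  · have hm : m ∈ Submodule.span Poly S := hS ▸ Submodule.mem_top
    induction hm using Submodule.span_induction with
    | mem m hm => exact h2 D m hm
    | zero => simp
    | add x y _ _ hx hy => simp only [map_add, hx, hy]
    | smul f x _ hx => rw [E.leibniz, map_add, map_smul, map_smul, hx, map_smul, E'.leibniz]

end EquivBunConn

/-- Used when `φ` and `ψ` agree only on basis vectors of certain degrees, while `v` is known to be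
supported on these degrees. -/
theorem basis_map_congr {V U : Type} [AddCommGroup V] [Module ℂ V] [AddCommGroup U] [Module ℂ U]
    {ι : Type} (b : Module.Basis ι ℂ V) {φ ψ : V →ₗ[ℂ] U} {v : V}
    (h : ∀ j, b.repr v j ≠ 0 → φ (b j) = ψ (b j)) : φ v = ψ v := by
  rw [← b.linearCombination_repr v, Finsupp.linearCombination_apply, Finsupp.sum, map_sum, map_sum]
  refine Finset.sum_congr rfl fun j hj => ?_
  rw [map_smul, map_smul, h j (Finsupp.mem_support_iff.1 hj)]

/-! ### Coordinates in `ℂ[t₁, t₂] ⊗ V` -/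

section Coord

variable {V : Type} [AddCommGroup V] [Module ℂ V] {ι : Type} (b : Module.Basis ι ℂ V)

/-- The coordinates of a polynomial with coefficients in `V`. -/
def polyCoord (j : ι) : Poly ⊗[ℂ] V →ₗ[Poly] Poly :=
  (TensorProduct.AlgebraTensorModule.rid ℂ Poly Poly).toLinearMap ∘ₗ (b.coord j).baseChange Poly

theorem polyCoord_tmul (j : ι) (f : Poly) (v : V) : polyCoord b j (f ⊗ₜ v) = b.repr v j • f := by
  simp [polyCoord]

theorem sum_polyCoord [Fintype ι] (x : Poly ⊗[ℂ] V) : ∑ j, polyCoord b j x ⊗ₜ b j = x := by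
  induction x with
  | zero => simp
  | tmul f v =>
    simp only [polyCoord_tmul]
    conv_rhs => rw [← b.sum_repr v, TensorProduct.tmul_sum]
    refine Finset.sum_congr rfl fun j _ => ?_
    rw [TensorProduct.smul_tmul]
  | add x y hx hy =>
    simp only [map_add, TensorProduct.add_tmul, Finset.sum_add_distrib, hx, hy]

theorem polyCoord_ext [Fintype ι] {x y : Poly ⊗[ℂ] V} (h : ∀ j, polyCoord b j x = polyCoord b j y) :
    x = y := by
  rw [← sum_polyCoord b x, ← sum_polyCoord b y]
  simp only [h]

theorem span_one_tmul_basis : Submodule.span Poly (Set.range fun k => (1 : Poly) ⊗ₜ[ℂ] b k) = ⊤ := by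
  rw [eq_top_iff]
  rintro x -
  induction x with
  | zero => exact zero_mem _
  | tmul f v =>
    induction b.mem_span v using Submodule.span_induction with
    | mem v hv =>
      obtain ⟨k, rfl⟩ := hv
      have : f ⊗ₜ[ℂ] b k = f • ((1 : Poly) ⊗ₜ[ℂ] b k) := by
        rw [TensorProduct.smul_tmul', smul_eq_mul, mul_one]
      rw [this]
      exact Submodule.smul_mem _ _ (Submodule.subset_span ⟨k, rfl⟩)
    | zero => simp
    | add x y _ _ hx hy => rw [TensorProduct.tmul_add]; exact add_mem hx hy
    | smul c x _ hx =>
      rw [TensorProduct.tmul_smul, ← algebraMap_smul Poly c]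
      exact Submodule.smul_mem _ _ hx
  | add x y hx hy => exact add_mem hx hy

end Coord

namespace Frame

variable {V V' : Type} [AddCommGroup V'] [Module ℂ V'] [AddCommGroup V] [Module ℂ V]

/-! ### The equivariant bundle with connection attached to a frame -/

/-- The action of the torus defined by the bigrading. -/
def ρ (B : Frame V) (l : Torus) : Module.End ℂ V :=
  B.b.constr ℂ fun k => torusChar (B.d k) l • B.b k

theorem ρ_b (B : Frame V) (l : Torus) (k : B.ι) : B.ρ l (B.b k) = torusChar (B.d k) l • B.b k :=
  Module.Basis.constr_basis _ _ _ _

theorem ρ_one (B : Frame V) : B.ρ 1 = 1 :=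
  B.b.ext fun k => by rw [ρ_b, torusChar_one, one_smul, Module.End.one_apply]

theorem ρ_mul (B : Frame V) (l m : Torus) : B.ρ (l * m) = B.ρ l * B.ρ m :=
  B.b.ext fun k => by
    rw [ρ_b, Module.End.mul_apply, ρ_b, map_smul, ρ_b, smul_smul, torusChar_mul, mul_comm]

/-- Homogenization: the vectors of degree `d` are multiplied by `t^{a - d - 1}`. -/
def θ (B : Frame V) (a : Fin 2 → ℤ) : V →ₗ[ℂ] Poly ⊗[ℂ] V :=
  B.b.constr ℂ fun j => mono (a - B.d j) ⊗ₜ B.b j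

theorem θ_b (B : Frame V) (a : Fin 2 → ℤ) (j : B.ι) :
    B.θ a (B.b j) = mono (a - B.d j) ⊗ₜ B.b j := Module.Basis.constr_basis _ _ _ _

theorem polyCoord_θ (B : Frame V) (a : Fin 2 → ℤ) (v : V) (j : B.ι) :
    polyCoord B.b j (B.θ a v) = B.b.repr v j • mono (a - B.d j) := by
  classical
  have : (polyCoord B.b j).restrictScalars ℂ ∘ₗ B.θ a =
      (B.b.coord j).smulRight (mono (a - B.d j)) := by
    refine B.b.ext fun k => ?_
    simp only [LinearMap.comp_apply, LinearMap.restrictScalars_apply, θ_b, polyCoord_tmul,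
      LinearMap.smulRight_apply, Module.Basis.coord_apply, Module.Basis.repr_self,
      Finsupp.single_apply]
    split_ifs with h
    · rw [h]
    · simp
  exact LinearMap.congr_fun this v

/-- Homogenization scales each coordinate by a nonzero monomial, so no information is lost; thus `δ`
can be recovered from the connection. -/
theorem θ_injective (B : Frame V) (a : Fin 2 → ℤ) : Function.Injective (B.θ a) := by
  intro v w h
  refine B.b.repr.injective (Finsupp.ext fun j => ?_)
  have := congrArg (polyCoord B.b j) h
  rw [polyCoord_θ, polyCoord_θ] at this
  exact smul_left_injective ℂ (mono_ne_zero _) this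

/-- The homogenization of `δ`. -/
def N₀ (B : Frame V) : V →ₗ[ℂ] Poly ⊗[ℂ] V := B.b.constr ℂ fun k => B.θ (B.d k) (B.δ (B.b k))

theorem N₀_b (B : Frame V) (k : B.ι) : B.N₀ (B.b k) = B.θ (B.d k) (B.δ (B.b k)) :=
  Module.Basis.constr_basis _ _ _ _

/-- The linear extension of the homogenization of `δ`. -/
def N (B : Frame V) : Poly ⊗[ℂ] V →ₗ[Poly] Poly ⊗[ℂ] V := B.N₀.liftBaseChange Poly

theorem N_tmul (B : Frame V) (f : Poly) (v : V) : B.N (f ⊗ₜ v) = f • B.N₀ v := by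
  simp [N]

/-- The action of the torus on the sections of the bundle. -/
def bunAct (B : Frame V) (l : Torus) : Module.End ℂ (Poly ⊗[ℂ] V) :=
  TensorProduct.map (torusPoly l).toLinearMap (B.ρ l)

theorem bunAct_tmul (B : Frame V) (l : Torus) (f : Poly) (v : V) :
    B.bunAct l (f ⊗ₜ v) = torusPoly l f ⊗ₜ B.ρ l v := rfl

theorem bunAct_smul (B : Frame V) (l : Torus) (f : Poly) (x : Poly ⊗[ℂ] V) :
    B.bunAct l (f • x) = torusPoly l f • B.bunAct l x := by
  induction x with
  | zero => simp
  | tmul g v =>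
    rw [TensorProduct.smul_tmul', bunAct_tmul, bunAct_tmul, TensorProduct.smul_tmul', smul_eq_mul,
      map_mul, smul_eq_mul]
  | add x y hx hy => rw [smul_add, map_add, hx, hy, map_add, smul_add]

/-- The covariant derivatives of the bundle. -/
def bunNabla (B : Frame V) : VectField →ₗ[Poly] Module.End ℂ (Poly ⊗[ℂ] V) where
  -- The connection `d + (t₁ dt₂ - t₂ dt₁) N`, contracted with `D`.
  toFun D := TensorProduct.map (D : Poly →ₗ[ℂ] Poly) LinearMap.id + rot D • B.N.restrictScalars ℂ
  map_add' D D' := by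
    refine TensorProduct.ext' fun f v => ?_
    simp only [LinearMap.add_apply, TensorProduct.map_tmul, map_add, LinearMap.smul_apply,
      add_smul, Derivation.coe_add_linearMap, TensorProduct.add_tmul]
    abel
  map_smul' f D := by
    refine TensorProduct.ext' fun g v => ?_
    simp only [LinearMap.add_apply, TensorProduct.map_tmul, map_smul, LinearMap.smul_apply,
      smul_assoc, Derivation.coe_smul_linearMap, RingHom.id_apply, smul_add,
      TensorProduct.smul_tmul']

theorem bunNabla_apply (B : Frame V) (D : VectField) (x : Poly ⊗[ℂ] V) :
    B.bunNabla D x = TensorProduct.map (D : Poly →ₗ[ℂ] Poly) LinearMap.id x + rot D • B.N x := rfl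

theorem bunNabla_tmul (B : Frame V) (D : VectField) (f : Poly) (v : V) :
    B.bunNabla D (f ⊗ₜ v) = D f ⊗ₜ v + (rot D * f) • B.N₀ v := by
  rw [bunNabla_apply, N_tmul, smul_smul]; rfl

theorem bunNabla_one_tmul (B : Frame V) (D : VectField) (v : V) :
    B.bunNabla D (1 ⊗ₜ v) = rot D • B.N₀ v := by
  rw [bunNabla_tmul, mul_one, D.map_one_eq_zero, TensorProduct.zero_tmul, zero_add]

theorem bunNabla_leibniz (B : Frame V) (D : VectField) (f : Poly) (x : Poly ⊗[ℂ] V) :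
    B.bunNabla D (f • x) = D f • x + f • B.bunNabla D x := by
  induction x with
  | zero => simp
  | tmul g v =>
    rw [TensorProduct.smul_tmul', bunNabla_tmul, bunNabla_tmul, smul_eq_mul, D.leibniz,
      TensorProduct.add_tmul, smul_add, TensorProduct.smul_tmul', TensorProduct.smul_tmul',
      smul_smul]
    simp only [smul_eq_mul]
    rw [mul_comm (D f) g, mul_left_comm]
    abel
  | add x y hx hy => simp only [smul_add, map_add, hx, hy]; abel

/-- The term `t^(a - d_j - 1) ⊗ b_j` has weight `(a - d_j - 1) + d_j = a - 1`, whatever `j`. The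
hypothesis keeps the exponents nonnegative, so that `mono` has its intended meaning. -/
theorem bunAct_θ (B : Frame V) (l : Torus) {a : Fin 2 → ℤ} {v : V}
    (h : ∀ j, B.b.repr v j ≠ 0 → ∀ i, B.d j i < a i) :
    B.bunAct l (B.θ a v) = torusChar (a - 1) l • B.θ a v := by
  refine basis_map_congr B.b (φ := B.bunAct l ∘ₗ B.θ a) (ψ := torusChar (a - 1) l • B.θ a)
    fun j hj => ?_
  rw [LinearMap.comp_apply, LinearMap.smul_apply, θ_b, bunAct_tmul, ρ_b,
    torusPoly_mono (fun i => by have := h j hj i; simp only [Pi.sub_apply]; omega),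
    TensorProduct.tmul_smul, ← TensorProduct.smul_tmul', smul_smul, ← EquivBunConn.torusChar_add]
  congr 2
  abel

theorem bunAct_N₀ (B : Frame V) (l : Torus) (k : B.ι) :
    B.bunAct l (B.N₀ (B.b k)) = torusChar (B.d k - 1) l • B.N₀ (B.b k) := by
  rw [N₀_b, bunAct_θ B l fun j hj => B.δ_mem j k hj]

/-- The equivariant bundle with connection attached to a frame. -/
def bun (B : Frame V) : EquivBunConn where
  M := Poly ⊗[ℂ] V
  finite :=
    have : Module.Finite ℂ V := Module.Finite.of_basis B.b
    inferInstance
  act :=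
    { toFun := B.bunAct
      map_one' := TensorProduct.ext' fun f v => by
        rw [bunAct_tmul, torusPoly_one, ρ_one]; rfl
      map_mul' := fun l m => TensorProduct.ext' fun f v => by
        rw [bunAct_tmul, torusPoly_mul, ρ_mul]; rfl }
  act_smul := B.bunAct_smul
  act_algebraic x := by
    change ∃ c : (Fin 2 → ℤ) →₀ Poly ⊗[ℂ] V,
      ∀ l, B.bunAct l x = c.sum fun a v => torusChar a l • v
    rw [← sum_polyCoord B.b x]
    generalize (Finset.univ : Finset B.ι) = s
    classical
    induction s using Finset.induction_on with
    | empty => exact ⟨0, fun l => by simp⟩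
    | insert j s hj ih =>
      have h : ∃ c : (Fin 2 → ℤ) →₀ Poly ⊗[ℂ] V, ∀ l,
          B.bunAct l (polyCoord B.b j x ⊗ₜ B.b j) = c.sum fun a v => torusChar a l • v := by
        obtain ⟨c, hc⟩ := EquivBunConn.torusPoly_algebraic (polyCoord B.b j x)
        refine ⟨c.sum fun a f => Finsupp.single (a + B.d j) (f ⊗ₜ B.b j), fun l => ?_⟩
        rw [Finsupp.sum_sum_index (fun _ => smul_zero _) (fun _ _ _ => smul_add _ _ _),
          bunAct_tmul, hc, ρ_b, Finsupp.sum, TensorProduct.sum_tmul]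
        refine Finset.sum_congr rfl fun a _ => ?_
        dsimp only
        rw [Finsupp.sum_single_index (by exact smul_zero _), EquivBunConn.torusChar_add,
          TensorProduct.tmul_smul, ← TensorProduct.smul_tmul', smul_smul, mul_comm]
      obtain ⟨c, hc⟩ := EquivBunConn.algebraic_add h ih
      exact ⟨c, fun l => by rw [Finset.sum_insert hj, map_add, hc]⟩
  nabla := B.bunNabla
  leibniz := B.bunNabla_leibniz
  nabla_equivariant l D x := by
    change B.bunAct l (B.bunNabla D x) = B.bunNabla (torusVect l D) (B.bunAct l x)
    rw [← sum_polyCoord B.b x]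
    simp only [map_sum]
    refine Finset.sum_congr rfl fun k _ => ?_
    set f := polyCoord B.b k x
    have h1 : torusVect l D (torusPoly l f) = torusPoly l (D f) := by
      rw [torusVect_apply, AlgEquiv.symm_apply_apply]
    -- The weight `d_k - 1` of `N₀ (b k)` is that of `b k` together with the factor `-1` coming from
    -- the contracted form.
    have h2 : torusChar (B.d k - 1) l = torusChar (-1) l * torusChar (B.d k) l := by
      rw [← EquivBunConn.torusChar_add]; congr 1; abel
    rw [bunNabla_tmul, map_add, bunAct_tmul, bunAct_tmul, bunNabla_tmul, bunAct_smul, bunAct_N₀, h1,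
      ρ_b, map_smul, rot_torusVect, map_mul, h2, smul_mul_assoc, smul_assoc,
      mul_smul (torusChar (-1) l), smul_comm _ (torusChar (-1) l)]

end Frame

namespace Frame

variable {V V' : Type} [AddCommGroup V'] [Module ℂ V'] [AddCommGroup V] [Module ℂ V]

/-! ### Morphisms of frames and of bundles -/

theorem ρ_map {B : Frame V} {C : Frame V'} {f : V →ₗ[ℂ] V'} (hf : f ∈ degreeZero B C) (l : Torus)
    (v : V) : f (B.ρ l v) = C.ρ l (f v) := by
  have : f ∘ₗ B.ρ l = C.ρ l ∘ₗ f := B.b.ext fun k => by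
    rw [LinearMap.comp_apply, ρ_b, map_smul]
    refine (basis_map_congr C.b (φ := C.ρ l) (ψ := torusChar (B.d k) l • LinearMap.id)
      fun j hj => ?_).symm
    rw [ρ_b, hf j k hj]; rfl
  exact LinearMap.congr_fun this v

theorem baseChange_θ {B : Frame V} {C : Frame V'} {f : V →ₗ[ℂ] V'} (hf : f ∈ degreeZero B C)
    (a : Fin 2 → ℤ) (v : V) : f.baseChange Poly (B.θ a v) = C.θ a (f v) := by
  have : (f.baseChange Poly).restrictScalars ℂ ∘ₗ B.θ a = C.θ a ∘ₗ f := B.b.ext fun k => by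
    rw [LinearMap.comp_apply, LinearMap.comp_apply, LinearMap.restrictScalars_apply, θ_b,
      LinearMap.baseChange_tmul]
    refine (basis_map_congr C.b (φ := C.θ a) (ψ := TensorProduct.mk ℂ Poly V' (mono (a - B.d k)))
      fun j hj => ?_).symm
    rw [θ_b, hf j k hj]; rfl
  exact LinearMap.congr_fun this v

/-- `N₀` homogenizes a basis vector with respect to its own degree; the image of `b k` only involves
basis vectors of that same degree, so one homogenization serves for all of them. -/
theorem N₀_map_b {B : Frame V} {C : Frame V'} {f : V →ₗ[ℂ] V'} (hf : f ∈ degreeZero B C) (k : B.ι) :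
    C.N₀ (f (B.b k)) = C.θ (B.d k) (C.δ (f (B.b k))) := by
  refine basis_map_congr C.b (φ := C.N₀) (ψ := C.θ (B.d k) ∘ₗ C.δ) fun j hj => ?_
  rw [N₀_b, hf j k hj]; rfl

theorem IsHom.baseChange_mem {B : Frame V} {C : Frame V'} {f : V →ₗ[ℂ] V'} (h : IsHom B C f) :
    f.baseChange Poly ∈ EquivBunConn.homs B.bun C.bun := by
  refine EquivBunConn.mem_homs_of_span (E := B.bun) (E' := C.bun) (span_one_tmul_basis B.b) _ ?_ ?_
  · rintro l _ ⟨k, rfl⟩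
    change f.baseChange Poly (B.bunAct l (1 ⊗ₜ B.b k)) = C.bunAct l (f.baseChange Poly (1 ⊗ₜ B.b k))
    rw [bunAct_tmul, LinearMap.baseChange_tmul, LinearMap.baseChange_tmul, bunAct_tmul,
      ρ_map h.mem]
  · rintro D _ ⟨k, rfl⟩
    change f.baseChange Poly (B.bunNabla D (1 ⊗ₜ B.b k)) =
      C.bunNabla D (f.baseChange Poly (1 ⊗ₜ B.b k))
    have := LinearMap.congr_fun h.comm (B.b k)
    simp only [LinearMap.comp_apply] at this
    rw [bunNabla_one_tmul, LinearMap.baseChange_tmul, bunNabla_one_tmul, map_smul, N₀_b,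
      baseChange_θ h.mem, N₀_map_b h.mem, this]

/-- The value at the origin of a polynomial with coefficients in `V`. -/
def evalZero (V : Type) [AddCommGroup V] [Module ℂ V] : Poly ⊗[ℂ] V →ₗ[ℂ] V :=
  (TensorProduct.lid ℂ V).toLinearMap ∘ₗ
    TensorProduct.map (MvPolynomial.aeval (0 : Fin 2 → ℂ)).toLinearMap LinearMap.id

theorem evalZero_tmul (f : Poly) (v : V) :
    evalZero V (f ⊗ₜ v) = MvPolynomial.constantCoeff f • v := by
  simp [evalZero]

/-- Along the Euler field the connection is coordinatewise differentiation, so a horizontal section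
has constant coordinates. -/
theorem eq_one_tmul_of_euler (B : Frame V) {x : Poly ⊗[ℂ] V} (h : B.bunNabla euler x = 0) :
    x = 1 ⊗ₜ evalZero V x := by
  have h0 : ∀ y, B.bunNabla euler y =
      TensorProduct.map (euler : Poly →ₗ[ℂ] Poly) LinearMap.id y := fun y => by
    rw [bunNabla_apply, rot_euler, zero_smul, add_zero]
  have h1 : ∀ j y, polyCoord B.b j (B.bunNabla euler y) = euler (polyCoord B.b j y) := by
    intro j y
    rw [h0]
    induction y with
    | zero => simp
    | tmul f v => simp [polyCoord_tmul]
    | add x y hx hy => simp only [map_add, hx, hy]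
  refine (sum_polyCoord B.b x).symm.trans ?_
  conv_rhs => rw [← sum_polyCoord B.b x]
  rw [map_sum, TensorProduct.tmul_sum]
  refine Finset.sum_congr rfl fun j _ => ?_
  have h2 := h1 j x
  rw [h, map_zero] at h2
  rw [evalZero_tmul, ← TensorProduct.smul_tmul]
  conv_lhs => rw [eq_C_of_euler_eq_zero h2.symm]
  rw [Algebra.smul_def, mul_one, MvPolynomial.algebraMap_eq]

theorem one_tmul_injective {v w : V}
    (h : (1 : Poly) ⊗ₜ[ℂ] v = (1 : Poly) ⊗ₜ[ℂ] w) : v = w := by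
  have := congrArg (evalZero V) h
  simpa [evalZero_tmul] using this

/-- Every morphism of bundles comes from a morphism of frames. -/
theorem exists_isHom {B : Frame V} {C : Frame V'} {φ : Poly ⊗[ℂ] V →ₗ[Poly] Poly ⊗[ℂ] V'}
    (hφ : φ ∈ EquivBunConn.homs B.bun C.bun) : ∃ f, IsHom B C f ∧ f.baseChange Poly = φ := by
  have hact : ∀ l x, φ (B.bunAct l x) = C.bunAct l (φ x) := hφ.1
  have hnab : ∀ D x, φ (B.bunNabla D x) = C.bunNabla D (φ x) := hφ.2
  let f : V →ₗ[ℂ] V' := evalZero V' ∘ₗ φ.restrictScalars ℂ ∘ₗ TensorProduct.mk ℂ Poly V 1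
  -- A morphism preserves horizontality along the Euler field, hence maps constant sections to
  -- constant sections: it is determined by a map of fibres.
  have hf : ∀ v, φ (1 ⊗ₜ v) = 1 ⊗ₜ f v := fun v => C.eq_one_tmul_of_euler (by
    rw [← hnab, bunNabla_one_tmul, rot_euler, zero_smul, map_zero])
  have hmem : f ∈ degreeZero B C := by
    intro j k hjk
    -- A nonzero matrix entry can be cancelled from the equivariance relation, so its row and column
    -- have the same character.
    refine torusChar_injective fun l => ?_
    have h1 := hact l (1 ⊗ₜ B.b k)
    rw [bunAct_tmul, ρ_b, map_one, hf, hf, bunAct_tmul, map_one] at h1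
    have h2 := one_tmul_injective h1
    have h3 := congrArg (fun u => C.b.repr u j) h2
    have h4 : C.b.repr (C.ρ l (f (B.b k))) j = torusChar (C.d j) l * C.b.repr (f (B.b k)) j := by
      classical
      have : C.b.coord j ∘ₗ C.ρ l = torusChar (C.d j) l • C.b.coord j := C.b.ext fun i => by
        rw [LinearMap.comp_apply, ρ_b, LinearMap.smul_apply, map_smul, Module.Basis.coord_apply,
          Module.Basis.repr_self, Finsupp.single_apply]
        split_ifs with h
        · rw [h]
        · simp
      exact LinearMap.congr_fun this _
    rw [h4, map_smul, map_smul, Finsupp.smul_apply, smul_eq_mul] at h3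
    exact (mul_right_cancel₀ hjk h3).symm
  refine ⟨f, ⟨hmem, B.b.ext fun k => ?_⟩, ?_⟩
  -- The derivative along `∂₂` suffices: there the contracted form is `t₁`, which can be divided
  -- out, and the homogenization can then be removed.
  · have h1 := hnab (MvPolynomial.pderiv 1) (1 ⊗ₜ B.b k)
    have hφf : φ = f.baseChange Poly := by
      refine TensorProduct.AlgebraTensorModule.curry_injective (LinearMap.ext_ring ?_)
      exact LinearMap.ext fun v => by simpa using hf v
    rw [bunNabla_one_tmul, hf, bunNabla_one_tmul, rot_pderiv_one, map_smul, N₀_b, hφf,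
      baseChange_θ hmem, N₀_map_b hmem] at h1
    refine C.θ_injective (B.d k) (polyCoord_ext C.b fun j => ?_)
    have h2 := congrArg (polyCoord C.b j) h1
    rw [map_smul, map_smul, smul_eq_mul, smul_eq_mul] at h2
    exact mul_left_cancel₀ (MvPolynomial.X_ne_zero 0) h2
  · refine TensorProduct.AlgebraTensorModule.curry_injective (LinearMap.ext_ring ?_)
    exact LinearMap.ext fun v => by simpa using (hf v).symm

/-! ### Compatibility with tensor products and complex conjugation -/

/-- `(ℂ[t₁, t₂] ⊗ V) ⊗ (ℂ[t₁, t₂] ⊗ V') = ℂ[t₁, t₂] ⊗ (V ⊗ V')`. -/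
def tensorEquiv (V V' : Type) [AddCommGroup V] [Module ℂ V] [AddCommGroup V'] [Module ℂ V'] :
    (Poly ⊗[ℂ] V) ⊗[Poly] (Poly ⊗[ℂ] V') ≃ₗ[Poly] Poly ⊗[ℂ] (V ⊗[ℂ] V') :=
  (TensorProduct.AlgebraTensorModule.distribBaseChange ℂ Poly V V').symm

theorem tensorEquiv_tmul (f g : Poly) (v : V) (w : V') :
    tensorEquiv V V' ((f ⊗ₜ v) ⊗ₜ (g ⊗ₜ w)) = (f * g) ⊗ₜ (v ⊗ₜ w) :=
  TensorProduct.AlgebraTensorModule.distribBaseChange_symm_tmul _ _ _ _ _ _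

theorem span_one_tmul_tmul (B : Frame V) (C : Frame V') :
    Submodule.span Poly (Set.range fun k : B.ι × C.ι =>
      ((1 : Poly) ⊗ₜ[ℂ] B.b k.1) ⊗ₜ[Poly] ((1 : Poly) ⊗ₜ[ℂ] C.b k.2)) = ⊤ := by
  rw [← TensorProduct.map₂_mk_top_top_eq_top, ← span_one_tmul_basis B.b, ← span_one_tmul_basis C.b,
    Submodule.map₂_span_span]
  congr 1
  ext x
  simp [Set.mem_image2]

/-- The exponent is unchanged because `(a + d_l) - (d_k + d_l) = a - d_k`. With its companion on the
right, this shows that homogenization commutes with the two summands of `δ` on the tensor product.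
-/
theorem tensorEquiv_θ_left (B : Frame V) (C : Frame V') (a : Fin 2 → ℤ) (v : V) (l : C.ι) :
    tensorEquiv V V' (B.θ a v ⊗ₜ (1 ⊗ₜ C.b l)) = (B.tensor C).θ (a + C.d l) (v ⊗ₜ C.b l) := by
  have : (tensorEquiv V V').toLinearMap.restrictScalars ℂ ∘ₗ
      ((TensorProduct.mk Poly _ _).flip ((1 : Poly) ⊗ₜ[ℂ] C.b l)).restrictScalars ℂ ∘ₗ B.θ a =
      (B.tensor C).θ (a + C.d l) ∘ₗ (TensorProduct.mk ℂ V V').flip (C.b l) := B.b.ext fun k => by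
    have h := (B.tensor C).θ_b (a + C.d l) (k, l)
    rw [tensor_b] at h
    refine Eq.trans ?_ h.symm
    change tensorEquiv V V' (B.θ a (B.b k) ⊗ₜ (1 ⊗ₜ C.b l)) = _
    rw [θ_b, tensorEquiv_tmul, mul_one]
    congr 2
    change a - B.d k = a + C.d l - (B.d k + C.d l)
    abel
  exact LinearMap.congr_fun this v

theorem tensorEquiv_θ_right (B : Frame V) (C : Frame V') (a : Fin 2 → ℤ) (k : B.ι) (w : V') :
    tensorEquiv V V' ((1 ⊗ₜ B.b k) ⊗ₜ C.θ a w) = (B.tensor C).θ (B.d k + a) (B.b k ⊗ₜ w) := by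
  have : (tensorEquiv V V').toLinearMap.restrictScalars ℂ ∘ₗ
      ((TensorProduct.mk Poly _ _) ((1 : Poly) ⊗ₜ[ℂ] B.b k)).restrictScalars ℂ ∘ₗ C.θ a =
      (B.tensor C).θ (B.d k + a) ∘ₗ TensorProduct.mk ℂ V V' (B.b k) := C.b.ext fun l => by
    have h := (B.tensor C).θ_b (B.d k + a) (k, l)
    rw [tensor_b] at h
    refine Eq.trans ?_ h.symm
    change tensorEquiv V V' ((1 ⊗ₜ B.b k) ⊗ₜ C.θ a (C.b l)) = _
    rw [θ_b, tensorEquiv_tmul, one_mul]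
    congr 2
    change a - C.d l = B.d k + a - (B.d k + C.d l)
    abel
  exact LinearMap.congr_fun this w

theorem tensorEquiv_mem (B : Frame V) (C : Frame V') :
    (tensorEquiv V V').toLinearMap ∈
      EquivBunConn.homs (EquivBunConn.tensor B.bun C.bun) (B.tensor C).bun := by
  refine EquivBunConn.mem_homs_of_span (E := EquivBunConn.tensor B.bun C.bun)
    (span_one_tmul_tmul B C) _ ?_ ?_
  · rintro l _ ⟨⟨k, k'⟩, rfl⟩
    change tensorEquiv V V' (B.bunAct l (1 ⊗ₜ B.b k) ⊗ₜ C.bunAct l (1 ⊗ₜ C.b k')) =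
      (B.tensor C).bunAct l (tensorEquiv V V' ((1 ⊗ₜ B.b k) ⊗ₜ (1 ⊗ₜ C.b k')))
    have h := (B.tensor C).ρ_b l (k, k')
    rw [tensor_b] at h
    rw [bunAct_tmul, bunAct_tmul, tensorEquiv_tmul, tensorEquiv_tmul, bunAct_tmul, map_one, mul_one,
      map_one, h, ρ_b, ρ_b, TensorProduct.smul_tmul_smul]
    congr 2
    exact (EquivBunConn.torusChar_add _ _ _).symm
  · rintro D _ ⟨⟨k, k'⟩, rfl⟩
    change tensorEquiv V V' (B.bunNabla D (1 ⊗ₜ B.b k) ⊗ₜ (1 ⊗ₜ C.b k') +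
      (1 ⊗ₜ B.b k) ⊗ₜ C.bunNabla D (1 ⊗ₜ C.b k')) =
      (B.tensor C).bunNabla D (tensorEquiv V V' ((1 ⊗ₜ B.b k) ⊗ₜ (1 ⊗ₜ C.b k')))
    have h := (B.tensor C).N₀_b (k, k')
    rw [tensor_b, tensor_δ, map_add] at h
    rw [bunNabla_one_tmul, bunNabla_one_tmul, tensorEquiv_tmul, mul_one, bunNabla_one_tmul, map_add,
      ← TensorProduct.smul_tmul', TensorProduct.tmul_smul, map_smul, map_smul, N₀_b, N₀_b,
      tensorEquiv_θ_left, tensorEquiv_θ_right, ← smul_add, h]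
    rfl

theorem unitEquiv_mem :
    (TensorProduct.AlgebraTensorModule.rid ℂ Poly Poly).symm.toLinearMap ∈
      EquivBunConn.homs EquivBunConn.unit unit.bun := by
  have hb : ∀ x : ℂ, unit.N₀ x = 0 := by
    intro x
    have : unit.N₀ = 0 := unit.b.ext fun k => by
      rw [N₀_b]
      exact map_zero _
    rw [this, LinearMap.zero_apply]
  have hρ : ∀ l, unit.ρ l 1 = 1 := fun l => by
    have h := unit.ρ_b l ()
    have h1 : unit.b () = (1 : ℂ) := Module.Basis.singleton_apply Unit ℂ ()
    rw [h1] at h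
    rw [h]
    change torusChar 0 l • (1 : ℂ) = 1
    rw [torusChar_zero, one_smul]
  refine EquivBunConn.mem_homs_of_span (E := EquivBunConn.unit) (S := {(1 : Poly)}) ?_ _ ?_ ?_
  · exact Ideal.span_singleton_one
  · rintro l _ rfl
    change torusPoly l 1 ⊗ₜ[ℂ] (1 : ℂ) = unit.bunAct l (1 ⊗ₜ 1)
    rw [bunAct_tmul, hρ]
  · rintro D _ rfl
    change D 1 ⊗ₜ[ℂ] (1 : ℂ) = unit.bunNabla D (1 ⊗ₜ 1)
    rw [bunNabla_one_tmul, hb, smul_zero, D.map_one_eq_zero, TensorProduct.zero_tmul]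

/-- `ℂ[t₁, t₂] ⊗ σ(V) → σ(ℂ[t₁, t₂] ⊗ V)`. -/
def conjBunMap (V : Type) [AddCommGroup V] [Module ℂ V] :
    Poly ⊗[ℂ] Conj V →ₗ[Poly] Conj (Poly ⊗[ℂ] V) :=
  (conjMap (TensorProduct.mk ℂ Poly V 1)).liftBaseChange Poly

theorem conjBunMap_tmul (f : Poly) (v : V) :
    conjBunMap V (f ⊗ₜ conjEquiv V v) = conjEquiv _ (polyConj f ⊗ₜ v) := by
  rw [conjBunMap, LinearMap.liftBaseChange_tmul]
  change conjEquiv _ (polyConj f • ((1 : Poly) ⊗ₜ[ℂ] v)) = _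
  rw [TensorProduct.smul_tmul', smul_eq_mul, mul_one]

/-- `ℂ[t₁, t₂] ⊗ σ(V) = σ(ℂ[t₁, t₂] ⊗ V)`, as complex vector spaces. -/
def conjBunLin (V : Type) [AddCommGroup V] [Module ℂ V] :
    Poly ⊗[ℂ] Conj V ≃ₗ[ℂ] Conj (Poly ⊗[ℂ] V) :=
  (TensorProduct.congr
    ({ polyConj with map_smul' := polyConj_smul } : Poly ≃ₛₗ[starRingEnd ℂ] Poly)
    (conjEquiv V)).symm.trans (conjEquiv (Poly ⊗[ℂ] V))

/-- One construction is visibly linear over the polynomials, the other visibly bijective; being the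
same map, it is both. -/
theorem conjBunMap_eq (x : Poly ⊗[ℂ] Conj V) : conjBunMap V x = conjBunLin V x := by
  induction x with
  | zero => simp
  | tmul f v =>
    obtain ⟨v, rfl⟩ := (conjEquiv V).surjective v
    rw [conjBunMap_tmul]
    rfl
  | add x y hx hy => rw [map_add, map_add, hx, hy]

/-- `ℂ[t₁, t₂] ⊗ σ(V) = σ(ℂ[t₁, t₂] ⊗ V)`. -/
def conjBunEquiv (V : Type) [AddCommGroup V] [Module ℂ V] :
    Poly ⊗[ℂ] Conj V ≃ₗ[Poly] Conj (Poly ⊗[ℂ] V) :=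
  { conjBunMap V with
    invFun := (conjBunLin V).symm
    left_inv := fun x => by
      change (conjBunLin V).symm (conjBunMap V x) = x
      rw [conjBunMap_eq, LinearEquiv.symm_apply_apply]
    right_inv := fun x => by
      change conjBunMap V ((conjBunLin V).symm x) = x
      rw [conjBunMap_eq, LinearEquiv.apply_symm_apply] }

theorem conjBunEquiv_tmul (f : Poly) (v : V) :
    conjBunEquiv V (f ⊗ₜ conjEquiv V v) = conjEquiv _ (polyConj f ⊗ₜ v) := conjBunMap_tmul f v

theorem conjBunEquiv_smul (c : ℂ) (x : Poly ⊗[ℂ] Conj V) :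
    conjBunEquiv V (c • x) = c • conjBunEquiv V x := by
  change conjBunMap V (c • x) = c • conjBunMap V x
  rw [conjBunMap_eq, map_smul, conjBunMap_eq]

theorem conj_b (B : Frame V) (k : B.ι) : B.conj.b k = conjEquiv V (B.b k) :=
  ComplexMHS.conjBasis_apply _ _

theorem conjBunEquiv_θ (B : Frame V) (a : Fin 2 → ℤ) (v : V) :
    conjBunEquiv V (B.conj.θ (fun i => a (Equiv.swap (0 : Fin 2) 1 i)) (conjEquiv V v)) =
      conjEquiv _ (B.θ a v) := by
  induction B.b.mem_span v using Submodule.span_induction with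
  | mem v hv =>
    obtain ⟨k, rfl⟩ := hv
    have h := B.conj.θ_b (fun i => a (Equiv.swap (0 : Fin 2) 1 i)) k
    rw [conj_b] at h
    rw [h, θ_b, conjBunEquiv_tmul]
    congr 2
    exact polyConj_mono (a - B.d k)
  | zero => simp
  | add x y _ _ hx hy => simp only [map_add, hx, hy]
  | smul c x _ hx =>
    rw [LinearEquiv.map_smulₛₗ, map_smul, conjBunEquiv_smul, map_smul, LinearEquiv.map_smulₛₗ, hx]

theorem conj_N₀ (B : Frame V) (k : B.ι) :
    conjBunEquiv V (B.conj.N₀ (conjEquiv V (B.b k))) = - conjEquiv _ (B.N₀ (B.b k)) := by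
  have h := B.conj.N₀_b k
  have h2 : B.conj.δ (conjEquiv V (B.b k)) = - conjEquiv V (B.δ (B.b k)) := rfl
  rw [conj_b, h2, map_neg] at h
  rw [h, N₀_b, map_neg]
  exact congrArg Neg.neg (conjBunEquiv_θ B (B.d k) (B.δ (B.b k)))

theorem conj_ρ (B : Frame V) (l : Torus) (k : B.ι) :
    B.conj.ρ l (conjEquiv V (B.b k)) = conjEquiv V (B.ρ (torusConj l) (B.b k)) := by
  have h := B.conj.ρ_b l k
  rw [conj_b] at h
  rw [h, ρ_b, LinearEquiv.map_smulₛₗ, EquivBunConn.torusChar_torusConj, Complex.conj_conj]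
  rfl

theorem conjBunEquiv_mem (B : Frame V) :
    (conjBunEquiv V).toLinearMap ∈ EquivBunConn.homs B.conj.bun (EquivBunConn.conj B.bun) := by
  have hS : Submodule.span Poly
      (Set.range fun k : B.ι => (1 : Poly) ⊗ₜ[ℂ] conjEquiv V (B.b k)) = ⊤ := by
    simpa only [ComplexMHS.conjBasis_apply] using span_one_tmul_basis (ComplexMHS.conjBasis B.b)
  refine EquivBunConn.mem_homs_of_span (E := B.conj.bun) hS _ ?_ ?_
  · rintro l _ ⟨k, rfl⟩
    change conjBunEquiv V (B.conj.bunAct l (1 ⊗ₜ conjEquiv V (B.b k))) =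
      conjMap (B.bunAct (torusConj l)) (conjBunEquiv V (1 ⊗ₜ conjEquiv V (B.b k)))
    rw [bunAct_tmul, conj_ρ, map_one, conjBunEquiv_tmul, conjBunEquiv_tmul, map_one]
    change _ = conjEquiv _ (B.bunAct (torusConj l) (1 ⊗ₜ B.b k))
    rw [bunAct_tmul, map_one]
  · rintro D _ ⟨k, rfl⟩
    change conjBunEquiv V (B.conj.bunNabla D (1 ⊗ₜ conjEquiv V (B.b k))) =
      conjMap (B.bunNabla (vectConj D)) (conjBunEquiv V (1 ⊗ₜ conjEquiv V (B.b k)))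
    rw [bunNabla_one_tmul, map_smul, conj_N₀, conjBunEquiv_tmul, map_one]
    change _ = conjEquiv _ (B.bunNabla (vectConj D) (1 ⊗ₜ B.b k))
    -- The sign of `-σ(δ)` in the conjugate frame and the sign of the reversed form agree.
    rw [bunNabla_one_tmul, rot_vectConj, smul_neg]
    exact (congrArg (conjEquiv _) (neg_smul (polyConj (rot D)) (B.N₀ (B.b k)))).symm

end Frame

/-! ### The functor from mixed Hodge structures to bundles with connection -/

/-- A frame of a mixed Hodge structure. -/
def hodgeFrame (X : ComplexMHS) : Frame X.V := (exists_frame X).choose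

theorem hodgeFrame_spec (X : ComplexMHS) : (hodgeFrame X).IsFrameOf X.W X.F' X.F'' :=
  (exists_frame X).choose_spec

/-- The identity of the mixed Hodge structure is a morphism between any two of its frames by
`isHom_of_mem_homs`: they share the bigrading and `δ`, hence the bundle. So the arbitrary choice in
`hodgeFrame` is harmless, and any convenient frame may replace it. -/
theorem Frame.id_mem {X : ComplexMHS} {B C : Frame X.V} (hB : B.IsFrameOf X.W X.F' X.F'')
    (hC : C.IsFrameOf X.W X.F' X.F'') :
    (LinearMap.id : Poly ⊗[ℂ] X.V →ₗ[Poly] Poly ⊗[ℂ] X.V) ∈ EquivBunConn.homs B.bun C.bun := by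
  have h := (isHom_of_mem_homs (f := LinearMap.id) hB hC
    ⟨fun _ _ h => h, fun _ _ h => h, fun _ _ h => h⟩).baseChange_mem
  rwa [LinearMap.baseChange_id] at h

/-- The bundle attached to a frame depends only on the mixed Hodge structure. -/
theorem Frame.mem_homs_right {X : ComplexMHS} {B C : Frame X.V} (hB : B.IsFrameOf X.W X.F' X.F'')
    (hC : C.IsFrameOf X.W X.F' X.F'') {E : EquivBunConn} {φ : E.M →ₗ[Poly] Poly ⊗[ℂ] X.V}
    (h : φ ∈ EquivBunConn.homs E B.bun) : φ ∈ EquivBunConn.homs E C.bun :=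
  ⟨fun l m => (h.1 l m).trans ((Frame.id_mem hB hC).1 l (φ m)),
    fun D m => (h.2 D m).trans ((Frame.id_mem hB hC).2 D (φ m))⟩

theorem Frame.mem_homs_left {X : ComplexMHS} {B C : Frame X.V} (hB : B.IsFrameOf X.W X.F' X.F'')
    (hC : C.IsFrameOf X.W X.F' X.F'') {E : EquivBunConn} {φ : Poly ⊗[ℂ] X.V →ₗ[Poly] E.M}
    (h : φ ∈ EquivBunConn.homs B.bun E) : φ ∈ EquivBunConn.homs C.bun E :=
  ⟨fun l m => (congrArg φ ((Frame.id_mem hC hB).1 l m)).trans (h.1 l m),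
    fun D m => (congrArg φ ((Frame.id_mem hC hB).2 D m)).trans (h.2 D m)⟩

/-- The functor which attaches to a mixed Hodge structure the bundle of any of its frames. -/
def hodgeBun : ComplexMHS ⥤ EquivBunConn where
  obj X := (hodgeFrame X).bun
  map {X Y} f := ⟨(ComplexMHS.Hom.lin f).baseChange Poly,
    (Frame.isHom_of_mem_homs (hodgeFrame_spec X) (hodgeFrame_spec Y) f.2).baseChange_mem⟩
  map_id _ := EquivBunConn.hom_ext LinearMap.baseChange_id
  map_comp _ _ := EquivBunConn.hom_ext (LinearMap.baseChange_comp _ _ )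

instance : hodgeBun.Additive where
  map_add := EquivBunConn.hom_ext (LinearMap.baseChange_add _ _)

instance : hodgeBun.Linear ℂ where
  map_smul f c := EquivBunConn.hom_ext (LinearMap.baseChange_smul c (ComplexMHS.Hom.lin f))

instance : hodgeBun.Faithful where
  map_injective {X Y f g} h := ComplexMHS.hom_ext (LinearMap.ext fun v => by
    have h1 := LinearMap.congr_fun (congrArg EquivBunConn.Hom.lin h) ((1 : Poly) ⊗ₜ[ℂ] v)
    exact Frame.one_tmul_injective h1)

instance : hodgeBun.Full where
  map_surjective {X Y} φ := by
    obtain ⟨f, hf, hφ⟩ := Frame.exists_isHom (B := hodgeFrame X) (C := hodgeFrame Y) φ.2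
    exact ⟨⟨f, hf.mem_homs (hodgeFrame_spec X) (hodgeFrame_spec Y)⟩, EquivBunConn.hom_ext hφ⟩

/-! ### Monoidality -/

theorem poly_tensor_ext {V V' U : Type} [AddCommGroup V] [Module ℂ V] [AddCommGroup V']
    [Module ℂ V'] [AddCommGroup U] [Module Poly U]
    {φ ψ : (Poly ⊗[ℂ] V) ⊗[Poly] (Poly ⊗[ℂ] V') →ₗ[Poly] U}
    (h : ∀ f v g w, φ ((f ⊗ₜ v) ⊗ₜ (g ⊗ₜ w)) = ψ ((f ⊗ₜ v) ⊗ₜ (g ⊗ₜ w))) : φ = ψ := by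
  refine TensorProduct.ext' fun x y => ?_
  induction x with
  | zero => simp
  | add x x' hx hx' => simp only [TensorProduct.add_tmul, map_add, hx, hx']
  | tmul f v =>
    induction y with
    | zero => simp
    | add y y' hy hy' => simp only [TensorProduct.tmul_add, map_add, hy, hy']
    | tmul g w => exact h f v g w

theorem poly_tensor_ext₃ {V V' V'' U : Type} [AddCommGroup V] [Module ℂ V] [AddCommGroup V']
    [Module ℂ V'] [AddCommGroup V''] [Module ℂ V''] [AddCommGroup U] [Module Poly U]
    {φ ψ : ((Poly ⊗[ℂ] V) ⊗[Poly] (Poly ⊗[ℂ] V')) ⊗[Poly] (Poly ⊗[ℂ] V'') →ₗ[Poly] U}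
    (h : ∀ f v g w k u, φ (((f ⊗ₜ v) ⊗ₜ (g ⊗ₜ w)) ⊗ₜ (k ⊗ₜ u)) =
      ψ (((f ⊗ₜ v) ⊗ₜ (g ⊗ₜ w)) ⊗ₜ (k ⊗ₜ u))) : φ = ψ := by
  refine TensorProduct.ext (poly_tensor_ext fun f v g w => LinearMap.ext fun y => ?_)
  change φ (((f ⊗ₜ v) ⊗ₜ (g ⊗ₜ w)) ⊗ₜ y) = ψ (((f ⊗ₜ v) ⊗ₜ (g ⊗ₜ w)) ⊗ₜ y)
  induction y with
  | zero => simp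
  | add y y' hy hy' => simp only [TensorProduct.tmul_add, map_add, hy, hy']
  | tmul k u => exact h f v g w k u

theorem lid_tensorEquiv {V : Type} [AddCommGroup V] [Module ℂ V] (p : Poly) (x : Poly ⊗[ℂ] V) :
    p • x = (TensorProduct.lid ℂ V).toLinearMap.baseChange Poly
      (Frame.tensorEquiv ℂ V ((p ⊗ₜ 1) ⊗ₜ x)) := by
  induction x with
  | zero => simp
  | add x y hx hy => rw [smul_add, hx, hy, TensorProduct.tmul_add, map_add, map_add]
  | tmul q v =>
    rw [Frame.tensorEquiv_tmul, LinearMap.baseChange_tmul, LinearEquiv.coe_coe,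
      TensorProduct.lid_tmul, one_smul, TensorProduct.smul_tmul', smul_eq_mul]

theorem rid_tensorEquiv {V : Type} [AddCommGroup V] [Module ℂ V] (x : Poly ⊗[ℂ] V) (p : Poly) :
    p • x = (TensorProduct.rid ℂ V).toLinearMap.baseChange Poly
      (Frame.tensorEquiv V ℂ (x ⊗ₜ (p ⊗ₜ 1))) := by
  induction x with
  | zero => simp
  | add x y hx hy => rw [smul_add, hx, hy, TensorProduct.add_tmul, map_add, map_add]
  | tmul q v =>
    rw [Frame.tensorEquiv_tmul, LinearMap.baseChange_tmul, LinearEquiv.coe_coe,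
      TensorProduct.rid_tmul, one_smul, TensorProduct.smul_tmul', smul_eq_mul, mul_comm]

open HodgeConn.Frame in
/-- The monoidal structure of the functor. -/
def hodgeBunCore : hodgeBun.CoreMonoidal where
  εIso := EquivBunConn.isoMk (E := EquivBunConn.unit) (E' := (hodgeFrame ComplexMHS.unit).bun)
    (TensorProduct.AlgebraTensorModule.rid ℂ Poly Poly).symm
    -- The explicit unit frame is exchanged for the chosen frame; `μIso` does the same with the
    -- tensor product frame, and `hodgeBunConj` with the conjugate frame.
    (mem_homs_right (X := ComplexMHS.unit) isFrameOf_unit (hodgeFrame_spec ComplexMHS.unit)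
      unitEquiv_mem)
  μIso X Y := EquivBunConn.isoMk (E := EquivBunConn.tensor (hodgeFrame X).bun (hodgeFrame Y).bun)
    (E' := (hodgeFrame (ComplexMHS.tensor X Y)).bun) (tensorEquiv X.V Y.V)
    (mem_homs_right (X := ComplexMHS.tensor X Y)
      ((hodgeFrame_spec X).tensor (hodgeFrame_spec Y)) (hodgeFrame_spec _) (tensorEquiv_mem _ _))
  μIso_hom_natural_left {X Y} f Z := EquivBunConn.hom_ext (poly_tensor_ext fun p v q w => by
    change tensorEquiv Y.V Z.V ((p ⊗ₜ f.1 v) ⊗ₜ (q ⊗ₜ w)) =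
      (TensorProduct.map f.1 LinearMap.id).baseChange Poly
        (tensorEquiv X.V Z.V ((p ⊗ₜ v) ⊗ₜ (q ⊗ₜ w)))
    rw [tensorEquiv_tmul, tensorEquiv_tmul]; rfl)
  μIso_hom_natural_right {X Y} Z f := EquivBunConn.hom_ext (poly_tensor_ext fun p v q w => by
    change tensorEquiv Z.V Y.V ((p ⊗ₜ v) ⊗ₜ (q ⊗ₜ f.1 w)) =
      (TensorProduct.map LinearMap.id f.1).baseChange Poly
        (tensorEquiv Z.V X.V ((p ⊗ₜ v) ⊗ₜ (q ⊗ₜ w)))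
    rw [tensorEquiv_tmul, tensorEquiv_tmul]; rfl)
  associativity X Y Z := EquivBunConn.hom_ext (poly_tensor_ext₃ fun p v q w r u => by
    change (TensorProduct.assoc ℂ X.V Y.V Z.V).toLinearMap.baseChange Poly
        (tensorEquiv (X.V ⊗[ℂ] Y.V) Z.V (tensorEquiv X.V Y.V ((p ⊗ₜ v) ⊗ₜ (q ⊗ₜ w)) ⊗ₜ (r ⊗ₜ u))) =
      tensorEquiv X.V (Y.V ⊗[ℂ] Z.V)
        ((p ⊗ₜ v) ⊗ₜ tensorEquiv Y.V Z.V ((q ⊗ₜ w) ⊗ₜ (r ⊗ₜ u)))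
    rw [tensorEquiv_tmul, tensorEquiv_tmul, tensorEquiv_tmul, tensorEquiv_tmul, mul_assoc]; rfl)
  left_unitality X := EquivBunConn.hom_ext (TensorProduct.ext' fun p x => lid_tensorEquiv p x)
  right_unitality X := EquivBunConn.hom_ext (TensorProduct.ext' fun x p => rid_tensorEquiv x p)

instance : hodgeBun.Monoidal := hodgeBunCore.toMonoidal

instance : hodgeBun.Braided where
  braided X Y := EquivBunConn.hom_ext (poly_tensor_ext fun p v q w => by
    change (TensorProduct.comm ℂ X.V Y.V).toLinearMap.baseChange Poly
        (Frame.tensorEquiv X.V Y.V ((p ⊗ₜ v) ⊗ₜ (q ⊗ₜ w))) =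
      Frame.tensorEquiv Y.V X.V ((q ⊗ₜ w) ⊗ₜ (p ⊗ₜ v))
    rw [Frame.tensorEquiv_tmul, Frame.tensorEquiv_tmul, mul_comm]; rfl)

/-! ### Compatibility with complex conjugation -/

open HodgeConn.Frame in
/-- The functor commutes with complex conjugation. -/
def hodgeBunConj : GammaAction.σ ⋙ hodgeBun ≅ hodgeBun ⋙ GammaAction.σ :=
  NatIso.ofComponents (fun X => EquivBunConn.isoMk
    (E := (hodgeFrame (ComplexMHS.conj X)).bun) (E' := EquivBunConn.conj (hodgeFrame X).bun)
    (conjBunEquiv X.V)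
    (mem_homs_left (X := ComplexMHS.conj X) (hodgeFrame_spec X).conj (hodgeFrame_spec _)
      (conjBunEquiv_mem _)))
    (fun {X Y} f => EquivBunConn.hom_ext (TensorProduct.AlgebraTensorModule.ext fun p v => by
      obtain ⟨v, rfl⟩ := (conjEquiv X.V).surjective v
      change conjBunEquiv Y.V (p ⊗ₜ conjEquiv Y.V (f.1 v)) =
        EquivBunConn.conjMapPoly (f.1.baseChange Poly) (conjBunEquiv X.V (p ⊗ₜ conjEquiv X.V v))
      rw [conjBunEquiv_tmul, conjBunEquiv_tmul]
      rfl))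

open HodgeConn.Frame in
theorem hodgeBunConj_monoidal : NatTrans.IsMonoidal hodgeBunConj.hom where
  unit := EquivBunConn.hom_ext (LinearMap.ext fun (p : Poly) => by
    change conjBunEquiv ℂ ((ComplexMHS.conjUnit.toLinearMap.baseChange Poly) (p ⊗ₜ (1 : ℂ))) =
      conjEquiv _ (polyConj p ⊗ₜ (1 : ℂ))
    have : ComplexMHS.conjUnit 1 = conjEquiv ℂ 1 := congrArg (conjEquiv ℂ) (map_one _)
    rw [LinearMap.baseChange_tmul, LinearEquiv.coe_coe, this, conjBunEquiv_tmul])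
  tensor X Y := EquivBunConn.hom_ext (poly_tensor_ext fun p v q w => by
    obtain ⟨v, rfl⟩ := (conjEquiv X.V).surjective v
    obtain ⟨w, rfl⟩ := (conjEquiv Y.V).surjective w
    change conjBunEquiv (X.V ⊗[ℂ] Y.V) ((ComplexMHS.conjTensor X.V Y.V).toLinearMap.baseChange Poly
        (tensorEquiv (Conj X.V) (Conj Y.V) ((p ⊗ₜ conjEquiv X.V v) ⊗ₜ (q ⊗ₜ conjEquiv Y.V w)))) =
      EquivBunConn.conjMapPoly (tensorEquiv X.V Y.V).toLinearMap
        (EquivBunConn.conjTensor _ _ (conjBunEquiv X.V (p ⊗ₜ conjEquiv X.V v) ⊗ₜ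
          conjBunEquiv Y.V (q ⊗ₜ conjEquiv Y.V w)))
    rw [tensorEquiv_tmul, LinearMap.baseChange_tmul, LinearEquiv.coe_coe,
      ComplexMHS.conjTensor_tmul, conjBunEquiv_tmul, conjBunEquiv_tmul, conjBunEquiv_tmul]
    change _ = conjEquiv _ (tensorEquiv X.V Y.V ((polyConj p ⊗ₜ v) ⊗ₜ (polyConj q ⊗ₜ w)))
    rw [tensorEquiv_tmul, map_mul])

open HodgeConn.Frame in
theorem hodgeBunConj_sq (X : ComplexMHS) :
    hodgeBun.map (GammaAction.sq.hom.app X) =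
      hodgeBunConj.hom.app (GammaAction.σ.obj X) ≫
        GammaAction.σ.map (hodgeBunConj.hom.app X) ≫ GammaAction.sq.hom.app (hodgeBun.obj X) :=
  EquivBunConn.hom_ext (TensorProduct.AlgebraTensorModule.ext fun p v => by
    obtain ⟨v, rfl⟩ := (conjEquiv (Conj X.V)).surjective v
    obtain ⟨v, rfl⟩ := (conjEquiv X.V).surjective v
    change p ⊗ₜ v = EquivBunConn.conjConj (Poly ⊗[ℂ] X.V)
      (EquivBunConn.conjMapPoly (conjBunEquiv X.V).toLinearMap
        (conjBunEquiv (Conj X.V) (p ⊗ₜ conjEquiv (Conj X.V) (conjEquiv X.V v))))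
    rw [conjBunEquiv_tmul]
    change _ = EquivBunConn.conjConj (Poly ⊗[ℂ] X.V) (conjEquiv _
      (conjBunEquiv X.V (polyConj p ⊗ₜ conjEquiv X.V v)))
    rw [conjBunEquiv_tmul, polyConj_polyConj]
    rfl)

/-! ### Independence of the characters of the torus -/

/-- Dedekind's independence of characters, applied to the values of an arbitrary linear form on the
coefficients. -/
theorem eq_zero_of_sum_torusChar {M : Type} [AddCommGroup M] [Module ℂ M] (s : Finset (Fin 2 → ℤ))
    (u : (Fin 2 → ℤ) → M) (h : ∀ l, ∑ a ∈ s, torusChar a l • u a = 0) : ∀ a ∈ s, u a = 0 := by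
  let χ : (Fin 2 → ℤ) → (Torus →* ℂ) := fun a =>
    ⟨⟨torusChar a, torusChar_one a⟩, torusChar_mul a⟩
  have hχ : Function.Injective χ := fun a b hab =>
    torusChar_injective fun l => DFunLike.congr_fun hab l
  have hli := (linearIndependent_monoidHom Torus ℂ).comp χ hχ
  intro a ha
  rw [← Module.forall_dual_apply_eq_zero_iff ℂ]
  intro φ
  refine linearIndependent_iff'.1 hli s (fun a => φ (u a)) ?_ a ha
  funext l
  have := congrArg φ (h l)
  rw [map_sum, map_zero] at this
  simp only [map_smul, smul_eq_mul] at this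
  rw [Finset.sum_apply, Pi.zero_apply, ← this]
  exact Finset.sum_congr rfl fun a _ => mul_comm _ _

namespace EquivBunConn

variable (E : EquivBunConn)

/-! ### The weights of the torus on the sections -/

/-- The sections of a given bidegree. -/
def weightSpace (a : Fin 2 → ℤ) : Submodule ℂ E.M where
  carrier := {m | ∀ l, E.act l m = torusChar a l • m}
  zero_mem' l := by rw [map_zero, smul_zero]
  add_mem' hm hn l := by rw [map_add, hm l, hn l, smul_add]
  smul_mem' c m hm l := by rw [map_smul, hm l, smul_comm]

/-- The coefficients of the Laurent polynomial `l ↦ l · m` are the weight components of `m`. The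
last clause says that an operator commuting with the torus which kills `m` kills each component; it
makes the horizontal sections a graded subspace. -/
theorem exists_weights (m : E.M) : ∃ (s : Finset (Fin 2 → ℤ)) (u : (Fin 2 → ℤ) → E.M),
    (∀ a ∈ s, u a ∈ E.weightSpace a) ∧ ∑ a ∈ s, u a = m ∧
      ∀ φ : Module.End ℂ E.M, (∀ l x, φ (E.act l x) = E.act l (φ x)) → φ m = 0 →
        ∀ a ∈ s, φ (u a) = 0 := by
  obtain ⟨c, hc⟩ := E.act_algebraic m
  have hc' : ∀ l, E.act l m = ∑ a ∈ c.support, torusChar a l • c a := hc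
  refine ⟨c.support, c, fun a ha l => ?_, ?_, fun φ hφ hm => ?_⟩
  · rw [← sub_eq_zero]
    refine eq_zero_of_sum_torusChar c.support (fun a => E.act l (c a) - torusChar a l • c a)
      (fun l' => ?_) a ha
    -- The action of `l * l'` is expanded in two ways and the coefficients of the characters of `l'`
    -- are compared.
    have h1 := hc' (l * l')
    rw [map_mul, Module.End.mul_apply, hc' l', map_sum] at h1
    simp only [smul_sub, Finset.sum_sub_distrib]
    rw [sub_eq_zero]
    simp only [map_smul] at h1
    rw [h1]
    refine Finset.sum_congr rfl fun a _ => ?_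
    rw [smul_smul, torusChar_mul, mul_comm]
  · have h1 := hc' 1
    rw [map_one, Module.End.one_apply] at h1
    rw [h1]
    exact Finset.sum_congr rfl fun a _ => by rw [torusChar_one, one_smul]
  · refine eq_zero_of_sum_torusChar c.support (fun a => φ (c a)) fun l => ?_
    have h1 := hφ l m
    rw [hm, map_zero, hc' l, map_sum] at h1
    simpa only [map_smul] using h1

/-- The multiplication by a coordinate. -/
def mulX (i : Fin 2) : Module.End ℂ E.M where
  toFun m := (MvPolynomial.X i : Poly) • m
  map_add' := smul_add _
  map_smul' _ _ := smul_comm _ _ _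

theorem mulX_apply (i : Fin 2) (m : E.M) : E.mulX i m = (MvPolynomial.X i : Poly) • m := rfl

/-- The action of the element `(2, 2)` of the torus. -/
def actTwo : Module.End ℂ E.M := E.act fun _ => Units.mk0 2 two_ne_zero

/-- The sections of a given total degree. -/
def totalSpace (n : ℤ) : Submodule ℂ E.M := Module.End.eigenspace E.actTwo (2 ^ n)

theorem weightSpace_le (a : Fin 2 → ℤ) : E.weightSpace a ≤ E.totalSpace (a 0 + a 1) := by
  intro m hm
  rw [totalSpace, Module.End.mem_eigenspace_iff, actTwo, hm]
  congr 1
  simp [torusChar, Fin.prod_univ_two, zpow_add₀]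

theorem mulX_totalSpace (i : Fin 2) {n : ℤ} {m : E.M} (hm : m ∈ E.totalSpace n) :
    E.mulX i m ∈ E.totalSpace (n + 1) := by
  rw [totalSpace, Module.End.mem_eigenspace_iff, actTwo] at hm ⊢
  rw [mulX_apply, E.act_smul, hm, torusPoly_apply, scaleHom_X, ← MvPolynomial.smul_eq_C_mul,
    smul_assoc, smul_comm _ ((2 : ℂ) ^ n), smul_smul, zpow_add₀ two_ne_zero, zpow_one, mul_comm]
  rfl

/-- The sections of total degree at least `w`. -/
def degreeGE (w : ℤ) : Submodule ℂ E.M := ⨆ n, ⨆ (_ : w ≤ n), E.totalSpace n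

theorem totalSpace_le {w n : ℤ} (h : w ≤ n) : E.totalSpace n ≤ E.degreeGE w :=
  le_iSup₂_of_le n h le_rfl

theorem degreeGE_anti {w w' : ℤ} (h : w ≤ w') : E.degreeGE w' ≤ E.degreeGE w :=
  iSup₂_le fun _ hn => E.totalSpace_le (h.trans hn)

theorem mulX_degreeGE (i : Fin 2) {w : ℤ} {m : E.M} (hm : m ∈ E.degreeGE w) :
    E.mulX i m ∈ E.degreeGE (w + 1) := by
  have : E.degreeGE w ≤ (E.degreeGE (w + 1)).comap (E.mulX i) :=
    iSup₂_le fun n hn m hm => E.totalSpace_le (by omega) (E.mulX_totalSpace i hm)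
  exact this hm

theorem smul_degreeGE {w : ℤ} (f : Poly) {m : E.M} (hm : m ∈ E.degreeGE w) :
    f • m ∈ E.degreeGE w := by
  induction f using MvPolynomial.induction_on with
  | C c =>
    rw [← MvPolynomial.algebraMap_eq, algebraMap_smul]
    exact Submodule.smul_mem _ _ hm
  | add p q hp hq => rw [add_smul]; exact add_mem hp hq
  | mul_X p i hp =>
    rw [mul_comm, mul_smul]
    exact E.degreeGE_anti (by omega) (E.mulX_degreeGE i hp)

theorem exists_mem_degreeGE (m : E.M) : ∃ w, m ∈ E.degreeGE w := by
  classical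
  obtain ⟨s, u, hu, rfl, -⟩ := E.exists_weights m
  induction s using Finset.induction_on with
  | empty => exact ⟨0, by simp⟩
  | insert a s ha ih =>
    obtain ⟨w, hw⟩ := ih fun a ha => hu a (Finset.mem_insert_of_mem ha)
    refine ⟨min w (a 0 + a 1), ?_⟩
    rw [Finset.sum_insert ha]
    exact add_mem (E.totalSpace_le (min_le_right _ _) (E.weightSpace_le a
      (hu a (Finset.mem_insert_self _ _)))) (E.degreeGE_anti (min_le_left _ _) hw)

/-- Finitely many generators have degrees bounded below, and multiplication by polynomials does not
lower degrees. -/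
theorem exists_degreeGE_eq_top : ∃ w, E.degreeGE w = ⊤ := by
  classical
  obtain ⟨S, hS⟩ := (Module.Finite.fg_top : (⊤ : Submodule Poly E.M).FG)
  have key : ∀ S : Finset E.M, ∃ w, ∀ m ∈ S, m ∈ E.degreeGE w := by
    intro S
    induction S using Finset.induction_on with
    | empty => exact ⟨0, by simp⟩
    | insert m S _ ih =>
      obtain ⟨w, hw⟩ := ih
      obtain ⟨w', hw'⟩ := E.exists_mem_degreeGE m
      refine ⟨min w w', fun x hx => ?_⟩
      rcases Finset.mem_insert.1 hx with rfl | hx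
      · exact E.degreeGE_anti (min_le_right _ _) hw'
      · exact E.degreeGE_anti (min_le_left _ _) (hw x hx)
  obtain ⟨w, hw⟩ := key S
  refine ⟨w, eq_top_iff.2 fun m _ => ?_⟩
  have hm : m ∈ Submodule.span Poly (S : Set E.M) := hS ▸ Submodule.mem_top
  induction hm using Submodule.span_induction with
  | mem m hm => exact hw m hm
  | zero => exact zero_mem _
  | add x y _ _ hx hy => exact add_mem (hx trivial) (hy trivial)
  | smul f x _ hx => exact E.smul_degreeGE f (hx trivial)

/-- Total degrees are encoded as the eigenvalues `2 ^ n` of a single operator, so independence of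
degrees is that of eigenspaces. -/
theorem eq_zero_of_mem_degreeGE {w n : ℤ} (h : n < w) {m : E.M} (hm : m ∈ E.totalSpace n)
    (hmw : m ∈ E.degreeGE w) : m = 0 := by
  have h1 := Module.End.eigenspaces_iSupIndep E.actTwo (2 ^ n)
  refine Submodule.disjoint_def.1 h1 m hm ?_
  have : E.degreeGE w ≤ ⨆ j, ⨆ (_ : j ≠ (2 : ℂ) ^ n), Module.End.eigenspace E.actTwo j := by
    refine iSup₂_le fun k hk => le_iSup₂_of_le ((2 : ℂ) ^ k) (fun hkn => ?_) le_rfl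
    have h2 : ((2 : ℝ) : ℂ) ^ k = ((2 : ℝ) : ℂ) ^ n := by push_cast; exact hkn
    rw [← Complex.ofReal_zpow, ← Complex.ofReal_zpow, Complex.ofReal_inj] at h2
    have := zpow_right_injective₀ (by norm_num) (by norm_num) h2
    omega
  exact this hmw

/-! ### The covariant derivative along the Euler vector field -/

/-- The covariant derivative along the Euler vector field. -/
def nablaEuler : Module.End ℂ E.M := E.nabla euler

theorem nablaEuler_eq (m : E.M) : E.nablaEuler m =
    E.mulX 0 (E.nabla (MvPolynomial.pderiv 0) m) + E.mulX 1 (E.nabla (MvPolynomial.pderiv 1) m) := by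
  rw [nablaEuler, euler, map_add, map_smul, map_smul]; rfl

theorem nablaEuler_mulX (i : Fin 2) (m : E.M) :
    E.nablaEuler (E.mulX i m) = E.mulX i m + E.mulX i (E.nablaEuler m) := by
  rw [mulX_apply, nablaEuler, E.leibniz, euler_X]; rfl

theorem nablaEuler_act (l : Torus) (m : E.M) :
    E.nablaEuler (E.act l m) = E.act l (E.nablaEuler m) := by
  rw [nablaEuler, E.nabla_equivariant, torusVect_euler]

/-- The powers of the ideal of the origin, times the module of sections. -/
def adic : ℕ → Submodule ℂ E.M
  | 0 => ⊤
  | k + 1 => (adic k).map (E.mulX 0) ⊔ (adic k).map (E.mulX 1)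

variable {E} in
theorem mem_adic_succ {k : ℕ} {m : E.M} : m ∈ E.adic (k + 1) ↔
    ∃ x ∈ E.adic k, ∃ y ∈ E.adic k, E.mulX 0 x + E.mulX 1 y = m := by
  rw [adic, Submodule.mem_sup]
  simp

/-- Since sections have degrees at least `w`, a given total degree meets only finitely many powers
of the ideal of the origin nontrivially. -/
theorem adic_le_degreeGE {w : ℤ} (hw : E.degreeGE w = ⊤) (k : ℕ) :
    E.adic k ≤ E.degreeGE (w + k) := by
  induction k with
  | zero => simp [hw]
  | succ k ih =>
    intro m hm
    obtain ⟨x, hx, y, hy, rfl⟩ := mem_adic_succ.1 hm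
    push_cast
    rw [← add_assoc]
    exact add_mem (E.mulX_degreeGE 0 (ih hx)) (E.mulX_degreeGE 1 (ih hy))

/-- At `k = 0` the Euler field vanishes at the origin, so `∇_E` takes values in the ideal times the
module; each coordinate factor then adds `1` by the Leibniz rule. -/
theorem nablaEuler_sub_mem_adic {k : ℕ} {m : E.M} (hm : m ∈ E.adic k) :
    E.nablaEuler m - (k : ℂ) • m ∈ E.adic (k + 1) := by
  induction k generalizing m with
  | zero =>
    rw [nablaEuler_eq, Nat.cast_zero, zero_smul, sub_zero]
    exact mem_adic_succ.2 ⟨_, trivial, _, trivial, rfl⟩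
  | succ k ih =>
    obtain ⟨x, hx, y, hy, rfl⟩ := mem_adic_succ.1 hm
    refine mem_adic_succ.2 ⟨_, ih hx, _, ih hy, ?_⟩
    simp only [map_add, map_sub, map_smul, nablaEuler_mulX, Nat.cast_add, Nat.cast_one, add_smul,
      one_smul, smul_add]
    abel

/-- The eigenspaces of the covariant derivative along the Euler vector field. -/
def eulerSpace (k : ℕ) : Submodule ℂ E.M := Module.End.eigenspace E.nablaEuler (k : ℂ)

variable {E} in
theorem mem_eulerSpace {k : ℕ} {m : E.M} :
    m ∈ E.eulerSpace k ↔ E.nablaEuler m = (k : ℂ) • m := Module.End.mem_eigenspace_iff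

theorem mulX_eulerSpace (i : Fin 2) {k : ℕ} {m : E.M} (hm : m ∈ E.eulerSpace k) :
    E.mulX i m ∈ E.eulerSpace (k + 1) := by
  rw [mem_eulerSpace] at hm ⊢
  rw [nablaEuler_mulX, hm, map_smul, Nat.cast_add, Nat.cast_one, add_smul, one_smul, add_comm]

/-- The sum of the eigenspaces for the eigenvalues at least `k`. -/
def eulerGE (k : ℕ) : Submodule ℂ E.M := ⨆ j, ⨆ (_ : k ≤ j), E.eulerSpace j

theorem eulerSpace_le {k j : ℕ} (h : k ≤ j) : E.eulerSpace j ≤ E.eulerGE k :=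
  le_iSup₂_of_le j h le_rfl

theorem eulerGE_anti {k k' : ℕ} (h : k ≤ k') : E.eulerGE k' ≤ E.eulerGE k :=
  iSup₂_le fun _ hj => E.eulerSpace_le (h.trans hj)

/-- `∇_E - k` acts on the eigenspace for `j > k` as the nonzero scalar `j - k`. -/
theorem exists_nablaEuler_sub (k : ℕ) {y : E.M} (hy : y ∈ E.eulerGE (k + 1)) :
    ∃ z ∈ E.eulerGE (k + 1), E.nablaEuler z - (k : ℂ) • z = y := by
  have : E.eulerGE (k + 1) ≤ (E.eulerGE (k + 1)).map (E.nablaEuler - (k : ℂ) • 1) := by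
    refine iSup₂_le fun j hj y hy => ⟨((j : ℂ) - k)⁻¹ • y,
      Submodule.smul_mem _ _ (E.eulerSpace_le hj hy), ?_⟩
    have hne : (j : ℂ) - k ≠ 0 := by
      rw [sub_ne_zero, Ne, Nat.cast_inj]; omega
    rw [LinearMap.sub_apply, map_smul, mem_eulerSpace.1 hy, LinearMap.smul_apply,
      Module.End.one_apply, smul_comm (k : ℂ), ← smul_sub, ← sub_smul, smul_smul,
      inv_mul_cancel₀ hne, one_smul]
  obtain ⟨z, hz, hzy⟩ := this hy
  exact ⟨z, hz, hzy⟩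

/-- Induction on the number `r` of adic steps before the degree bound forces vanishing. The defect
`∇_E m - k m` lies one step deeper and in the same total degree, hence in the sum of the eigenspaces
above `k`. There `∇_E - k` is onto, so `m` can be corrected to an eigenvector. -/
theorem mem_eulerGE {w : ℤ} (hw : E.degreeGE w = ⊤) {n : ℤ} (r k : ℕ) (hr : n < w + k + r) {m : E.M}
    (hm : m ∈ E.totalSpace n) (hk : m ∈ E.adic k) : m ∈ E.eulerGE k := by
  induction r generalizing k m with
  | zero =>
    rw [E.eq_zero_of_mem_degreeGE (by simpa using hr) hm (E.adic_le_degreeGE hw k hk)]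
    exact zero_mem _
  | succ r ih =>
    have h1 : E.nablaEuler m ∈ E.totalSpace n := by
      rw [totalSpace, Module.End.mem_eigenspace_iff] at hm ⊢
      have := E.nablaEuler_act (fun _ => Units.mk0 2 two_ne_zero) m
      change E.nablaEuler (E.actTwo m) = E.actTwo (E.nablaEuler m) at this
      rw [← this, hm, map_smul]
    obtain ⟨z, hz, hzm⟩ := E.exists_nablaEuler_sub k (ih (k + 1) (by push_cast at hr ⊢; omega)
      (sub_mem h1 (Submodule.smul_mem _ _ hm)) (E.nablaEuler_sub_mem_adic hk))
    -- `z` has the same defect as `m`, so the difference has none.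
    have h2 : m - z ∈ E.eulerSpace k := by
      rw [mem_eulerSpace, map_sub, smul_sub, sub_eq_sub_iff_sub_eq_sub]
      exact hzm.symm
    have := add_mem (E.eulerSpace_le le_rfl h2) (E.eulerGE_anti (Nat.le_succ k) hz)
    simpa using this

theorem iSup_eulerSpace : ⨆ k, E.eulerSpace k = ⊤ := by
  obtain ⟨w, hw⟩ := E.exists_degreeGE_eq_top
  refine eq_top_iff.2 fun m _ => ?_
  obtain ⟨s, u, hu, rfl, -⟩ := E.exists_weights m
  refine sum_mem fun a ha => ?_
  have h1 := E.mem_eulerGE hw (n := a 0 + a 1) ((a 0 + a 1 - w + 1).toNat) 0 (by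
    have := Int.self_le_toNat (a 0 + a 1 - w + 1)
    push_cast
    omega) (E.weightSpace_le a (hu a ha)) trivial
  exact (iSup₂_le fun j _ => le_iSup E.eulerSpace j : E.eulerGE 0 ≤ _) h1

theorem eulerSpace_disjoint (k : ℕ) {m : E.M} (hm : m ∈ E.eulerSpace k)
    (h : m ∈ ⨆ j, ⨆ (_ : j ≠ k), E.eulerSpace j) : m = 0 := by
  have h1 := Module.End.eigenspaces_iSupIndep E.nablaEuler (k : ℂ)
  refine Submodule.disjoint_def.1 h1 m hm ?_
  exact (iSup₂_le fun j hj => le_iSup₂_of_le (j : ℂ) (by rwa [Ne, Nat.cast_inj]) le_rfl :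
    (⨆ j, ⨆ (_ : j ≠ k), E.eulerSpace j) ≤ _) h

/-- The witness is the component of `x` with eigenvalue `k`; multiplication by a coordinate moves
the other components away from the eigenvalue `k + 1`. -/
theorem exists_eulerSpace_part (i : Fin 2) (k : ℕ) (x : E.M) : ∃ x' ∈ E.eulerSpace k,
    E.mulX i (x - x') ∈ ⨆ j, ⨆ (_ : j ≠ k + 1), E.eulerSpace j := by
  have hx : x ∈ ⨆ k, E.eulerSpace k := E.iSup_eulerSpace ▸ Submodule.mem_top
  refine Submodule.iSup_induction E.eulerSpace (motive := fun x => ∃ x' ∈ E.eulerSpace k,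
    E.mulX i (x - x') ∈ ⨆ j, ⨆ (_ : j ≠ k + 1), E.eulerSpace j) hx (fun j x hx => ?_) ?_
    fun x y hx hy => ?_
  · by_cases h : j = k
    · exact ⟨x, h ▸ hx, by rw [sub_self, map_zero]; exact zero_mem _⟩
    · refine ⟨0, zero_mem _, ?_⟩
      rw [sub_zero]
      exact (le_iSup₂_of_le (j + 1) (by omega) le_rfl :
        E.eulerSpace (j + 1) ≤ ⨆ j, ⨆ (_ : j ≠ k + 1), E.eulerSpace j) (E.mulX_eulerSpace i hx)
  · exact ⟨0, zero_mem _, by rw [sub_self, map_zero]; exact zero_mem _⟩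
  · obtain ⟨x', h1, h2⟩ := hx
    obtain ⟨y', h3, h4⟩ := hy
    refine ⟨x' + y', add_mem h1 h3, ?_⟩
    rw [add_sub_add_comm, map_add]
    exact add_mem h2 h4

/-- The sections which are horizontal along the Euler vector field generate the module. -/
theorem span_eulerSpace_zero : Submodule.span Poly (E.eulerSpace 0 : Set E.M) = ⊤ := by
  set U := Submodule.span Poly (E.eulerSpace 0 : Set E.M) with hU
  have key : ∀ k, E.eulerSpace k ≤ U.restrictScalars ℂ := by
    intro k
    induction k with
    | zero => exact fun m hm => Submodule.subset_span hm
    | succ k ih =>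
      intro m hm
      have h1 := mem_eulerSpace.1 hm
      rw [nablaEuler_eq] at h1
      obtain ⟨x, hx, hx'⟩ := E.exists_eulerSpace_part 0 k (E.nabla (MvPolynomial.pderiv 0) m)
      obtain ⟨y, hy, hy'⟩ := E.exists_eulerSpace_part 1 k (E.nabla (MvPolynomial.pderiv 1) m)
      -- For `m` with eigenvalue `k + 1`, the identity `(k + 1) m = t₁ ∇₁ m + t₂ ∇₂ m` remains true
      -- after replacing `∇₁ m` and `∇₂ m` by their components `x`, `y` with eigenvalue `k`. By
      -- induction these lie in the submodule generated by the kernel.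
      have h2 : ((k + 1 : ℕ) : ℂ) • m - (E.mulX 0 x + E.mulX 1 y) = 0 := by
        refine E.eulerSpace_disjoint (k + 1) (sub_mem (Submodule.smul_mem _ _ hm)
          (add_mem (E.mulX_eulerSpace 0 hx) (E.mulX_eulerSpace 1 hy))) ?_
        have h3 := add_mem hx' hy'
        rw [map_sub, map_sub, sub_add_sub_comm, h1] at h3
        exact h3
      have hne : ((k + 1 : ℕ) : ℂ) ≠ 0 := Nat.cast_ne_zero.2 (Nat.succ_ne_zero k)
      have h4 : m = (((k + 1 : ℕ) : ℂ)⁻¹) • (E.mulX 0 x + E.mulX 1 y) := by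
        rw [← sub_eq_zero.1 h2, smul_smul, inv_mul_cancel₀ hne, one_smul]
      rw [h4]
      exact Submodule.smul_mem _ _ (add_mem (U.smul_mem _ (ih hx)) (U.smul_mem _ (ih hy)))
  refine eq_top_iff.2 fun m _ => ?_
  have hm : m ∈ ⨆ k, E.eulerSpace k := E.iSup_eulerSpace ▸ Submodule.mem_top
  exact (iSup_le key : _ ≤ U.restrictScalars ℂ) hm

/-- Multiples of a coordinate only have components with positive eigenvalue, so a horizontal section
is determined by its value at the origin. -/
theorem eq_zero_of_mem_adic_one {m : E.M} (hm : m ∈ E.eulerSpace 0) (h : m ∈ E.adic 1) : m = 0 := by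
  obtain ⟨x, -, y, -, rfl⟩ := mem_adic_succ.1 h
  have key : ∀ i x, E.mulX i x ∈ ⨆ j, ⨆ (_ : j ≠ 0), E.eulerSpace j := by
    intro i x
    have hx : x ∈ ⨆ k, E.eulerSpace k := E.iSup_eulerSpace ▸ Submodule.mem_top
    have : (⨆ k, E.eulerSpace k) ≤ (⨆ j, ⨆ (_ : j ≠ 0), E.eulerSpace j).comap (E.mulX i) :=
      iSup_le fun k x hx => (le_iSup₂_of_le (k + 1) (by omega) le_rfl :
        E.eulerSpace (k + 1) ≤ ⨆ j, ⨆ (_ : j ≠ 0), E.eulerSpace j) (E.mulX_eulerSpace i hx)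
    exact this hx
  exact E.eulerSpace_disjoint 0 hm (add_mem (key 0 x) (key 1 y))

theorem smul_sub_mem_adic_one (f : Poly) (m : E.M) :
    f • m - MvPolynomial.constantCoeff f • m ∈ E.adic 1 := by
  induction f using MvPolynomial.induction_on with
  | C c =>
    rw [MvPolynomial.constantCoeff_C, ← MvPolynomial.algebraMap_eq, algebraMap_smul, sub_self]
    exact zero_mem _
  | add p q hp hq =>
    rw [add_smul, map_add, add_smul, add_sub_add_comm]
    exact add_mem hp hq
  | mul_X p i hp =>
    rw [map_mul, MvPolynomial.constantCoeff_X, mul_zero, zero_smul, sub_zero, mul_comm, mul_smul]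
    have : ∀ x, E.mulX i x ∈ E.adic 1 := by
      intro x
      fin_cases i
      · exact mem_adic_succ.2 ⟨x, trivial, 0, trivial, by simp⟩
      · exact mem_adic_succ.2 ⟨0, trivial, x, trivial, by simp⟩
    exact this _

instance finiteDimensional_eulerSpace_zero : FiniteDimensional ℂ (E.eulerSpace 0) := by
  have hfg : (Submodule.span Poly (E.eulerSpace 0 : Set E.M)).FG := by
    rw [span_eulerSpace_zero]; exact Module.Finite.fg_top
  obtain ⟨S, hS, hspan⟩ := (Submodule.fg_span_iff_fg_span_finset_subset _).1 hfg
  rw [span_eulerSpace_zero] at hspan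
  have hle : Submodule.span ℂ (S : Set E.M) ≤ E.eulerSpace 0 := Submodule.span_le.2 hS
  -- Finitely many horizontal sections generate the module, so their complex combinations reach
  -- every section modulo the ideal of the origin, where horizontal sections are separated.
  have key : ∀ m : E.M, ∃ s ∈ Submodule.span ℂ (S : Set E.M), m - s ∈ E.adic 1 := by
    intro m
    have hm : m ∈ Submodule.span Poly (S : Set E.M) := hspan ▸ Submodule.mem_top
    induction hm using Submodule.span_induction with
    | mem m hm => exact ⟨m, Submodule.subset_span hm, by rw [sub_self]; exact zero_mem _⟩
    | zero => exact ⟨0, zero_mem _, by rw [sub_self]; exact zero_mem _⟩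
    | add x y _ _ hx hy =>
      obtain ⟨s, hs, hs'⟩ := hx
      obtain ⟨t, ht, ht'⟩ := hy
      exact ⟨s + t, add_mem hs ht, by rw [add_sub_add_comm]; exact add_mem hs' ht'⟩
    | smul f x _ hx =>
      obtain ⟨s, hs, hs'⟩ := hx
      refine ⟨MvPolynomial.constantCoeff f • s, Submodule.smul_mem _ _ hs, ?_⟩
      have := add_mem (E.smul_sub_mem_adic_one f x)
        (Submodule.smul_mem _ (MvPolynomial.constantCoeff f) hs')
      rwa [smul_sub, sub_add_sub_cancel] at this
  have : E.eulerSpace 0 = Submodule.span ℂ (S : Set E.M) := by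
    refine le_antisymm (fun m hm => ?_) hle
    obtain ⟨s, hs, hs'⟩ := key m
    rwa [sub_eq_zero.1 (E.eq_zero_of_mem_adic_one (sub_mem hm (hle hs)) hs')]
  rw [this]
  exact FiniteDimensional.span_finset ℂ S

/-- The horizontal sections along the Euler vector field have a basis of bihomogeneous sections. -/
theorem exists_homogeneous_basis : ∃ (ι : Type) (b : Module.Basis ι ℂ (E.eulerSpace 0))
    (d : ι → Fin 2 → ℤ), ∀ k, (b k : E.M) ∈ E.weightSpace (d k) := by
  let S : Set (E.eulerSpace 0) := {v | ∃ a, (v : E.M) ∈ E.weightSpace a}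
  have hS : ⊤ ≤ Submodule.span ℂ S := by
    rintro ⟨m, hm⟩ -
    obtain ⟨s, u, hu, hsum, hφ⟩ := E.exists_weights m
    -- `∇_E` commutes with the torus, so the weight components of a horizontal section are
    -- horizontal.
    have hu0 : ∀ a ∈ s, u a ∈ E.eulerSpace 0 := fun a ha => by
      have := hφ E.nablaEuler E.nablaEuler_act (by
        rw [mem_eulerSpace.1 hm, Nat.cast_zero, zero_smul]) a ha
      rw [mem_eulerSpace, this, Nat.cast_zero, zero_smul]
    have : (⟨m, hm⟩ : E.eulerSpace 0) = ∑ a ∈ s.attach, ⟨u a, hu0 a a.2⟩ := by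
      refine Subtype.ext ?_
      rw [Submodule.coe_sum]
      exact hsum.symm.trans (Finset.sum_attach s u).symm
    rw [this]
    exact sum_mem fun a _ => Submodule.subset_span ⟨a, hu a a.2⟩
  choose d hd using fun k => Module.Basis.ofSpan_subset hS ⟨k, rfl⟩
  exact ⟨_, Module.Basis.ofSpan hS, d, hd⟩

end EquivBunConn

/-! ### Bihomogeneous polynomials and the linear relation between the coordinates -/

theorem coeff_torusPoly (l : Torus) (f : Poly) (s : Fin 2 →₀ ℕ) :
    (torusPoly l f).coeff s = torusChar (fun i => (s i : ℤ)) l * f.coeff s := by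
  classical
  induction f using MvPolynomial.induction_on' with
  | monomial u a =>
    rw [EquivBunConn.torusPoly_monomial, MvPolynomial.coeff_smul, smul_eq_mul,
      MvPolynomial.coeff_monomial]
    split_ifs with h
    · rw [h]
    · simp
  | add p q hp hq => rw [map_add, MvPolynomial.coeff_add, hp, hq, MvPolynomial.coeff_add, mul_add]

/-- The bihomogeneous polynomials are the multiples of monomials. -/
theorem exists_smul_mono {a : Fin 2 → ℤ} {f : Poly}
    (h : ∀ l, torusPoly l f = torusChar (a - 1) l • f) :
    ∃ c : ℂ, f = c • mono a ∧ (c ≠ 0 → ∀ i, 0 < a i) := by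
  classical
  have key : ∀ s, f.coeff s ≠ 0 → ∀ i, (s i : ℤ) = a i - 1 := by
    intro s hs i
    have : (fun i => (s i : ℤ)) = a - 1 := torusChar_injective fun l => by
      have h1 := congrArg (MvPolynomial.coeff s) (h l)
      rw [coeff_torusPoly, MvPolynomial.coeff_smul, smul_eq_mul] at h1
      exact mul_right_cancel₀ hs h1
    simpa using congrFun this i
  refine ⟨f.coeff (Finsupp.equivFunOnFinite.symm fun i => (a i - 1).toNat), ?_, fun hc i => ?_⟩
  · ext s
    rw [MvPolynomial.coeff_smul, mono, MvPolynomial.coeff_monomial, smul_eq_mul]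
    split_ifs with hs
    · rw [hs, mul_one]
    · rw [mul_zero]
      by_contra h0
      refine hs (Finsupp.ext fun i => ?_)
      have := key s h0 i
      simp only [Finsupp.coe_equivFunOnFinite_symm]
      omega
  · have := key _ hc i
    simp only [Finsupp.coe_equivFunOnFinite_symm] at this
    omega

/-- Exactness of the Koszul complex of `t₁, t₂`: `t₁` is prime and does not divide `t₂`. -/
theorem exists_eq_X_mul {f g : Poly}
    (h : (MvPolynomial.X 0 : Poly) * f + MvPolynomial.X 1 * g = 0) :
    ∃ n, f = - MvPolynomial.X 1 * n ∧ g = MvPolynomial.X 0 * n := by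
  have h1 : (MvPolynomial.X 0 : Poly) ∣ MvPolynomial.X 1 * g :=
    ⟨-f, by rw [mul_neg]; exact eq_neg_of_add_eq_zero_right h⟩
  obtain ⟨n, rfl⟩ := (MvPolynomial.X_prime.dvd_mul.1 h1).resolve_left fun h2 => by
    rw [MvPolynomial.X_dvd_X] at h2
    simp at h2
  refine ⟨n, ?_, rfl⟩
  have h3 : (MvPolynomial.X 0 : Poly) * (f + MvPolynomial.X 1 * n) = 0 := by rw [← h]; ring
  have h4 := (mul_eq_zero.1 h3).resolve_left (MvPolynomial.X_ne_zero 0)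
  rw [eq_neg_of_add_eq_zero_left h4, neg_mul]

namespace EquivBunConn

variable (E : EquivBunConn)

/-! ### The trivialization by the horizontal sections along the Euler vector field -/

/-- The homomorphism from the trivial bundle on the horizontal sections along the Euler vector
field. -/
def eulerLift : Poly ⊗[ℂ] E.eulerSpace 0 →ₗ[Poly] E.M :=
  (E.eulerSpace 0).subtype.liftBaseChange Poly

theorem eulerLift_tmul (f : Poly) (v : E.eulerSpace 0) : E.eulerLift (f ⊗ₜ v) = f • (v : E.M) :=
  LinearMap.liftBaseChange_tmul _ _ _ _

theorem eulerLift_surjective : Function.Surjective E.eulerLift := by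
  rw [← LinearMap.range_eq_top, eq_top_iff, ← span_eulerSpace_zero, Submodule.span_le]
  exact fun v hv => ⟨1 ⊗ₜ ⟨v, hv⟩, by rw [eulerLift_tmul, one_smul]⟩

/-- Modulo the ideal of the origin a relation between horizontal sections has constant coefficients.
By `eq_zero_of_mem_adic_one` these already give a relation over `ℂ`, hence vanish. -/
theorem constantCoeff_polyCoord {ι : Type} [Fintype ι] (b : Module.Basis ι ℂ (E.eulerSpace 0))
    {x : Poly ⊗[ℂ] E.eulerSpace 0} (hx : E.eulerLift x = 0) (j : ι) :
    MvPolynomial.constantCoeff (polyCoord b j x) = 0 := by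
  have h1 : ((∑ k, MvPolynomial.constantCoeff (polyCoord b k x) • b k : E.eulerSpace 0) : E.M) ∈
      E.adic 1 := by
    have h2 : ∑ k, polyCoord b k x • (b k : E.M) = 0 := by
      rw [← hx]
      conv_rhs => rw [← sum_polyCoord b x, map_sum]
      simp only [eulerLift_tmul]
    have h3 : ∑ k, (polyCoord b k x • (b k : E.M) -
        MvPolynomial.constantCoeff (polyCoord b k x) • (b k : E.M)) ∈ E.adic 1 :=
      sum_mem fun k _ => E.smul_sub_mem_adic_one _ _
    rw [Finset.sum_sub_distrib, h2, zero_sub, neg_mem_iff] at h3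
    simpa only [Submodule.coe_sum, Submodule.coe_smul] using h3
  have h4 : ∑ k, MvPolynomial.constantCoeff (polyCoord b k x) • b k = 0 :=
    Subtype.ext (E.eq_zero_of_mem_adic_one (Subtype.prop _) h1)
  exact Fintype.linearIndependent_iff.1 b.linearIndependent _ h4 j

theorem eulerLift_injective {ι : Type} [Fintype ι] (b : Module.Basis ι ℂ (E.eulerSpace 0)) :
    Function.Injective E.eulerLift := by
  -- Projectivity makes the kernel a direct summand, with projector `p = 1 - s ∘ eulerLift`. A
  -- kernel element has coordinates in the ideal `I` of the origin, and applying `p` to its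
  -- expansion puts it in `I` times the kernel.
  obtain ⟨s, hs⟩ := Module.projective_lifting_property E.eulerLift LinearMap.id
    E.eulerLift_surjective
  let I : Ideal Poly := RingHom.ker (MvPolynomial.constantCoeff : Poly →+* ℂ)
  have hle : LinearMap.ker E.eulerLift ≤ I • LinearMap.ker E.eulerLift := by
    intro x hx
    rw [LinearMap.mem_ker] at hx
    let p : Poly ⊗[ℂ] E.eulerSpace 0 →ₗ[Poly] Poly ⊗[ℂ] E.eulerSpace 0 :=
      LinearMap.id - s ∘ₗ E.eulerLift
    have hp : ∀ y, p y ∈ LinearMap.ker E.eulerLift := fun y => by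
      rw [LinearMap.mem_ker]
      change E.eulerLift (y - s (E.eulerLift y)) = 0
      rw [map_sub, sub_eq_zero]
      exact (LinearMap.congr_fun hs (E.eulerLift y)).symm
    have hpx : p x = x := by
      change x - s (E.eulerLift x) = x
      rw [hx, map_zero, sub_zero]
    rw [← hpx, ← sum_polyCoord b x, map_sum]
    refine sum_mem fun j _ => ?_
    have : polyCoord b j x ⊗ₜ[ℂ] b j = polyCoord b j x • ((1 : Poly) ⊗ₜ[ℂ] b j) := by
      rw [TensorProduct.smul_tmul', smul_eq_mul, mul_one]
    rw [this, map_smul]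
    exact Submodule.smul_mem_smul (RingHom.mem_ker.2 (E.constantCoeff_polyCoord b hx j)) (hp _)
  -- By Nakayama's lemma some `r ≡ 1` modulo `I` kills the kernel; it is nonzero and the free module
  -- has no torsion, so the kernel vanishes.
  obtain ⟨r, hr, hr0⟩ := Submodule.exists_sub_one_mem_and_smul_eq_zero_of_fg_of_le_smul I
    (LinearMap.ker E.eulerLift) (IsNoetherian.noetherian _) hle
  have hne : r ≠ 0 := by
    rintro rfl
    have := RingHom.mem_ker.1 hr
    simp at this
  rw [← LinearMap.ker_eq_bot, eq_bot_iff]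
  intro x hx
  rw [Submodule.mem_bot]
  refine polyCoord_ext b fun j => ?_
  have := congrArg (polyCoord b j) (hr0 x hx)
  rw [map_smul, map_zero, smul_eq_mul] at this
  rw [map_zero, (mul_eq_zero.1 this).resolve_left hne]

/-- The trivialization of the bundle by the horizontal sections along the Euler vector field. -/
def eulerEquiv {ι : Type} [Fintype ι] (b : Module.Basis ι ℂ (E.eulerSpace 0)) :
    Poly ⊗[ℂ] E.eulerSpace 0 ≃ₗ[Poly] E.M :=
  LinearEquiv.ofBijective E.eulerLift ⟨E.eulerLift_injective b, E.eulerLift_surjective⟩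

theorem exists_nabla_eq {ι : Type} [Fintype ι] (b : Module.Basis ι ℂ (E.eulerSpace 0))
    (v : E.eulerSpace 0) : ∃ x : Poly ⊗[ℂ] E.eulerSpace 0,
      ∀ D, E.nabla D v = rot D • E.eulerLift x := by
  obtain ⟨x₀, h₀⟩ := E.eulerLift_surjective (E.nabla (MvPolynomial.pderiv 0) v)
  obtain ⟨x₁, h₁⟩ := E.eulerLift_surjective (E.nabla (MvPolynomial.pderiv 1) v)
  -- Horizontality along the Euler field, read in the free module. Coordinate by coordinate it gives
  -- `x₀ = -t₂ n` and `x₁ = t₁ n`.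
  have h : (MvPolynomial.X 0 : Poly) • x₀ + (MvPolynomial.X 1 : Poly) • x₁ = 0 := by
    refine E.eulerLift_injective b ?_
    have := mem_eulerSpace.1 v.2
    rw [nablaEuler_eq, mulX_apply, mulX_apply, Nat.cast_zero, zero_smul] at this
    rw [map_add, map_smul, map_smul, h₀, h₁, this, map_zero]
  have hj : ∀ j, ∃ n, polyCoord b j x₀ = - MvPolynomial.X 1 * n ∧
      polyCoord b j x₁ = MvPolynomial.X 0 * n := fun j => exists_eq_X_mul (by
    simpa only [map_add, map_smul, smul_eq_mul, map_zero] using congrArg (polyCoord b j) h)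
  choose n hn₀ hn₁ using hj
  have e : ∀ g : Poly, g • ∑ j, n j ⊗ₜ[ℂ] b j = ∑ j, (g * n j) ⊗ₜ[ℂ] b j := fun g => by
    rw [Finset.smul_sum]
    exact Finset.sum_congr rfl fun j _ => by rw [TensorProduct.smul_tmul', smul_eq_mul]
  have hx₀ : x₀ = (- MvPolynomial.X 1 : Poly) • ∑ j, n j ⊗ₜ[ℂ] b j := by
    rw [e, ← sum_polyCoord b x₀]
    simp only [hn₀]
  have hx₁ : x₁ = (MvPolynomial.X 0 : Poly) • ∑ j, n j ⊗ₜ[ℂ] b j := by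
    rw [e, ← sum_polyCoord b x₁]
    simp only [hn₁]
  refine ⟨∑ j, n j ⊗ₜ[ℂ] b j, fun D => ?_⟩
  conv_lhs => rw [vectField_eq D]
  rw [map_add, map_smul, map_smul, LinearMap.add_apply, LinearMap.smul_apply, LinearMap.smul_apply,
    ← h₀, ← h₁, hx₀, hx₁, map_smul, map_smul, smul_smul, smul_smul, ← add_smul, rot_apply]
  congr 1
  ring

theorem act_eulerLift {ι : Type} [Fintype ι] {b : Module.Basis ι ℂ (E.eulerSpace 0)}
    {d : ι → Fin 2 → ℤ} (hd : ∀ k, (b k : E.M) ∈ E.weightSpace (d k)) (l : Torus)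
    (x : Poly ⊗[ℂ] E.eulerSpace 0) : E.act l (E.eulerLift x) =
      E.eulerLift (∑ j, (torusChar (d j) l • torusPoly l (polyCoord b j x)) ⊗ₜ b j) := by
  conv_lhs => rw [← sum_polyCoord b x]
  simp only [map_sum, eulerLift_tmul]
  refine Finset.sum_congr rfl fun j _ => ?_
  rw [E.act_smul, hd j l, smul_comm, smul_assoc]

/-- The equivariance of the connection, tested on `∂₂` where the contracted form is `t₁`. After
cancelling `t₁`, the `j`-th coordinate of the coefficient at `b k` has weight `d_k - 1` minus the
weight `d_j` of `b j`. -/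
theorem torusPoly_polyCoord {ι : Type} [Fintype ι] {b : Module.Basis ι ℂ (E.eulerSpace 0)}
    {d : ι → Fin 2 → ℤ} (hd : ∀ k, (b k : E.M) ∈ E.weightSpace (d k)) {k : ι}
    {x : Poly ⊗[ℂ] E.eulerSpace 0} (hx : ∀ D, E.nabla D (b k) = rot D • E.eulerLift x) (j : ι)
    (l : Torus) : torusPoly l (polyCoord b j x) =
      torusChar (d k - d j - 1) l • polyCoord b j x := by
  classical
  have h1 := E.nabla_equivariant l (MvPolynomial.pderiv 1) (b k)
  have h2 : (torusPoly l (MvPolynomial.X 0)) • E.act l (E.eulerLift x) =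
      torusPoly l (MvPolynomial.X 0) • torusChar (d k - 1) l • E.eulerLift x := by
    rw [hd k l, map_smul, hx, hx, E.act_smul, rot_torusVect, rot_pderiv_one] at h1
    rw [h1, smul_assoc, smul_smul, ← torusChar_add, smul_comm]
    congr 3
  have hne : torusPoly l (MvPolynomial.X 0) ≠ 0 :=
    (map_ne_zero_iff _ (torusPoly l).injective).2 (MvPolynomial.X_ne_zero 0)
  rw [act_eulerLift E hd, ← algebraMap_smul Poly (torusChar (d k - 1) l), ← map_smul, ← map_smul,
    ← map_smul] at h2
  have h3 := congrArg (polyCoord b j) (E.eulerLift_injective b h2)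
  rw [map_smul, map_smul, smul_eq_mul, smul_eq_mul, map_smul, map_sum] at h3
  have h4 := mul_left_cancel₀ hne h3
  simp only [polyCoord_tmul, Module.Basis.repr_self, Finsupp.single_apply, ite_smul, one_smul,
    zero_smul, Finset.sum_ite_eq', Finset.mem_univ, if_true] at h4
  rw [algebraMap_smul] at h4
  have h5 : torusChar (d k - d j - 1) l = torusChar (-d j) l * torusChar (d k - 1) l := by
    rw [← torusChar_add]; congr 1; abel
  rw [h5, mul_smul, ← h4, smul_smul, torusChar_neg_mul, one_smul]

/-- Every equivariant bundle with connection comes from a frame. -/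
theorem exists_frame_bun : ∃ (B : Frame (E.eulerSpace 0))
    (e : Poly ⊗[ℂ] E.eulerSpace 0 ≃ₗ[Poly] E.M), e.toLinearMap ∈ homs B.bun E := by
  obtain ⟨ι, b, d, hd⟩ := E.exists_homogeneous_basis
  let _ : Fintype ι := FiniteDimensional.fintypeBasisIndex b
  choose x hx using fun k => E.exists_nabla_eq b (b k)
  -- The coordinates are bihomogeneous, hence `c` times a monomial. A nonzero `c` needs nonnegative
  -- exponents `d_k - d_j - 1`, which says that the operator with matrix `c` strictly lowers both
  -- degrees.
  choose c hc hc' using fun k j => exists_smul_mono (a := d k - d j) fun l =>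
    E.torusPoly_polyCoord hd (hx k) j l
  have hrepr : ∀ j k, b.repr (b.constr ℂ (fun k => ∑ j, c k j • b j) (b k)) j = c k j := by
    intro j k
    rw [Module.Basis.constr_basis, Module.Basis.repr_sum_self]
  let B : Frame (E.eulerSpace 0) :=
    { ι := ι
      b := b
      d := d
      δ := b.constr ℂ fun k => ∑ j, c k j • b j
      δ_mem := fun j k h i => by
        rw [hrepr] at h
        have := hc' k j h i
        simp only [Pi.sub_apply] at this
        omega }
  have hN : ∀ k : ι, B.N₀ (b k) = x k := fun k => by
    refine polyCoord_ext b fun j => ?_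
    have h1 := B.N₀_b k
    have h2 := B.polyCoord_θ (d k) (B.δ (b k)) j
    change B.N₀ (b k) = B.θ (d k) (B.δ (b k)) at h1
    change polyCoord b j (B.θ (d k) (B.δ (b k))) = b.repr _ j • mono (d k - d j) at h2
    rw [h1, h2, hc k j]
    congr 1
    exact hrepr j k
  refine ⟨B, E.eulerEquiv b, mem_homs_of_span (span_one_tmul_basis b) _ ?_ ?_⟩
  · rintro l _ ⟨k, rfl⟩
    change E.eulerLift (B.bunAct l (1 ⊗ₜ b k)) = E.act l (E.eulerLift (1 ⊗ₜ b k))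
    have h1 : B.ρ l (b k) = torusChar (d k) l • b k := B.ρ_b l k
    rw [Frame.bunAct_tmul, h1, map_one, eulerLift_tmul, eulerLift_tmul, one_smul, one_smul, hd k l]
    rfl
  · rintro D _ ⟨k, rfl⟩
    change E.eulerLift (B.bunNabla D (1 ⊗ₜ b k)) = E.nabla D (E.eulerLift (1 ⊗ₜ b k))
    rw [Frame.bunNabla_one_tmul, hN, map_smul, eulerLift_tmul, one_smul, hx]

end EquivBunConn

/-! ### Essential surjectivity -/

instance : hodgeBun.EssSurj where
  mem_essImage E := by
    obtain ⟨B, e, he⟩ := E.exists_frame_bun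
    -- `B` is by definition a frame of the mixed Hodge structure it defines, so its bundle is that
    -- of the frame chosen by `hodgeFrame`.
    exact ⟨B.mhs, ⟨EquivBunConn.isoMk (E := (hodgeFrame B.mhs).bun) e
      (Frame.mem_homs_left (X := B.mhs) (B := B) ⟨fun _ => rfl, fun _ => rfl, fun _ => rfl⟩
        (hodgeFrame_spec _) he)⟩⟩

instance : hodgeBun.IsEquivalence where

end HodgeConn

end

/-- The category of complex mixed Hodge structures is equivalent, as a (`ℂ`-linear, symmetric)
tensor category with action of `Gal(ℂ/ℝ)`, to the category of `𝔾_m²`-equivariant algebraic vector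
bundles with equivariant connection on the affine plane over `ℂ`. -/
theorem mainTheorem2 :
    ∃ (F : HodgeConn.ComplexMHS ⥤ HodgeConn.EquivBunConn) (_ : F.Braided),
      F.IsEquivalence ∧ F.Additive ∧ F.Linear ℂ ∧
      ∃ γ : HodgeConn.GammaAction.σ ⋙ F ≅ F ⋙ HodgeConn.GammaAction.σ,
        NatTrans.IsMonoidal γ.hom ∧
        ∀ X : HodgeConn.ComplexMHS,
          F.map (HodgeConn.GammaAction.sq.hom.app X) =
            γ.hom.app (HodgeConn.GammaAction.σ.obj X) ≫
              HodgeConn.GammaAction.σ.map (γ.hom.app X) ≫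
                HodgeConn.GammaAction.sq.hom.app (F.obj X) :=
  ⟨HodgeConn.hodgeBun, inferInstance, inferInstance, inferInstance, inferInstance,
    HodgeConn.hodgeBunConj, HodgeConn.hodgeBunConj_monoidal, HodgeConn.hodgeBunConj_sq⟩
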